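/- **Conventions.** $\mathsf{Fib}$ denotes the strict $2$-category of cloven fibrations over arbitrary base categories: objects are functors $\Pi\colon\mathbb X'\to\mathbb X$ with a chosen Cartesian lift of every $f\colon M\to\Pi E$; $1$-morphisms $(F,F')\colon\Pi_1\to\Pi_2$ are pairs of functors with $\Pi_2F'=F\Pi_1$ such that $F'$ sends Cartesian lifts of $f$ to Cartesian lifts of $Ff$ (the chosen lifts need not be preserved); $2$-morphisms are pairs of natural transformations, the one between the total categories lying over the one between the base categories. A $2$-category admits *PIE limits* if it admits all small $2$-products, inserters and equifiers (with universal properties expressed by isomorphisms of Hom-categories). A *tangentad* $(\mathbb X,\mathbb T)$ in a $2$-category $\mathbf K$ is an object $\mathbb X$ with a $1$-endomorphism $T$ and $2$-morphisms $p\colon T\Rightarrow\mathsf{id}$, $z\colon\mathsf{id}\Rightarrow T$, $s\colon T_2\Rightarrow T$, $l\colon T\Rightarrow T^2$, $c\colon T^2\Rightarrow T^2$ satisfying the axioms of a tangent category (Rosický, Cockett–Cruttwell); here $T_n$ is the $n$-fold pullback of $p$ along itself, it is preserved by the iterates of $T$, and this pullback and the one in the universality of the vertical lift are pointwise, that is,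 preserved by precomposition with every $1$-morphism into $\mathbb X$. A *lax tangent morphism* $(F,\alpha)\colon(\mathbb X_1,\mathbb T_1)\to(\mathbb X_2,\mathbb T_2)$ is a $1$-morphism $F\colon\mathbb X_1\to\mathbb X_2$ with a $2$-morphism $\alpha\colon FT_1\Rightarrow T_2F$ compatible with $p,z,s,l,c$; it is *strict* if $FT_1=T_2F$ and $\alpha=\mathsf{id}$. A *tangent $2$-morphism* is a $2$-morphism compatible with the distributive laws $\alpha$. The category $[\mathbb Y,\mathbb T_{\mathbb Y}\|\mathbb X,\mathbb T]$ of lax tangent morphisms and tangent $2$-morphisms is a tangent category, with tangent bundle functor $\bar T(F,\alpha)=(T,c)\circ(F,\alpha)$ and with projection, zero, sum, vertical lift and flip given by postcomposition with those of $\mathbb T$. A *vector field* in a tangent category $(\mathbb X,\mathbb T)$ is a pair $(M,v)$ with $v\colon M\to TM$ and $p_M v=\mathsf{id}_M$; a morphism $(M,v)\to(N,u)$ is $f\colon M\to N$ with $Tf\circ v=u\circ f$. They form a tangent category $\mathsf{VF}(\mathbb X,\mathbb T)$ with tangent bundle functor $(M,v)\mapsto(TM,c_M\circ Tv)$ and with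 structural natural transformations those of $\mathbb T$. A tangentad $(\mathbb X,\mathbb T)$ of $\mathbf K$ *admits the construction of vector fields* if there are a tangentad $\mathbb V$, called the tangentad of vector fields of $(\mathbb X,\mathbb T)$, a strict tangent morphism $U\colon\mathbb V\to(\mathbb X,\mathbb T)$ and a vector field $\mathsf v\colon U\to\bar TU$ in $[\mathbb V\|\mathbb X,\mathbb T]$ such that for every tangentad $\mathbb Y$ the functor $$\Gamma_{\mathsf v}\colon[\mathbb Y\|\mathbb V]\to\mathsf{VF}[\mathbb Y\|\mathbb X,\mathbb T],\qquad H\mapsto(U\circ H,\ \mathsf v_H\colon UH\to\bar TUH)$$ is an isomorphism of categories (it is then an isomorphism of tangent categories, since $U$ is strict). $\mathbf K$ admits the construction of vector fields if each of its tangentads does. A *tangent fibration* $\Pi\colon(\mathbb X',\mathbb T')\to(\mathbb X,\mathbb T)$ is a cloven fibration between tangent categories that is a strict tangent morphism, with chosen pullbacks satisfying $\Pi T'_n=T_n\Pi$ strictly and compatibly with the projections, and whose pairs $(T,T')$ and $(T_n,T'_n)$ are $1$-morphisms of $\mathsf{Fib}$. **Theorem.** 1. The $2$-category $\mathsf{Fib}$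 admits PIE limits. 2. $\mathsf{Fib}$ admits the construction of vector fields. 3. Let $\Pi\colon(\mathbb X',\mathbb T')\to(\mathbb X,\mathbb T)$ be a tangent fibration. Then the functor $$\mathsf{VF}(\Pi)\colon\mathsf{VF}(\mathbb X',\mathbb T')\to\mathsf{VF}(\mathbb X,\mathbb T),\qquad(E,w)\mapsto(\Pi E,\Pi w),$$ with the cleavage induced by that of $\Pi$, is a tangent fibration. Moreover $\Pi$ and $\mathsf{VF}(\Pi)$ are tangentads in $\mathsf{Fib}$, and $\mathsf{VF}(\Pi)$ is the tangentad of vector fields of $\Pi$, where $U$ is the pair of forgetful functors $(M,v)\mapsto M$, $(E,w)\mapsto E$, and where the universal vector field $\mathsf v$ has the components $v\colon M\to TM$ at $(M,v)$ and $w\colon E\to T'E$ at $(E,w)$. -/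

import Mathlib

open CategoryTheory Bicategory Limits

universe w v u

namespace TangentFib

section General

variable {C : Type u} [Category.{v} C]

/-- `(b, π)` exhibits `P` as the `n`-fold pullback of `q` along itself
(the `0`-fold pullback being `B` itself). -/
def IsFiberPower {E B P : C} (q : E ⟶ B) {n : ℕ} (b : P ⟶ B) (π : Fin n → (P ⟶ E)) : Prop :=
  ∃ h : ∀ i, π i ≫ q = b, Nonempty (IsLimit (WidePullbackCone.mk (f := fun _ => q) b π h))

lemma IsFiberPower.exists_lift {E B P : C} {q : E ⟶ B} {n : ℕ} {b : P ⟶ B}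
    {π : Fin n → (P ⟶ E)} (h : IsFiberPower q b π) {Z : C} (b' : Z ⟶ B) (π' : Fin n → (Z ⟶ E))
    (hq : ∀ i, π' i ≫ q = b') : ∃ f : Z ⟶ P, f ≫ b = b' ∧ ∀ i, f ≫ π i = π' i := by
  obtain ⟨hπ, ⟨hl⟩⟩ := h
  let t : WidePullbackCone (fun _ : Fin n => q) := WidePullbackCone.mk b' π' hq
  exact ⟨hl.lift t, hl.fac t none, fun i => hl.fac t (some i)⟩

lemma IsFiberPower.hom_ext {E B P : C} {q : E ⟶ B} {n : ℕ} {b : P ⟶ B}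
    {π : Fin n → (P ⟶ E)} (h : IsFiberPower q b π) {Z : C} {f g : Z ⟶ P} (hb : f ≫ b = g ≫ b)
    (hq : ∀ i, f ≫ π i = g ≫ π i) : f = g := by
  obtain ⟨hπ, ⟨hl⟩⟩ := h
  refine hl.hom_ext fun j => ?_
  cases j with
  | none => exact hb
  | some i => exact hq i

lemma IsFiberPower.comp_eq {E B P : C} {q : E ⟶ B} {n : ℕ} {b : P ⟶ B}
    {π : Fin n → (P ⟶ E)} (h : IsFiberPower q b π) (i : Fin n) : π i ≫ q = b := h.1 i

end General

section TwoCat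

variable {K : Type u} [Bicategory.{w, v} K]

/-- The iterates of a `1`-endomorphism. -/
def iter {X : K} (T : X ⟶ X) : ℕ → (X ⟶ X)
  | 0 => 𝟙 X
  | k + 1 => iter T k ≫ T

/-- The data of a tangent structure on an object `X`. Composition of `1`-morphisms is written in
diagrammatic order (`F ≫ G` is `G ∘ F`); hence, for `α : G ⟶ H`, the whiskering `α ▷ T` is the
usual `Tα` (apply `T` to `α`), while `T ◁ α` is the usual `α_T` (evaluate `α` at `T`).

* `T` is the tangent bundle `1`-morphism and `p` its projection;
* `Tn n`, with `leg n : Tn n ⟶ 𝟙 X` and `proj n i : Tn n ⟶ T`, is the `n`-fold pullback of `p`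
  along itself;
* `z`, `s`, `l`, `c` are the zero morphism, the sum, the vertical lift and the canonical flip. -/
structure TangentData (X : K) where
  T : X ⟶ X
  p : T ⟶ 𝟙 X
  Tn : ℕ → (X ⟶ X)
  leg (n : ℕ) : Tn n ⟶ 𝟙 X
  proj (n : ℕ) : Fin n → (Tn n ⟶ T)
  z : 𝟙 X ⟶ T
  s : Tn 2 ⟶ T
  l : T ⟶ T ≫ T
  c : T ≫ T ⟶ T ≫ T

namespace TangentData

variable {X : K} (D : TangentData X)

/-- The first projection `π₁ : T₂ ⟶ T`. -/
abbrev pr₁ : D.Tn 2 ⟶ D.T := D.proj 2 0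

/-- The second projection `π₂ : T₂ ⟶ T`. -/
abbrev pr₂ : D.Tn 2 ⟶ D.T := D.proj 2 1

/-- The axioms of a tangentad. The morphisms that the axioms induce by the universal property of a
pullback are introduced as the morphisms with the given components.

* `isFiberPower`: `Tn n` is the pointwise `n`-fold pullback of `p` along itself, and each iterate of
  `T` preserves it; pointwise means: after precomposition with any `1`-morphism `F : Y ⟶ X`.
* `z_p`, `s_p`, `s_assoc`, `s_unit`, `s_comm`: `(p, z, s)` is a commutative monoid over `𝟙 X`.
* `l_p`, `z_l`, `s_l`: `(z, l)` is an additive bundle morphism from `p` to `Tp`.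
* `c_p`, `z_c`, `s_c`: `(id, c)` is an additive bundle morphism from `Tp` to `p_T`.
* `l_l`, `l_c`, `c_l`: coassociativity of `l`, and its compatibility with `c`.
* `c_c`, `yang_baxter`: `c` is a symmetric braiding.
* `universal`: the square with top side `⟨l π₁, z_T π₂⟩` followed by `Ts`, left side `p π₁`, right
  side `Tp` and bottom side `z`, is a pointwise pullback. -/
structure IsTangentad : Prop where
  isFiberPower (n : ℕ) {Y : K} (F : Y ⟶ X) (k : ℕ) :
    IsFiberPower (F ◁ (D.p ▷ iter D.T k)) (F ◁ (D.leg n ▷ iter D.T k))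
      (fun i => F ◁ (D.proj n i ▷ iter D.T k))
  z_p : D.z ≫ D.p = 𝟙 (𝟙 X)
  s_p : D.s ≫ D.p = D.pr₁ ≫ D.p
  s_assoc : ∃ e₁ e₂ g₁ g₂ : D.Tn 3 ⟶ D.Tn 2,
    (e₁ ≫ D.pr₁ = D.proj 3 0 ∧ e₁ ≫ D.pr₂ = D.proj 3 1) ∧
    (e₂ ≫ D.pr₁ = D.proj 3 1 ∧ e₂ ≫ D.pr₂ = D.proj 3 2) ∧
    (g₁ ≫ D.pr₁ = e₁ ≫ D.s ∧ g₁ ≫ D.pr₂ = D.proj 3 2) ∧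
    (g₂ ≫ D.pr₁ = D.proj 3 0 ∧ g₂ ≫ D.pr₂ = e₂ ≫ D.s) ∧
    g₁ ≫ D.s = g₂ ≫ D.s
  s_unit : ∃ g : D.T ⟶ D.Tn 2, g ≫ D.pr₁ = D.p ≫ D.z ∧ g ≫ D.pr₂ = 𝟙 D.T ∧ g ≫ D.s = 𝟙 D.T
  s_comm : ∃ τ : D.Tn 2 ⟶ D.Tn 2, τ ≫ D.pr₁ = D.pr₂ ∧ τ ≫ D.pr₂ = D.pr₁ ∧ τ ≫ D.s = D.s
  l_p : D.l ≫ D.p ▷ D.T ≫ (λ_ D.T).hom = D.p ≫ D.z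
  z_l : D.z ≫ D.l = D.z ≫ (λ_ D.T).inv ≫ D.z ▷ D.T
  s_l : ∃ g : D.Tn 2 ⟶ D.Tn 2 ≫ D.T,
    g ≫ D.pr₁ ▷ D.T = D.pr₁ ≫ D.l ∧ g ≫ D.pr₂ ▷ D.T = D.pr₂ ≫ D.l ∧
    D.s ≫ D.l = g ≫ D.s ▷ D.T
  c_p : D.c ≫ D.T ◁ D.p ≫ (ρ_ D.T).hom = D.p ▷ D.T ≫ (λ_ D.T).hom
  z_c : (λ_ D.T).inv ≫ D.z ▷ D.T ≫ D.c = (ρ_ D.T).inv ≫ D.T ◁ D.z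
  s_c : ∃ g : D.Tn 2 ≫ D.T ⟶ D.T ≫ D.Tn 2,
    g ≫ D.T ◁ D.pr₁ = D.pr₁ ▷ D.T ≫ D.c ∧ g ≫ D.T ◁ D.pr₂ = D.pr₂ ▷ D.T ≫ D.c ∧
    D.s ▷ D.T ≫ D.c = g ≫ D.T ◁ D.s
  l_l : D.l ≫ D.l ▷ D.T ≫ (α_ _ _ _).hom = D.l ≫ D.T ◁ D.l
  l_c : D.l ≫ D.c = D.l
  c_l : D.T ◁ D.l ≫ (α_ _ _ _).inv ≫ D.c ▷ D.T ≫ (α_ _ _ _).hom ≫ D.T ◁ D.c =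
    D.c ≫ D.l ▷ D.T ≫ (α_ _ _ _).hom
  c_c : D.c ≫ D.c = 𝟙 (D.T ≫ D.T)
  yang_baxter :
    D.c ▷ D.T ≫ (α_ _ _ _).hom ≫ D.T ◁ D.c ≫ (α_ _ _ _).inv ≫ D.c ▷ D.T =
      (α_ _ _ _).hom ≫ D.T ◁ D.c ≫ (α_ _ _ _).inv ≫ D.c ▷ D.T ≫ (α_ _ _ _).hom ≫
        D.T ◁ D.c ≫ (α_ _ _ _).inv
  universal : ∃ g : D.Tn 2 ⟶ D.Tn 2 ≫ D.T,
    g ≫ D.pr₁ ▷ D.T = D.pr₁ ≫ D.l ∧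
    g ≫ D.pr₂ ▷ D.T = D.pr₂ ≫ (ρ_ D.T).inv ≫ D.T ◁ D.z ∧
    ∀ {Y : K} (F : Y ⟶ X),
      IsPullback (F ◁ (g ≫ D.s ▷ D.T)) (F ◁ (D.pr₁ ≫ D.p))
        (F ◁ (D.p ▷ D.T)) (F ◁ (D.z ≫ (λ_ D.T).inv))

end TangentData

variable (K) in
/-- A tangentad in `K`: an object of `K` with a tangent structure. -/
structure Tangentad where
  X : K
  data : TangentData X
  isTangentad : data.IsTangentad

/-- The distributive law `F T² ⟶ T² F` (in the usual order of composition) obtained by applying the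
distributive law `α : F T ⟶ T F` twice. -/
def doubleLaw {A B : Tangentad K} (F : A.X ⟶ B.X) (α : A.data.T ≫ F ⟶ F ≫ B.data.T) :
    (A.data.T ≫ A.data.T) ≫ F ⟶ F ≫ B.data.T ≫ B.data.T :=
  (α_ _ _ _).hom ≫ A.data.T ◁ α ≫ (α_ _ _ _).inv ≫ α ▷ B.data.T ≫ (α_ _ _ _).hom

/-- Compatibility of a distributive law `α` with the two tangent structures: `(F, α)` is a lax tangent
morphism. In `s`, the morphism `g` is the induced distributive law `F T₂ ⟶ T₂ F`. -/
structure IsLax {A B : Tangentad K} (F : A.X ⟶ B.X)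
    (α : A.data.T ≫ F ⟶ F ≫ B.data.T) : Prop where
  p : α ≫ F ◁ B.data.p ≫ (ρ_ F).hom = A.data.p ▷ F ≫ (λ_ F).hom
  z : A.data.z ▷ F ≫ α = (λ_ F).hom ≫ (ρ_ F).inv ≫ F ◁ B.data.z
  s : ∃ g : A.data.Tn 2 ≫ F ⟶ F ≫ B.data.Tn 2,
    g ≫ F ◁ B.data.pr₁ = A.data.pr₁ ▷ F ≫ α ∧ g ≫ F ◁ B.data.pr₂ = A.data.pr₂ ▷ F ≫ α ∧
    A.data.s ▷ F ≫ α = g ≫ F ◁ B.data.s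
  l : A.data.l ▷ F ≫ doubleLaw F α = α ≫ F ◁ B.data.l
  c : A.data.c ▷ F ≫ doubleLaw F α = doubleLaw F α ≫ F ◁ B.data.c

/-- Lax tangent morphisms between tangentads. -/
structure LaxMor (A B : Tangentad K) where
  F : A.X ⟶ B.X
  law : A.data.T ≫ F ⟶ F ≫ B.data.T
  isLax : IsLax F law

/-- Tangent `2`-morphisms: `2`-morphisms compatible with the distributive laws. -/
@[ext]
structure LaxMor.Hom {A B : Tangentad K} (F G : LaxMor A B) where
  hom : F.F ⟶ G.F
  comm : F.law ≫ hom ▷ B.data.T = A.data.T ◁ hom ≫ G.law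

/-- The Hom-category of lax tangent morphisms and tangent `2`-morphisms. -/
instance (A B : Tangentad K) : Category (LaxMor A B) where
  Hom F G := LaxMor.Hom F G
  id F := ⟨𝟙 F.F, by simp⟩
  comp f g := ⟨f.hom ≫ g.hom, by
    rw [comp_whiskerRight, ← Category.assoc, f.comm, Category.assoc, g.comm, whiskerLeft_comp,
      Category.assoc]⟩
  id_comp _ := LaxMor.Hom.ext (Category.id_comp _)
  comp_id _ := LaxMor.Hom.ext (Category.comp_id _)
  assoc _ _ _ := LaxMor.Hom.ext (Category.assoc _ _ _)

@[simp] lemma LaxMor.id_hom {A B : Tangentad K} (F : LaxMor A B) :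
    LaxMor.Hom.hom (𝟙 F) = 𝟙 F.F := rfl

@[simp] lemma LaxMor.comp_hom {A B : Tangentad K} {F G H : LaxMor A B} (f : F ⟶ G) (g : G ⟶ H) :
    LaxMor.Hom.hom (f ≫ g) = f.hom ≫ g.hom := rfl

@[ext] lemma LaxMor.hom_ext {A B : Tangentad K} {F G : LaxMor A B} {f g : F ⟶ G}
    (h : LaxMor.Hom.hom f = LaxMor.Hom.hom g) : f = g := LaxMor.Hom.ext h

/-- A lax tangent morphism is strict when it commutes with the tangent bundle `1`-morphisms on the
nose and its distributive law is an identity. -/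
def LaxMor.IsStrict {A B : Tangentad K} (F : LaxMor A B) : Prop :=
  ∃ h : A.data.T ≫ F.F = F.F ≫ B.data.T, F.law = eqToHom h

/-- The distributive law of the composite of two lax tangent morphisms. -/
def compLaw {A B D : Tangentad K} (F : A.X ⟶ B.X) (α : A.data.T ≫ F ⟶ F ≫ B.data.T)
    (G : B.X ⟶ D.X) (β : B.data.T ≫ G ⟶ G ≫ D.data.T) :
    A.data.T ≫ F ≫ G ⟶ (F ≫ G) ≫ D.data.T :=
  (α_ _ _ _).inv ≫ α ▷ G ≫ (α_ _ _ _).hom ≫ F ◁ β ≫ (α_ _ _ _).inv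


section
variable {A B D : Tangentad K} {F : A.X ⟶ B.X} {α : A.data.T ≫ F ⟶ F ≫ B.data.T}
    {G : B.X ⟶ D.X} {β : B.data.T ≫ G ⟶ G ≫ D.data.T}

lemma IsLax.comp_p (hα : IsLax F α) (hβ : IsLax G β) : 
    compLaw F α G β ≫ (F ≫ G) ◁ D.data.p ≫ (ρ_ _).hom = A.data.p ▷ (F ≫ G) ≫ (λ_ _).hom := by
  have e1 := congrArg (fun x => F ◁ x) hβ.p
  have e2 := congrArg (fun x => x ▷ G) hα.p
  simp only [compLaw]
  simp at e1 e2 ⊢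
  rw [e1, e2]

lemma IsLax.comp_z (hα : IsLax F α) (hβ : IsLax G β) : 
    A.data.z ▷ (F ≫ G) ≫ compLaw F α G β = (λ_ _).hom ≫ (ρ_ _).inv ≫ (F ≫ G) ◁ D.data.z := by
  have e1 := congrArg (fun x => F ◁ x) hβ.z
  have e2 := congrArg (fun x => x ▷ G) hα.z
  simp only [compLaw]
  simp at e1 e2 ⊢
  rw [reassoc_of% e2]
  simp
  rw [reassoc_of% e1, ← whiskerLeft_comp_assoc]
  simp

lemma IsLax.comp_s (hα : IsLax F α) (hβ : IsLax G β) :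
    ∃ g : A.data.Tn 2 ≫ F ≫ G ⟶ (F ≫ G) ≫ D.data.Tn 2,
    g ≫ (F ≫ G) ◁ D.data.pr₁ = A.data.pr₁ ▷ (F ≫ G) ≫ compLaw F α G β ∧
    g ≫ (F ≫ G) ◁ D.data.pr₂ = A.data.pr₂ ▷ (F ≫ G) ≫ compLaw F α G β ∧
    A.data.s ▷ (F ≫ G) ≫ compLaw F α G β = g ≫ (F ≫ G) ◁ D.data.s := by
  obtain ⟨a, a1, a2, a3⟩ := hα.s
  obtain ⟨b, b1, b2, b3⟩ := hβ.s
  have a1' := congrArg (fun x => x ▷ G) a1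
  have a2' := congrArg (fun x => x ▷ G) a2
  have a3' := congrArg (fun x => x ▷ G) a3
  have b1' := congrArg (fun x => F ◁ x) b1
  have b2' := congrArg (fun x => F ◁ x) b2
  have b3' := congrArg (fun x => F ◁ x) b3
  refine ⟨(α_ _ _ _).inv ≫ a ▷ G ≫ (α_ _ _ _).hom ≫ F ◁ b ≫ (α_ _ _ _).inv, ?_, ?_, ?_⟩ <;>
  simp only [compLaw] <;> simp at a1' a2' a3' b1' b2' b3' ⊢
  · rw [reassoc_of% b1', ← reassoc_of% a1']; simp
  · rw [reassoc_of% b2', ← reassoc_of% a2']; simp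
  · rw [reassoc_of% a3', ← reassoc_of% b3']; simp


lemma doubleLaw_comp (F : A.X ⟶ B.X) (α : A.data.T ≫ F ⟶ F ≫ B.data.T)
    (G : B.X ⟶ D.X) (β : B.data.T ≫ G ⟶ G ≫ D.data.T) :
    doubleLaw (F ≫ G) (compLaw F α G β) = (α_ _ _ _).inv ≫ doubleLaw F α ▷ G ≫ (α_ _ _ _).hom ≫
      F ◁ doubleLaw G β ≫ (α_ _ _ _).inv := by
  calc _ = 𝟙 _ ⊗≫ A.data.T ◁ α ▷ G ⊗≫ ((A.data.T ≫ F) ◁ β ≫ α ▷ (G ≫ D.data.T)) ⊗≫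
        F ◁ β ▷ D.data.T ⊗≫ 𝟙 _ := by simp only [doubleLaw, compLaw]; bicategory
    _ = _ := by rw [whisker_exchange]; simp only [doubleLaw]; bicategory

lemma IsLax.comp (hα : IsLax F α) (hβ : IsLax G β) :
    IsLax (F ≫ G) (compLaw F α G β) where
  p := hα.comp_p hβ
  z := hα.comp_z hβ
  s := hα.comp_s hβ
  l := by
    have e1 := congrArg (fun x => F ◁ x) hβ.l
    have e2 := congrArg (fun x => x ▷ G) hα.l
    rw [doubleLaw_comp]
    simp only [compLaw]
    simp at e1 e2 ⊢
    rw [reassoc_of% e2]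
    simp
    rw [reassoc_of% e1]
  c := by
    have e1 := congrArg (fun x => F ◁ x) hβ.c
    have e2 := congrArg (fun x => x ▷ G) hα.c
    rw [doubleLaw_comp]
    simp at e1 e2 ⊢
    rw [reassoc_of% e2]
    simp
    rw [reassoc_of% e1]

/-- The composite of two lax tangent morphisms. -/
def LaxMor.comp (P : LaxMor A B) (Q : LaxMor B D) : LaxMor A D where
  F := P.F ≫ Q.F
  law := compLaw P.F P.law Q.F Q.law
  isLax := P.isLax.comp Q.isLax

/-- Whiskering of a tangent `2`-morphism by a lax tangent morphism. -/
def LaxMor.whiskerR {P P' : LaxMor A B} (f : P ⟶ P') (Q : LaxMor B D) :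
    P.comp Q ⟶ P'.comp Q where
  hom := f.hom ▷ Q.F
  comm := by
    have e := congrArg (fun x => x ▷ Q.F) f.comm
    have e3 := whisker_exchange f.hom Q.law
    simp only [LaxMor.comp, compLaw]
    simp at e e3 ⊢
    rw [← cancel_epi (α_ A.data.T P.F Q.F).hom, ← cancel_mono (α_ P'.F Q.F D.data.T).hom]
    simp [← reassoc_of% e, e3]

/-- Whiskering of a tangent `2`-morphism by a lax tangent morphism. -/
def LaxMor.whiskerL (P : LaxMor A B) {Q Q' : LaxMor B D} (f : Q ⟶ Q')  :
    P.comp Q ⟶ P.comp Q' where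
  hom := P.F ◁ f.hom
  comm := by
    have e := congrArg (fun x => P.F ◁ x) f.comm
    have e3 := whisker_exchange P.law f.hom
    simp only [LaxMor.comp, compLaw]
    simp at e e3 ⊢
    rw [← cancel_epi (α_ A.data.T P.F Q.F).hom]
    simp [reassoc_of% e, reassoc_of% e3]

/-- The associator (an identity in a `2`-category), as a tangent `2`-morphism. -/
def LaxMor.assocInv {E : Tangentad K} (P : LaxMor A B) (Q : LaxMor B D) (R : LaxMor D E) :
    P.comp (Q.comp R) ⟶ (P.comp Q).comp R where
  hom := (α_ P.F Q.F R.F).inv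
  comm := by
    simp only [LaxMor.comp, compLaw]
    bicategory

/-- The lax tangent morphism `(T, c)`. -/
def Tangentad.tangent (A : Tangentad K) : LaxMor A A where
  F := A.data.T
  law := A.data.c
  isLax := by
    have h := A.isTangentad
    refine ⟨h.c_p, ?_, ?_, ?_, ?_⟩
    · have := h.z_c
      rw [← this]; simp
    · obtain ⟨g, h1, h2, h3⟩ := h.s_c
      exact ⟨g, h1, h2, h3⟩
    · have e := h.c_l
      have e2 : A.data.c ≫ A.data.c = 𝟙 _ := h.c_c
      have e3 := congrArg (fun x => A.data.c ≫ x ≫ A.data.T ◁ A.data.c ≫ (α_ _ _ _).inv ≫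
        A.data.c ▷ A.data.T ≫ (α_ _ _ _).hom) e
      simp only [doubleLaw]
      simp only [Category.assoc, reassoc_of% e2, ← whiskerLeft_comp_assoc, e2,
        ← comp_whiskerRight_assoc, Iso.hom_inv_id_assoc, whiskerLeft_id, Category.id_comp,
        id_whiskerRight, Iso.inv_hom_id, Category.comp_id] at e3
      exact e3.symm
    · have e := h.yang_baxter
      simp only [doubleLaw]
      simp at e ⊢
      rw [reassoc_of% e]; simp


/-- The component `p_F : T F ⟶ F` of the projection of the Hom-tangent category. -/
def LaxMor.tangentProj {A B : Tangentad K} (P : LaxMor B A) : P.comp A.tangent ⟶ P where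
  hom := P.F ◁ A.data.p ≫ (ρ_ _).hom
  comm := by
    have h := A.isTangentad.c_p
    have h2 : A.data.c ≫ A.data.c = 𝟙 _ := A.isTangentad.c_c
    have h3 : A.data.c ≫ A.data.p ▷ A.data.T ≫ (λ_ _).hom = A.data.T ◁ A.data.p ≫ (ρ_ _).hom := by
      rw [← h, reassoc_of% h2]
    have e := congrArg (fun x => P.F ◁ x) h3
    have e3 := whisker_exchange P.law A.data.p
    simp only [LaxMor.comp, compLaw, Tangentad.tangent]
    simp at e e3 ⊢
    rw [e, ← cancel_mono (ρ_ (P.F ≫ A.data.T)).inv, ← cancel_epi (α_ B.data.T P.F A.data.T).hom]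
    simp [e3]

end

/-- The tangent bundle functor `T̄` of the Hom-tangent category `[A ‖ B]`:
`(F, α) ↦ (T, c) ∘ (F, α)`. -/
def homTangent (A B : Tangentad K) : LaxMor A B ⥤ LaxMor A B where
  obj P := P.comp B.tangent
  map f := LaxMor.whiskerR f B.tangent
  map_id _ := LaxMor.hom_ext (id_whiskerRight _ _)
  map_comp _ _ := LaxMor.hom_ext (comp_whiskerRight _ _ _)

/-- The projection `T̄ ⟶ 𝟭` of the Hom-tangent category `[A ‖ B]`. -/
def homProj (A B : Tangentad K) : homTangent A B ⟶ 𝟭 (LaxMor A B) where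
  app P := P.tangentProj
  naturality P Q f := by
    apply LaxMor.hom_ext
    have := whisker_exchange f.hom B.data.p
    change f.hom ▷ B.data.T ≫ Q.F ◁ B.data.p ≫ (ρ_ Q.F).hom =
      (P.F ◁ B.data.p ≫ (ρ_ P.F).hom) ≫ f.hom
    simp [← reassoc_of% this]

end TwoCat

section TangentCategory

variable {C : Type u} [Category.{v} C]

variable (C) in
/-- The data of a tangent structure on a category `C`; the names are as in `TangentData`. -/
structure TangentCatData where
  T : C ⥤ C
  p : T ⟶ 𝟭 C
  Tn : ℕ → (C ⥤ C)
  leg (n : ℕ) : Tn n ⟶ 𝟭 C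
  proj (n : ℕ) : Fin n → (Tn n ⟶ T)
  z : 𝟭 C ⟶ T
  s : Tn 2 ⟶ T
  l : T ⟶ T ⋙ T
  c : T ⋙ T ⟶ T ⋙ T

namespace TangentCatData

variable (D : TangentCatData C)

/-- The first projection `π₁ : T₂ ⟶ T`. -/
abbrev pr₁ : D.Tn 2 ⟶ D.T := D.proj 2 0

/-- The second projection `π₂ : T₂ ⟶ T`. -/
abbrev pr₂ : D.Tn 2 ⟶ D.T := D.proj 2 1

/-- The iterates of the tangent bundle functor. -/
def iterate : ℕ → (C ⥤ C)
  | 0 => 𝟭 C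
  | k + 1 => iterate k ⋙ D.T

/-- The axioms of a tangent category, stated at each object `M`; they are the axioms of a tangentad,
in the same order. -/
structure IsTangentCategory : Prop where
  isFiberPower (n : ℕ) (M : C) (k : ℕ) :
    IsFiberPower ((D.iterate k).map (D.p.app M)) ((D.iterate k).map ((D.leg n).app M))
      (fun i => (D.iterate k).map ((D.proj n i).app M))
  z_p (M : C) : D.z.app M ≫ D.p.app M = 𝟙 M
  s_p (M : C) : D.s.app M ≫ D.p.app M = D.pr₁.app M ≫ D.p.app M
  s_assoc (M : C) : ∃ e₁ e₂ g₁ g₂ : (D.Tn 3).obj M ⟶ (D.Tn 2).obj M,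
    (e₁ ≫ D.pr₁.app M = (D.proj 3 0).app M ∧ e₁ ≫ D.pr₂.app M = (D.proj 3 1).app M) ∧
    (e₂ ≫ D.pr₁.app M = (D.proj 3 1).app M ∧ e₂ ≫ D.pr₂.app M = (D.proj 3 2).app M) ∧
    (g₁ ≫ D.pr₁.app M = e₁ ≫ D.s.app M ∧ g₁ ≫ D.pr₂.app M = (D.proj 3 2).app M) ∧
    (g₂ ≫ D.pr₁.app M = (D.proj 3 0).app M ∧ g₂ ≫ D.pr₂.app M = e₂ ≫ D.s.app M) ∧
    g₁ ≫ D.s.app M = g₂ ≫ D.s.app M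
  s_unit (M : C) : ∃ g : D.T.obj M ⟶ (D.Tn 2).obj M,
    g ≫ D.pr₁.app M = D.p.app M ≫ D.z.app M ∧ g ≫ D.pr₂.app M = 𝟙 (D.T.obj M) ∧
    g ≫ D.s.app M = 𝟙 (D.T.obj M)
  s_comm (M : C) : ∃ τ : (D.Tn 2).obj M ⟶ (D.Tn 2).obj M,
    τ ≫ D.pr₁.app M = D.pr₂.app M ∧ τ ≫ D.pr₂.app M = D.pr₁.app M ∧
    τ ≫ D.s.app M = D.s.app M
  l_p (M : C) : D.l.app M ≫ D.T.map (D.p.app M) = D.p.app M ≫ D.z.app M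
  z_l (M : C) : D.z.app M ≫ D.l.app M = D.z.app M ≫ D.T.map (D.z.app M)
  s_l (M : C) : ∃ g : (D.Tn 2).obj M ⟶ D.T.obj ((D.Tn 2).obj M),
    g ≫ D.T.map (D.pr₁.app M) = D.pr₁.app M ≫ D.l.app M ∧
    g ≫ D.T.map (D.pr₂.app M) = D.pr₂.app M ≫ D.l.app M ∧
    D.s.app M ≫ D.l.app M = g ≫ D.T.map (D.s.app M)
  c_p (M : C) : D.c.app M ≫ D.p.app (D.T.obj M) = D.T.map (D.p.app M)
  z_c (M : C) : D.T.map (D.z.app M) ≫ D.c.app M = D.z.app (D.T.obj M)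
  s_c (M : C) : ∃ g : D.T.obj ((D.Tn 2).obj M) ⟶ (D.Tn 2).obj (D.T.obj M),
    g ≫ D.pr₁.app (D.T.obj M) = D.T.map (D.pr₁.app M) ≫ D.c.app M ∧
    g ≫ D.pr₂.app (D.T.obj M) = D.T.map (D.pr₂.app M) ≫ D.c.app M ∧
    D.T.map (D.s.app M) ≫ D.c.app M = g ≫ D.s.app (D.T.obj M)
  l_l (M : C) : D.l.app M ≫ D.T.map (D.l.app M) = D.l.app M ≫ D.l.app (D.T.obj M)
  l_c (M : C) : D.l.app M ≫ D.c.app M = D.l.app M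
  c_l (M : C) : D.l.app (D.T.obj M) ≫ D.T.map (D.c.app M) ≫ D.c.app (D.T.obj M) =
    D.c.app M ≫ D.T.map (D.l.app M)
  c_c (M : C) : D.c.app M ≫ D.c.app M = 𝟙 (D.T.obj (D.T.obj M))
  yang_baxter (M : C) :
    D.T.map (D.c.app M) ≫ D.c.app (D.T.obj M) ≫ D.T.map (D.c.app M) =
      D.c.app (D.T.obj M) ≫ D.T.map (D.c.app M) ≫ D.c.app (D.T.obj M)
  universal (M : C) : ∃ g : (D.Tn 2).obj M ⟶ D.T.obj ((D.Tn 2).obj M),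
    g ≫ D.T.map (D.pr₁.app M) = D.pr₁.app M ≫ D.l.app M ∧
    g ≫ D.T.map (D.pr₂.app M) = D.pr₂.app M ≫ D.z.app (D.T.obj M) ∧
    IsPullback (g ≫ D.T.map (D.s.app M)) (D.pr₁.app M ≫ D.p.app M)
      (D.T.map (D.p.app M)) (D.z.app M)

end TangentCatData

end TangentCategory

section VecField

variable {C : Type u} [Category.{v} C] 

/-- A vector field `(M, v)`: a section `v : M ⟶ TM` of the projection. -/
structure VecField (T : C ⥤ C) (p : T ⟶ 𝟭 C) where
  obj : C
  field : obj ⟶ T.obj obj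
  field_p : field ≫ p.app obj = 𝟙 obj

namespace VecField

variable {T : C ⥤ C} {p : T ⟶ 𝟭 C}

/-- A morphism of vector fields `(M, v) ⟶ (N, u)`: a morphism `f : M ⟶ N` with `Tf ∘ v = u ∘ f`. -/
@[ext]
structure Hom (X Y : VecField T p) where
  hom : X.obj ⟶ Y.obj
  comm : X.field ≫ T.map hom = hom ≫ Y.field

/-- The category of vector fields. -/
instance : Category (VecField T p) where
  Hom X Y := Hom X Y
  id X := ⟨𝟙 X.obj, by simp⟩
  comp f g := ⟨f.hom ≫ g.hom, by
    rw [T.map_comp, ← Category.assoc, f.comm, Category.assoc, g.comm, Category.assoc]⟩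
  id_comp _ := Hom.ext (Category.id_comp _)
  comp_id _ := Hom.ext (Category.comp_id _)
  assoc _ _ _ := Hom.ext (Category.assoc _ _ _)

@[simp] lemma id_hom (X : VecField T p) : Hom.hom (𝟙 X) = 𝟙 X.obj := rfl

@[simp] lemma comp_hom {X Y Z : VecField T p} (f : X ⟶ Y) (g : Y ⟶ Z) :
    Hom.hom (f ≫ g) = f.hom ≫ g.hom := rfl

@[ext] lemma hom_ext {X Y : VecField T p} {f g : X ⟶ Y} (h : Hom.hom f = Hom.hom g) : f = g :=
  Hom.ext h

/-- The forgetful functor `(M, v) ↦ M`. -/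
@[simps]
def forget (T : C ⥤ C) (p : T ⟶ 𝟭 C) : VecField T p ⥤ C where
  obj X := X.obj
  map f := f.hom

/-- The tangent bundle functor on vector fields, `(M, v) ↦ (TM, c ∘ Tv)`. -/
@[simps]
def tangent (c : T ⋙ T ⟶ T ⋙ T) (hc : ∀ M, c.app M ≫ p.app (T.obj M) = T.map (p.app M)) :
    VecField T p ⥤ VecField T p where
  obj X := ⟨T.obj X.obj, T.map X.field ≫ c.app X.obj, by
    rw [Category.assoc, hc, ← T.map_comp, X.field_p, T.map_id]⟩
  map {X Y} f := ⟨T.map f.hom, by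
    have h1 := c.naturality f.hom
    have h2 := congrArg T.map f.comm
    simp only [Functor.comp_map, T.map_comp] at h1 h2
    change (T.map X.field ≫ c.app X.obj) ≫ T.map (T.map f.hom) =
      T.map f.hom ≫ T.map Y.field ≫ c.app Y.obj
    rw [Category.assoc, ← h1, reassoc_of% h2]⟩

end VecField

end VecField

section VecFieldTangent

variable {C : Type u} [Category.{v} C]

namespace TangentCatData

variable {D : TangentCatData C}

lemma IsTangentCategory.c_p' (h : D.IsTangentCategory) (M : C) : D.c.app M ≫ D.T.map (D.p.app M) = D.p.app (D.T.obj M) := by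
  have h2 := h.c_c M
  rw [← h.c_p, reassoc_of% h2]

lemma IsTangentCategory.power (h : D.IsTangentCategory) (n : ℕ) (M : C) :
    IsFiberPower (D.p.app M) ((D.leg n).app M) (fun i => (D.proj n i).app M) :=
  h.isFiberPower n M 0

lemma IsTangentCategory.powerT (h : D.IsTangentCategory) (n : ℕ) (M : C) :
    IsFiberPower (D.T.map (D.p.app M)) (D.T.map ((D.leg n).app M))
      (fun i => D.T.map ((D.proj n i).app M)) :=
  h.isFiberPower n M 1

lemma IsTangentCategory.exists_flip (h : D.IsTangentCategory) (n : ℕ) (M : C) :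
    ∃ f : (D.Tn n).obj (D.T.obj M) ⟶ D.T.obj ((D.Tn n).obj M),
      f ≫ D.T.map ((D.leg n).app M) = (D.leg n).app (D.T.obj M) ∧
      ∀ i, f ≫ D.T.map ((D.proj n i).app M) = (D.proj n i).app (D.T.obj M) ≫ D.c.app M := by
  refine (h.powerT n M).exists_lift _ _ fun i => ?_
  rw [Category.assoc, h.c_p']
  exact (h.power n (D.T.obj M)).comp_eq i

variable (h : D.IsTangentCategory)


/-- The canonical flip `cₙ : Tₙ TM ⟶ T TₙM`, induced by `c`. -/
noncomputable def flip (n : ℕ) (M : C) : (D.Tn n).obj (D.T.obj M) ⟶ D.T.obj ((D.Tn n).obj M) :=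
  (h.exists_flip n M).choose

lemma flip_leg (n : ℕ) (M : C) :
    flip h n M ≫ D.T.map ((D.leg n).app M) = (D.leg n).app (D.T.obj M) :=
  (h.exists_flip n M).choose_spec.1

lemma flip_proj (n : ℕ) (M : C) (i : Fin n) :
    flip h n M ≫ D.T.map ((D.proj n i).app M) = (D.proj n i).app (D.T.obj M) ≫ D.c.app M :=
  (h.exists_flip n M).choose_spec.2 i

lemma nat_leg (n : ℕ) {M N : C} (f : M ⟶ N) :
    (D.Tn n).map f ≫ (D.leg n).app N = (D.leg n).app M ≫ f := (D.leg n).naturality f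

lemma nat_p {M N : C} (f : M ⟶ N) : D.T.map f ≫ D.p.app N = D.p.app M ≫ f := D.p.naturality f

lemma nat_z {M N : C} (f : M ⟶ N) : f ≫ D.z.app N = D.z.app M ≫ D.T.map f := D.z.naturality f

lemma nat_l {M N : C} (f : M ⟶ N) :
    D.T.map f ≫ D.l.app N = D.l.app M ≫ D.T.map (D.T.map f) := D.l.naturality f

lemma nat_c {M N : C} (f : M ⟶ N) :
    D.T.map (D.T.map f) ≫ D.c.app N = D.c.app M ≫ D.T.map (D.T.map f) := D.c.naturality f

lemma flip_p (n : ℕ) {M : C} (x : M ⟶ D.T.obj M) (hx : x ≫ D.p.app M = 𝟙 M) :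
    ((D.Tn n).map x ≫ flip h n M) ≫ D.p.app ((D.Tn n).obj M) = 𝟙 ((D.Tn n).obj M) := by
  apply (h.power n M).hom_ext
  · have h1 := flip_leg h n M
    rw [Category.assoc, Category.assoc, ← nat_p, reassoc_of% h1, ← Category.assoc, nat_leg,
      Category.assoc, Category.id_comp]
    exact (congrArg (fun y => (D.leg n).app M ≫ y) hx).trans (Category.comp_id _)
  · intro i
    have h1 := flip_proj h n M i
    rw [Category.assoc, Category.assoc, ← nat_p, reassoc_of% h1, h.c_p, ← Category.assoc,
      (D.proj n i).naturality, Category.assoc, ← D.T.map_comp, hx, D.T.map_id,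
      Category.comp_id, Category.id_comp]

lemma flip_naturality (n : ℕ) {M N : C} (f : M ⟶ N) :
    (D.Tn n).map (D.T.map f) ≫ flip h n N = flip h n M ≫ D.T.map ((D.Tn n).map f) := by
  apply (h.powerT n N).hom_ext
  · rw [Category.assoc, Category.assoc, flip_leg, ← D.T.map_comp, nat_leg, nat_leg, D.T.map_comp,
      ← Category.assoc, flip_leg]
  · intro i
    have h1 := flip_proj h n M i
    rw [Category.assoc, Category.assoc, flip_proj, ← D.T.map_comp, (D.proj n i).naturality,
      D.T.map_comp, reassoc_of% h1, ← nat_c, ← Category.assoc, (D.proj n i).naturality,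
      Category.assoc]

lemma flip_s (M : C) : flip h 2 M ≫ D.T.map (D.s.app M) = D.s.app (D.T.obj M) ≫ D.c.app M := by
  obtain ⟨g, g1, g2, g3⟩ := h.s_c M
  have hg : flip h 2 M ≫ g = 𝟙 _ := by
    have key : ∀ i, (flip h 2 M ≫ g) ≫ (D.proj 2 i).app (D.T.obj M) =
        𝟙 _ ≫ (D.proj 2 i).app (D.T.obj M) := by
      intro i
      have e : g ≫ (D.proj 2 i).app (D.T.obj M) = D.T.map ((D.proj 2 i).app M) ≫ D.c.app M := by
        fin_cases i
        · exact g1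
        · exact g2
      have e2 := flip_proj h 2 M i
      rw [Category.assoc, e, reassoc_of% e2, h.c_c, Category.comp_id, Category.id_comp]
    refine (h.power 2 (D.T.obj M)).hom_ext ?_ key
    rw [← (h.power 2 (D.T.obj M)).comp_eq 0, ← Category.assoc, key, Category.assoc]
  have h2 := h.c_c M
  have e : D.T.map (D.s.app M) = g ≫ D.s.app (D.T.obj M) ≫ D.c.app M := by
    rw [← Category.assoc, ← g3, Category.assoc, h2]; exact (Category.comp_id _).symm
  rw [e, reassoc_of% hg]

/-- The tangent structure on the category of vector fields: `Tₙ (M, v) = (TₙM, cₙ ∘ Tₙv)`, and the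
structural natural transformations have the same underlying morphisms as those of `C`. -/
noncomputable def IsTangentCategory.vf : TangentCatData (VecField D.T D.p) where
  T := VecField.tangent D.c h.c_p
  p :=
    { app X := ⟨D.p.app X.obj, by
        change (D.T.map X.field ≫ D.c.app X.obj) ≫ D.T.map (D.p.app X.obj) =
          D.p.app X.obj ≫ X.field
        rw [Category.assoc, h.c_p', nat_p]⟩
      naturality _ _ f := VecField.hom_ext (D.p.naturality _) }
  Tn n :=
    { obj X := ⟨(D.Tn n).obj X.obj, (D.Tn n).map X.field ≫ flip h n X.obj,
        flip_p h n X.field X.field_p⟩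
      map {X Y} f := ⟨(D.Tn n).map f.hom, by
        have e := f.comm
        change ((D.Tn n).map X.field ≫ flip h n X.obj) ≫ D.T.map ((D.Tn n).map f.hom) =
          (D.Tn n).map f.hom ≫ (D.Tn n).map Y.field ≫ flip h n Y.obj
        rw [Category.assoc, ← flip_naturality, ← Category.assoc, ← Category.assoc,
          ← Functor.map_comp, ← Functor.map_comp, e]⟩ 
      map_id X := VecField.hom_ext ((D.Tn n).map_id _)
      map_comp f g := VecField.hom_ext ((D.Tn n).map_comp _ _) }
  leg n :=
    { app X := ⟨(D.leg n).app X.obj, by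
        change ((D.Tn n).map X.field ≫ flip h n X.obj) ≫ D.T.map ((D.leg n).app X.obj) =
          (D.leg n).app X.obj ≫ X.field
        rw [Category.assoc, flip_leg, nat_leg]⟩
      naturality _ _ f := VecField.hom_ext ((D.leg n).naturality _) }
  proj n i :=
    { app X := ⟨(D.proj n i).app X.obj, by
        change ((D.Tn n).map X.field ≫ flip h n X.obj) ≫ D.T.map ((D.proj n i).app X.obj) =
          (D.proj n i).app X.obj ≫ D.T.map X.field ≫ D.c.app X.obj
        rw [Category.assoc, flip_proj, ← Category.assoc, (D.proj n i).naturality,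
          Category.assoc]⟩
      naturality _ _ f := VecField.hom_ext ((D.proj n i).naturality _) }
  z :=
    { app X := ⟨D.z.app X.obj, by
        change X.field ≫ D.T.map (D.z.app X.obj) =
          D.z.app X.obj ≫ D.T.map X.field ≫ D.c.app X.obj
        have e : D.z.app (D.T.obj X.obj) ≫ D.c.app X.obj = D.T.map (D.z.app X.obj) := by
          rw [← h.z_c, Category.assoc, h.c_c]; exact Category.comp_id _
        rw [← e, ← Category.assoc, nat_z, Category.assoc]⟩
      naturality _ _ f := VecField.hom_ext (D.z.naturality _) }
  s :=
    { app X := ⟨D.s.app X.obj, by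
        change ((D.Tn 2).map X.field ≫ flip h 2 X.obj) ≫ D.T.map (D.s.app X.obj) =
          D.s.app X.obj ≫ D.T.map X.field ≫ D.c.app X.obj
        rw [Category.assoc, flip_s, ← Category.assoc, D.s.naturality, Category.assoc]⟩
      naturality _ _ f := VecField.hom_ext (D.s.naturality _) }
  l :=
    { app X := ⟨D.l.app X.obj, by
        change (D.T.map X.field ≫ D.c.app X.obj) ≫ D.T.map (D.l.app X.obj) =
          D.l.app X.obj ≫ D.T.map (D.T.map X.field ≫ D.c.app X.obj) ≫ D.c.app (D.T.obj X.obj)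
        have e := nat_l (D := D) X.field
        rw [Category.assoc, ← h.c_l, D.T.map_comp, Category.assoc, reassoc_of% e]⟩
      naturality _ _ f := VecField.hom_ext (D.l.naturality _) }
  c :=
    { app X := ⟨D.c.app X.obj, by
        change (D.T.map (D.T.map X.field ≫ D.c.app X.obj) ≫ D.c.app (D.T.obj X.obj)) ≫
            D.T.map (D.c.app X.obj) = D.c.app X.obj ≫
          D.T.map (D.T.map X.field ≫ D.c.app X.obj) ≫ D.c.app (D.T.obj X.obj)
        have e := nat_c (D := D) X.field
        rw [D.T.map_comp, Category.assoc, Category.assoc, h.yang_baxter, Category.assoc,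
          reassoc_of% e]⟩
      naturality _ _ f := VecField.hom_ext (D.c.naturality _) }

end TangentCatData

end VecFieldTangent

section Construction

variable {K : Type u} [Bicategory.{w, v} K]

/-- The functor `Γ : [Y ‖ V] ⥤ VF [Y ‖ A]` induced by a vector field `W = ((U, α), w)` in the
Hom-tangent category `[V ‖ A]`: it sends a lax tangent morphism `H : Y ⟶ V` to the vector field
`w_H : U ∘ H ⟶ T̄(U ∘ H)`. -/
def Gamma {V A : Tangentad K} (W : VecField (homTangent V A) (homProj V A)) (Y : Tangentad K) :
    LaxMor Y V ⥤ VecField (homTangent Y A) (homProj Y A) where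
  obj H :=
    { obj := H.comp W.obj
      field := H.whiskerL W.field ≫ H.assocInv W.obj A.tangent
      field_p := by
        let w : W.obj.F ⟶ W.obj.F ≫ A.data.T := W.field.hom
        have hw : w ≫ W.obj.F ◁ A.data.p ≫ (ρ_ W.obj.F).hom = 𝟙 W.obj.F :=
          congrArg LaxMor.Hom.hom W.field_p
        apply LaxMor.hom_ext
        change (H.F ◁ w ≫ (α_ H.F W.obj.F A.data.T).inv) ≫ (H.F ≫ W.obj.F) ◁ A.data.p ≫
          (ρ_ (H.F ≫ W.obj.F)).hom = 𝟙 (H.F ≫ W.obj.F)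
        have := congrArg (fun x => H.F ◁ x) hw
        simpa using this }
  map {H H'} f :=
    { hom := LaxMor.whiskerR f W.obj
      comm := by
        apply LaxMor.hom_ext
        let w : W.obj.F ⟶ W.obj.F ≫ A.data.T := W.field.hom
        have := whisker_exchange f.hom w
        change (H.F ◁ w ≫ (α_ H.F W.obj.F A.data.T).inv) ≫ f.hom ▷ W.obj.F ▷ A.data.T =
          f.hom ▷ W.obj.F ≫ H'.F ◁ w ≫ (α_ H'.F W.obj.F A.data.T).inv
        simp [← reassoc_of% this] }
  map_id _ := VecField.hom_ext (LaxMor.hom_ext (id_whiskerRight _ _))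
  map_comp _ _ := VecField.hom_ext (LaxMor.hom_ext (comp_whiskerRight _ _ _))


/-- The functor `F` is an isomorphism of categories. -/
def IsIsoFunctor {C : Type*} {D : Type*} [Category* C] [Category* D] (F : C ⥤ D) : Prop :=
  ∃ G : D ⥤ C, F ⋙ G = 𝟭 C ∧ G ⋙ F = 𝟭 D

/-- The vector field `W` on `U : V ⟶ A` exhibits `V` as the tangentad of vector fields of `A`: `U` is
strict and, for each tangentad `Y`, the functor `Γ` is invertible. (Since `U` is strict, the
distributive law that makes `Γ` a tangent morphism is an identity, hence `Γ` is invertible as a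
tangent morphism precisely when it is invertible as a functor.) -/
def IsUniversalVectorField {V A : Tangentad K} (W : VecField (homTangent V A) (homProj V A)) :
    Prop :=
  W.obj.IsStrict ∧ ∀ Y : Tangentad K, IsIsoFunctor (Gamma W Y)

variable (K) in
/-- `K` admits the construction of vector fields: each tangentad of `K` has a tangentad of vector
fields. -/
def AdmitsVectorFields : Prop :=
  ∀ A : Tangentad K, ∃ (V : Tangentad K) (W : VecField (homTangent V A) (homProj V A)),
    IsUniversalVectorField W

section PIE

/-- The comparison functor whose invertibility, for all `Y`, says that `π` is a `2`-product cone. -/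
@[simps]
def prodComparison {J : Type*} {A : J → K} {P : K} (π : ∀ j, P ⟶ A j) (Y : K) :
    (Y ⟶ P) ⥤ (∀ j, Y ⟶ A j) where
  obj H j := H ≫ π j
  map f j := f ▷ π j

/-- Objects of the category of inserter cones over `F, G : X ⟶ X'` with vertex `Y`. -/
structure InsertObj {X X' : K} (F G : X ⟶ X') (Y : K) where
  obj : Y ⟶ X
  cell : obj ≫ F ⟶ obj ≫ G

namespace InsertObj

variable {X X' : K} {F G : X ⟶ X'} {Y : K}

/-- Morphisms of inserter cones. -/
@[ext]
structure Hom (H H' : InsertObj F G Y) where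
  hom : H.obj ⟶ H'.obj
  comm : H.cell ≫ hom ▷ G = hom ▷ F ≫ H'.cell

instance : Category (InsertObj F G Y) where
  Hom H H' := Hom H H'
  id H := ⟨𝟙 H.obj, by simp⟩
  comp f g := ⟨f.hom ≫ g.hom, by
    rw [comp_whiskerRight, ← Category.assoc, f.comm, Category.assoc, g.comm, comp_whiskerRight,
      Category.assoc]⟩
  id_comp _ := Hom.ext (Category.id_comp _)
  comp_id _ := Hom.ext (Category.comp_id _)
  assoc _ _ _ := Hom.ext (Category.assoc _ _ _)

end InsertObj

/-- The comparison functor whose invertibility, for all `Y`, says that `(V, θ)` is an inserter of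
`F` and `G`. -/
def insertComparison {X X' I : K} {F G : X ⟶ X'} (V : I ⟶ X) (θ : V ≫ F ⟶ V ≫ G) (Y : K) :
    (Y ⟶ I) ⥤ InsertObj F G Y where
  obj H := ⟨H ≫ V, (α_ _ _ _).hom ≫ H ◁ θ ≫ (α_ _ _ _).inv⟩
  map {H H'} f := ⟨f ▷ V, by
    have := whisker_exchange f θ
    rw [whiskerRight_comp, whiskerRight_comp] at this
    change ((α_ H V F).hom ≫ H ◁ θ ≫ (α_ H V G).inv) ≫ f ▷ V ▷ G =
      f ▷ V ▷ F ≫ (α_ H' V F).hom ≫ H' ◁ θ ≫ (α_ H' V G).inv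
    rw [← cancel_epi (α_ H V F).inv, ← cancel_mono (α_ H' V G).hom]
    simpa using this⟩
  map_id _ := InsertObj.Hom.ext (id_whiskerRight _ _)
  map_comp _ _ := InsertObj.Hom.ext (comp_whiskerRight _ _ _)

/-- Equifier cones over `φ, ψ : F ⟶ G` with vertex `Y`. -/
def equifies {X X' : K} {F G : X ⟶ X'} (φ ψ : F ⟶ G) (Y : K) : ObjectProperty (Y ⟶ X) :=
  fun H => H ◁ φ = H ◁ ψ

/-- The comparison functor whose invertibility, for all `Y`, says that `W` is an equifier of `φ`
and `ψ`. -/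
def equifyComparison {X X' E : K} {F G : X ⟶ X'} {φ ψ : F ⟶ G} (W : E ⟶ X)
    (hW : equifies φ ψ E W) (Y : K) : (Y ⟶ E) ⥤ (equifies φ ψ Y).FullSubcategory :=
  (equifies φ ψ Y).lift (postcomp Y W) (fun H => by
    have hW : W ◁ φ = W ◁ ψ := hW
    change (H ≫ W) ◁ φ = (H ≫ W) ◁ ψ
    rw [comp_whiskerLeft, hW, comp_whiskerLeft])

/-- `K` admits PIE limits: (`t`-small) `2`-products, inserters and equifiers. -/
structure AdmitsPIELimits.{t, w', v', u'} (K : Type u') [Bicategory.{w', v'} K] : Prop where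
  products : ∀ (J : Type t) (A : J → K), ∃ (P : K) (π : ∀ j, P ⟶ A j),
    ∀ Y : K, IsIsoFunctor (prodComparison π Y)
  inserters : ∀ {X X' : K} (F G : X ⟶ X'), ∃ (I : K) (V : I ⟶ X) (θ : V ≫ F ⟶ V ≫ G),
    ∀ Y : K, IsIsoFunctor (insertComparison V θ Y)
  equifiers : ∀ {X X' : K} {F G : X ⟶ X'} (φ ψ : F ⟶ G),
    ∃ (E : K) (W : E ⟶ X) (hW : equifies φ ψ E W),
      ∀ Y : K, IsIsoFunctor (equifyComparison W hW Y)

end PIE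

end Construction

/-- A cleavage of `P : E ⥤ B`: a choice of a Cartesian lift `f^*X ⟶ X` of each `f : M ⟶ P X`.
(Mathlib calls `IsStronglyCartesian` what is usually called a Cartesian lift of `f`.) -/
structure Cleavage {E : Type*} {B : Type*} [Category* E] [Category* B] (P : E ⥤ B) where
  obj {M : B} {X : E} (f : M ⟶ P.obj X) : E
  lift {M : B} {X : E} (f : M ⟶ P.obj X) : obj f ⟶ X
  cartesian {M : B} {X : E} (f : M ⟶ P.obj X) : P.IsStronglyCartesian f (lift f)

/-- Cloven fibrations over arbitrary base categories. -/
structure Fib where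
  total : Type u
  base : Type u
  [catTotal : Category.{v} total]
  [catBase : Category.{v} base]
  proj : total ⥤ base
  cleavage : Cleavage proj

namespace Fib

attribute [instance] catTotal catBase

/-- The `1`-morphisms of `Fib`: strictly commuting squares of functors that preserve Cartesian
lifts. -/
structure Mor (P Q : Fib.{v, u}) where
  base : P.base ⥤ Q.base
  total : P.total ⥤ Q.total
  comm : total ⋙ Q.proj = P.proj ⋙ base
  cartesian : ∀ {M N : P.base} {X Y : P.total} (f : M ⟶ N) (φ : X ⟶ Y),
    P.proj.IsStronglyCartesian f φ → Q.proj.IsStronglyCartesian (base.map f) (total.map φ)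

lemma Mor.comm_obj {P Q : Fib.{v, u}} (F : Mor P Q) (X : P.total) :
    Q.proj.obj (F.total.obj X) = F.base.obj (P.proj.obj X) :=
  Functor.congr_obj F.comm X

lemma Mor.isHomLift {P Q : Fib.{v, u}} (F : Mor P Q) {M N : P.base} {X Y : P.total}
    {f : M ⟶ N} {φ : X ⟶ Y} (h : P.proj.IsHomLift f φ) :
    Q.proj.IsHomLift (F.base.map f) (F.total.map φ) := by
  obtain ⟨⟩ := h
  apply IsHomLift.of_fac' _ _ _ (F.comm_obj _) (F.comm_obj _)
  have := Functor.congr_hom F.comm φ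
  simpa using this

/-- The `2`-morphisms of `Fib`: pairs of natural transformations, the total one lying over the base
one. -/
@[ext]
structure Cell {P Q : Fib.{v, u}} (F G : Mor P Q) where
  base : F.base ⟶ G.base
  total : F.total ⟶ G.total
  comm : ∀ X : P.total, Q.proj.IsHomLift (base.app (P.proj.obj X)) (total.app X)

/-- The Hom-categories of `Fib`. -/
instance (P Q : Fib.{v, u}) : Category (Mor P Q) where
  Hom F G := Cell F G
  id F := ⟨𝟙 _, 𝟙 _, fun X => IsHomLift.id (F.comm_obj X)⟩
  comp φ ψ := ⟨φ.base ≫ ψ.base, φ.total ≫ ψ.total, fun X => by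
    have := φ.comm X
    have := ψ.comm X
    rw [NatTrans.comp_app, NatTrans.comp_app]
    infer_instance⟩
  id_comp φ := Cell.ext (Category.id_comp _) (Category.id_comp _)
  comp_id φ := Cell.ext (Category.comp_id _) (Category.comp_id _)
  assoc φ ψ χ := Cell.ext (Category.assoc _ _ _) (Category.assoc _ _ _)

@[ext] lemma cell_ext {P Q : Fib.{v, u}} {F G : Mor P Q} {φ ψ : F ⟶ G}
    (h₁ : Cell.base φ = Cell.base ψ) (h₂ : Cell.total φ = Cell.total ψ) : φ = ψ :=
  Cell.ext h₁ h₂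

/-- The identity `1`-morphism. -/
abbrev idMor (P : Fib.{v, u}) : Mor P P where
  base := 𝟭 _
  total := 𝟭 _
  comm := rfl
  cartesian _ _ h := h

/-- The composite of `1`-morphisms. -/
abbrev compMor {P Q R : Fib.{v, u}} (F : Mor P Q) (G : Mor Q R) : Mor P R where
  base := F.base ⋙ G.base
  total := F.total ⋙ G.total
  comm := by
    rw [Functor.assoc, G.comm, ← Functor.assoc, F.comm, Functor.assoc]
  cartesian f φ h := G.cartesian _ _ (F.cartesian f φ h)

/-- Left whiskering. -/
def whiskerL {P Q R : Fib.{v, u}} (F : Mor P Q) {G H : Mor Q R} (η : G ⟶ H) :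
    compMor F G ⟶ compMor F H :=
  Cell.mk (F := compMor F G) (G := compMor F H) (Functor.whiskerLeft F.base η.base)
    (Functor.whiskerLeft F.total η.total) fun X => by
      have := η.comm (F.total.obj X)
      rw [F.comm_obj] at this
      exact this

/-- Right whiskering. -/
def whiskerR {P Q R : Fib.{v, u}} {F G : Mor P Q} (η : F ⟶ G) (H : Mor Q R) :
    compMor F H ⟶ compMor G H :=
  Cell.mk (F := compMor F H) (G := compMor G H) (Functor.whiskerRight η.base H.base)
    (Functor.whiskerRight η.total H.total) fun X => H.isHomLift (η.comm X)

@[simp] lemma id_base {P Q : Fib.{v, u}} (F : Mor P Q) : Cell.base (𝟙 F) = 𝟙 F.base := rfl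
@[simp] lemma id_total {P Q : Fib.{v, u}} (F : Mor P Q) : Cell.total (𝟙 F) = 𝟙 F.total := rfl
@[simp] lemma comp_base {P Q : Fib.{v, u}} {F G H : Mor P Q} (φ : F ⟶ G) (ψ : G ⟶ H) :
    Cell.base (φ ≫ ψ) = φ.base ≫ ψ.base := rfl
@[simp] lemma comp_total {P Q : Fib.{v, u}} {F G H : Mor P Q} (φ : F ⟶ G) (ψ : G ⟶ H) :
    Cell.total (φ ≫ ψ) = φ.total ≫ ψ.total := rfl

instance (P Q : Fib.{v, u}) (F G : Mor P Q) (φ : F ⟶ G) (X : P.total) :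
    Q.proj.IsHomLift (φ.base.app (P.proj.obj X)) (φ.total.app X) := φ.comm X

/-- The associator, an identity. -/
def assocIso {P Q R S : Fib.{v, u}} (F : Mor P Q) (G : Mor Q R) (H : Mor R S) :
    compMor (compMor F G) H ≅ compMor F (compMor G H) := Iso.refl (compMor (compMor F G) H)

/-- The left unitor, an identity. -/
def leftIso {P Q : Fib.{v, u}} (F : Mor P Q) : compMor (idMor P) F ≅ F := Iso.refl F

/-- The right unitor, an identity. -/
def rightIso {P Q : Fib.{v, u}} (F : Mor P Q) : compMor F (idMor Q) ≅ F := Iso.refl F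

/-- The `2`-category of cloven fibrations. -/
instance : Bicategory Fib.{v, u} where
  Hom P Q := Mor P Q
  id P := idMor P
  comp F G := compMor F G
  homCategory P Q := inferInstanceAs (Category (Mor P Q))
  whiskerLeft F _ _ η := whiskerL F η
  whiskerRight η H := whiskerR η H
  associator F G H := assocIso F G H
  leftUnitor F := leftIso F
  rightUnitor F := rightIso F
  whiskerLeft_id _ _ := rfl
  whiskerLeft_comp _ _ _ _ _ _ := rfl
  id_whiskerLeft η := (cell_ext ((Category.id_comp _).trans (Category.comp_id _))
    ((Category.id_comp _).trans (Category.comp_id _))).symm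
  comp_whiskerLeft F G _ _ η := (cell_ext ((Category.id_comp _).trans (Category.comp_id _))
    ((Category.id_comp _).trans (Category.comp_id _))).symm
  id_whiskerRight F G := cell_ext (Functor.whiskerRight_id' _) (Functor.whiskerRight_id' _)
  comp_whiskerRight η θ F := cell_ext (Functor.whiskerRight_comp _ _ _)
    (Functor.whiskerRight_comp _ _ _)
  whiskerRight_id η := (cell_ext ((Category.id_comp _).trans (Category.comp_id _))
    ((Category.id_comp _).trans (Category.comp_id _))).symm
  whiskerRight_comp η F G := (cell_ext ((Category.id_comp _).trans (Category.comp_id _))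
    ((Category.id_comp _).trans (Category.comp_id _))).symm
  whisker_assoc F _ _ η H := (cell_ext ((Category.id_comp _).trans (Category.comp_id _))
    ((Category.id_comp _).trans (Category.comp_id _))).symm
  whisker_exchange {_ _ _ _ _ _ _} η θ := cell_ext
    (NatTrans.ext (funext fun X => (θ.base.naturality (η.base.app X)).symm))
    (NatTrans.ext (funext fun X => (θ.total.naturality (η.total.app X)).symm))
  pentagon F G H K := by
    have h : whiskerR (𝟙 (compMor (compMor F G) H)) K = 𝟙 (compMor (compMor (compMor F G) H) K) :=
      cell_ext (Functor.whiskerRight_id' _) (Functor.whiskerRight_id' _)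
    exact (congrArg₂ (fun (x y : compMor (compMor (compMor F G) H) K ⟶
      compMor (compMor (compMor F G) H) K) => x ≫ y) h (Category.comp_id _))
  triangle F G := ((Category.id_comp _).trans
    (cell_ext (Functor.whiskerRight_id' _) (Functor.whiskerRight_id' _)).symm)

/-- The bicategory `Fib` is strict, that is, a `2`-category. -/
instance : Bicategory.Strict Fib.{v, u} where
  id_comp _ := rfl
  comp_id _ := rfl
  assoc _ _ _ := rfl
  leftUnitor_eqToIso _ := rfl
  rightUnitor_eqToIso _ := rfl
  associator_eqToIso _ _ _ := rfl


section VecFieldFib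

variable {P : Fib.{v, u}} (T : Mor P P) (p : T ⟶ idMor P)

/-- Vector fields on the total category. -/
abbrev VFTotal := VecField (C := P.total) T.total p.total

/-- Vector fields on the base category. -/
abbrev VFBase := VecField (C := P.base) T.base p.base

lemma proj_p (E : P.total) :
    P.proj.map (p.total.app E) = eqToHom (T.comm_obj E) ≫ p.base.app (P.proj.obj E) := by
  have := p.comm E
  have h := IsHomLift.fac' P.proj (p.base.app (P.proj.obj E)) (p.total.app E)
  rw [h]; exact congrArg _ (Category.comp_id _)

lemma Mor.proj_map {P Q : Fib.{v, u}} (F : Mor P Q) {X Y : P.total} (φ : X ⟶ Y) :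
    Q.proj.map (F.total.map φ) ≫ eqToHom (F.comm_obj Y) =
      eqToHom (F.comm_obj X) ≫ F.base.map (P.proj.map φ) := by
  have := Functor.congr_hom F.comm φ
  simp at this
  simp [this]

/-- The functor `VF(Π)`, `(E, w) ↦ (ΠE, Πw)`. -/
def vfProj : VFTotal T p ⥤ VFBase T p where
  obj X :=
    { obj := P.proj.obj X.obj
      field := P.proj.map X.field ≫ eqToHom (T.comm_obj X.obj)
      field_p := by
        rw [Category.assoc]
        refine (congrArg (fun x => P.proj.map X.field ≫ x) (proj_p T p X.obj).symm).trans ?_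
        rw [← P.proj.map_comp]
        exact (congrArg P.proj.map X.field_p).trans (P.proj.map_id _) }
  map {X Y} f := ⟨P.proj.map f.hom, by
    have h := congrArg P.proj.map f.comm
    rw [P.proj.map_comp, P.proj.map_comp] at h
    change (P.proj.map X.field ≫ eqToHom (T.comm_obj X.obj)) ≫ T.base.map (P.proj.map f.hom) =
      P.proj.map f.hom ≫ P.proj.map Y.field ≫ eqToHom (T.comm_obj Y.obj)
    rw [Category.assoc, ← T.proj_map, reassoc_of% h]⟩
  map_id X := VecField.hom_ext (P.proj.map_id _)
  map_comp f g := VecField.hom_ext (P.proj.map_comp _ _)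

variable {T p}

lemma vfBase_ext {X Y : VFBase T p} (h : X.obj = Y.obj)
    (h' : X.field ≫ T.base.map (eqToHom h) = eqToHom h ≫ Y.field) : X = Y := by
  obtain ⟨X, x, hx⟩ := X
  obtain ⟨Y, y, hy⟩ := Y
  obtain rfl : X = Y := h
  obtain rfl : x = y := by simpa using h'
  rfl

lemma vfBase_eqToHom_hom {X Y : VFBase T p} (h : X = Y) (h' : X.obj = Y.obj) :
    VecField.Hom.hom (eqToHom h) = eqToHom h' := by
  subst h; rfl

lemma vfProj_isHomLift {M N : VFBase T p} {X Y : VFTotal T p} (f : M ⟶ N) (φ : X ⟶ Y)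
    (hX : (vfProj T p).obj X = M) (hY : (vfProj T p).obj Y = N)
    (h : P.proj.IsHomLift (VecField.Hom.hom f) (VecField.Hom.hom φ)) :
    (vfProj T p).IsHomLift f φ := by
  subst hX hY
  apply IsHomLift.of_fac _ _ _ rfl rfl
  apply VecField.hom_ext
  have hf := @IsHomLift.eq_of_isHomLift _ _ _ _ P.proj X.obj Y.obj (VecField.Hom.hom f)
    (VecField.Hom.hom φ) h
  rw [eqToHom_refl, eqToHom_refl, Category.comp_id, Category.id_comp]
  exact hf

lemma isHomLift_of_vfProj {M N : VFBase T p} {X Y : VFTotal T p} (f : M ⟶ N) (φ : X ⟶ Y)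
    (h : (vfProj T p).IsHomLift f φ) :
    P.proj.IsHomLift (VecField.Hom.hom f) (VecField.Hom.hom φ) := by
  obtain ⟨⟩ := h
  exact .map _

/-- The underlying morphism of a morphism with codomain `Π(E, w)`. -/
def baseHom {M : VFBase T p} {X : VFTotal T p} (f : M ⟶ (vfProj T p).obj X) :
    M.obj ⟶ P.proj.obj X.obj := VecField.Hom.hom f


lemma vf_lift_exists {M : VFBase T p} {X : VFTotal T p} (f : M ⟶ (vfProj T p).obj X) {E : P.total}
    (φ : E ⟶ X.obj) [P.proj.IsStronglyCartesian (baseHom f) φ] :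
    ∃ w : E ⟶ T.total.obj E, P.proj.IsHomLift M.field w ∧ w ≫ T.total.map φ = φ ≫ X.field := by
  have := T.cartesian (baseHom f) φ inferInstance
  have hX : P.proj.IsHomLift (P.proj.map X.field ≫ eqToHom (T.comm_obj X.obj)) X.field :=
    inferInstance
  have hc : baseHom f ≫ P.proj.map X.field ≫ eqToHom (T.comm_obj X.obj) =
    M.field ≫ T.base.map (baseHom f) := f.comm.symm
  have hX' : P.proj.IsHomLift (baseHom f ≫ P.proj.map X.field ≫ eqToHom (T.comm_obj X.obj))
    (φ ≫ X.field) := inferInstance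
  obtain ⟨w, h, -⟩ := Functor.IsStronglyCartesian.universal_property P.proj
    (T.base.map (baseHom f)) (T.total.map φ) M.field _ hc (φ ≫ X.field)
  exact ⟨w, h⟩

lemma vf_lift_section {M : VFBase T p} {X : VFTotal T p} (f : M ⟶ (vfProj T p).obj X) {E : P.total}
    (φ : E ⟶ X.obj) [P.proj.IsStronglyCartesian (baseHom f) φ] (w : E ⟶ T.total.obj E)
    (hw : P.proj.IsHomLift M.field w) (h : w ≫ T.total.map φ = φ ≫ X.field) :
    w ≫ p.total.app E = 𝟙 E := by
  have hE : P.proj.obj E = M.obj := IsHomLift.domain_eq P.proj (baseHom f) φ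
  have h1 : P.proj.IsHomLift (p.base.app M.obj) (p.total.app E) := by
    rw [← hE]; exact p.comm E
  have h2 : P.proj.IsHomLift (𝟙 M.obj) (w ≫ p.total.app E) := by
    rw [← M.field_p]; exact IsHomLift.comp P.proj M.field (p.base.app M.obj) w (p.total.app E)
  have h3 : P.proj.IsHomLift (𝟙 M.obj) (𝟙 E) := IsHomLift.id hE
  apply Functor.IsStronglyCartesian.ext P.proj (baseHom f) φ (𝟙 M.obj)
  have hn := p.total.naturality φ
  change T.total.map φ ≫ p.total.app X.obj = p.total.app E ≫ φ at hn
  have hs : X.field ≫ p.total.app X.obj = 𝟙 X.obj := X.field_p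
  rw [Category.assoc, ← hn, reassoc_of% h, hs, Category.comp_id, Category.id_comp]

/-- The vector field on domain of a Cartesian lift. -/
noncomputable def vfLiftObj {M : VFBase T p} {X : VFTotal T p} (f : M ⟶ (vfProj T p).obj X)
    {E : P.total} (φ : E ⟶ X.obj) [P.proj.IsStronglyCartesian (baseHom f) φ] :
    VFTotal T p where
  obj := E
  field := (vf_lift_exists f φ).choose
  field_p := vf_lift_section f φ _ (vf_lift_exists f φ).choose_spec.1
    (vf_lift_exists f φ).choose_spec.2

lemma vf_isStronglyCartesian {M N : VFBase T p} {X Y : VFTotal T p} (f : M ⟶ N) (φ : X ⟶ Y)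
    (h : (vfProj T p).IsHomLift f φ)
    (hφ : P.proj.IsStronglyCartesian (VecField.Hom.hom f) (VecField.Hom.hom φ)) :
    (vfProj T p).IsStronglyCartesian f φ where
  universal_property' {Z} g ψ hψ := by
    have h1 := isHomLift_of_vfProj _ _ hψ
    obtain ⟨χ, ⟨hχ, hχ'⟩, hu⟩ := Functor.IsStronglyCartesian.universal_property P.proj
      (VecField.Hom.hom f) (VecField.Hom.hom φ) (VecField.Hom.hom g) _ rfl (VecField.Hom.hom ψ)
    have hX := IsHomLift.domain_eq (vfProj T p) f φ
    subst hX
    have hT := T.cartesian _ _ hφ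
    have hc : Z.field ≫ T.total.map χ = χ ≫ X.field := by
      have a1 : P.proj.IsHomLift ((vfProj T p).obj Z).field Z.field :=
        inferInstanceAs (P.proj.IsHomLift (P.proj.map Z.field ≫ eqToHom (T.comm_obj Z.obj)) Z.field)
      have a2 : P.proj.IsHomLift ((vfProj T p).obj X).field X.field :=
        inferInstanceAs (P.proj.IsHomLift (P.proj.map X.field ≫ eqToHom (T.comm_obj X.obj)) X.field)
      have a3 := T.isHomLift hχ
      have b1 : P.proj.IsHomLift (VecField.Hom.hom g ≫ ((vfProj T p).obj X).field)
          (χ ≫ X.field) := inferInstance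
      have b2 : P.proj.IsHomLift (VecField.Hom.hom g ≫ ((vfProj T p).obj X).field)
          (Z.field ≫ T.total.map χ) := by
        rw [← g.comm]; exact IsHomLift.comp P.proj _ _ _ _
      apply Functor.IsStronglyCartesian.ext P.proj (T.base.map (VecField.Hom.hom f))
        (T.total.map (VecField.Hom.hom φ)) (VecField.Hom.hom g ≫ ((vfProj T p).obj X).field)
      have e1 : Z.field ≫ T.total.map (VecField.Hom.hom ψ) = VecField.Hom.hom ψ ≫ Y.field := ψ.comm
      have e2 : X.field ≫ T.total.map (VecField.Hom.hom φ) = VecField.Hom.hom φ ≫ Y.field := φ.comm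
      rw [Category.assoc, Category.assoc, ← T.total.map_comp, hχ', e1, e2, reassoc_of% hχ']
    refine ⟨⟨χ, hc⟩, ⟨vfProj_isHomLift _ _ rfl rfl hχ, VecField.hom_ext hχ'⟩, ?_⟩
    intro y hy
    exact VecField.hom_ext (hu _ ⟨isHomLift_of_vfProj _ _ hy.1, congrArg VecField.Hom.hom hy.2⟩)

lemma vfProj_vfLiftObj {M : VFBase T p} {X : VFTotal T p} (f : M ⟶ (vfProj T p).obj X)
    {E : P.total} (φ : E ⟶ X.obj) [P.proj.IsStronglyCartesian (baseHom f) φ] :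
    (vfProj T p).obj (vfLiftObj f φ) = M := by
  have hE : P.proj.obj E = M.obj := IsHomLift.domain_eq P.proj (baseHom f) φ
  have hw := (vf_lift_exists f φ).choose_spec.1
  have hf := IsHomLift.fac' P.proj M.field (vf_lift_exists f φ).choose
  apply vfBase_ext hE
  change (P.proj.map (vf_lift_exists f φ).choose ≫ eqToHom (T.comm_obj E)) ≫
    T.base.map (eqToHom hE) = eqToHom hE ≫ M.field
  rw [hf]
  simp [eqToHom_map]

variable (T p)

/-- The functor `VF(Π)` with the cleavage induced by the cleavage of `Π`. -/
noncomputable def vf : Fib.{v, max u v} where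
  total := VFTotal T p
  base := VFBase T p
  proj := vfProj T p
  cleavage :=
    { obj {M X} f :=
        haveI := P.cleavage.cartesian (baseHom f)
        vfLiftObj f (P.cleavage.lift (baseHom f))
      lift {M X} f :=
        haveI := P.cleavage.cartesian (baseHom f)
        ⟨P.cleavage.lift (baseHom f),
          (vf_lift_exists f (P.cleavage.lift (baseHom f))).choose_spec.2⟩
      cartesian {M X} f := by
        have := P.cleavage.cartesian (baseHom f)
        apply vf_isStronglyCartesian
        · apply vfProj_isHomLift
          · exact vfProj_vfLiftObj f _
          · rfl
          · exact this.toIsHomLift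
        · exact this }

lemma vf_cartesian_iff {M N : VFBase T p} {X Y : VFTotal T p} (f : M ⟶ N) (φ : X ⟶ Y)
    (hφ : (vfProj T p).IsStronglyCartesian f φ) :
    P.proj.IsStronglyCartesian (VecField.Hom.hom f) (VecField.Hom.hom φ) := by
  have hY := IsHomLift.codomain_eq (vfProj T p) f φ
  subst hY
  obtain ⟨Z, ψ, hψ, hψ'⟩ : ∃ (Z : VFTotal T p) (ψ : Z ⟶ Y),
      (vfProj T p).IsStronglyCartesian f ψ ∧
      P.proj.IsStronglyCartesian (baseHom f) (VecField.Hom.hom ψ) :=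
    ⟨_, (vf T p).cleavage.lift f, (vf T p).cleavage.cartesian f,
      P.cleavage.cartesian (baseHom f)⟩
  let e := Functor.IsStronglyCartesian.domainIsoOfBaseIso (vfProj T p) (f := f) (f' := f)
    (g := Iso.refl M) (Category.id_comp f).symm ψ φ
  have he : (vfProj T p).IsHomLift (𝟙 M) e.hom :=
    Functor.IsStronglyCartesian.domainUniqueUpToIso_inv_isHomLift (vfProj T p) (g := Iso.refl M)
      (Category.id_comp f).symm ψ φ
  have he' : P.proj.IsHomLift (𝟙 M.obj) (VecField.Hom.hom e.hom) := isHomLift_of_vfProj _ _ he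
  have hc : e.hom ≫ ψ = φ := Functor.IsStronglyCartesian.fac (vfProj T p) (g := (Iso.refl M).hom) f ψ
    (Category.id_comp f).symm φ
  have hi : IsIso (VecField.Hom.hom e.hom) :=
    Functor.map_isIso (VecField.forget (C := P.total) T.total p.total) e.hom
  have h2 : P.proj.IsStronglyCartesian (𝟙 M.obj) (VecField.Hom.hom e.hom) :=
    Functor.IsStronglyCartesian.of_isIso _ _ _
  have h3 : P.proj.IsStronglyCartesian (𝟙 M.obj ≫ baseHom f)
    (VecField.Hom.hom e.hom ≫ VecField.Hom.hom ψ) :=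
    Functor.IsStronglyCartesian.comp P.proj (f := 𝟙 M.obj) (g := baseHom f)
  rw [Category.id_comp] at h3
  rw [← hc]
  exact h3

end VecFieldFib

section Universal

variable {P : Fib.{v, max u v}} (T : Mor P P) (p : T ⟶ idMor P)

/-- The forgetful `1`-morphism `VF(Π) ⟶ Π`. -/
noncomputable def vfForget : Mor (vf.{v, max u v} T p) P where
  base := VecField.forget (C := P.base) T.base p.base
  total := VecField.forget (C := P.total) T.total p.total
  comm := rfl
  cartesian f φ h := vf_cartesian_iff T p f φ h

/-- The tautological `2`-morphism, with components `v` at `(M, v)` and `w` at `(E, w)`. -/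
noncomputable def vfCell : vfForget.{v, u} T p ⟶ compMor (vfForget.{v, u} T p) T :=
  Cell.mk (F := vfForget.{v, u} T p) (G := compMor (vfForget.{v, u} T p) T)
    { app (X : VFBase T p) := X.field
      naturality _ _ f := (VecField.Hom.comm (T := T.base) (p := p.base) f).symm }
    { app (X : VFTotal T p) := X.field
      naturality _ _ f := (VecField.Hom.comm (T := T.total) (p := p.total) f).symm }
    fun (X : VFTotal T p) => inferInstanceAs (P.proj.IsHomLift
      (P.proj.map X.field ≫ eqToHom (T.comm_obj X.obj)) X.field)

end Universal

section TangentFibration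

/-- The tangent data induced on the base category of a fibration. -/
def baseData {P : Fib.{v, u}} (D : TangentData P) : TangentCatData P.base where
  T := Mor.base D.T
  p := Cell.base D.p
  Tn n := Mor.base (D.Tn n)
  leg n := Cell.base (D.leg n)
  proj n i := Cell.base (D.proj n i)
  z := Cell.base D.z
  s := Cell.base D.s
  l := Cell.base D.l
  c := Cell.base D.c

/-- The tangent data induced on the total category of a fibration. -/
def totalData {P : Fib.{v, u}} (D : TangentData P) : TangentCatData P.total where
  T := Mor.total D.T
  p := Cell.total D.p
  Tn n := Mor.total (D.Tn n)
  leg n := Cell.total (D.leg n)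
  proj n i := Cell.total (D.proj n i)
  z := Cell.total D.z
  s := Cell.total D.s
  l := Cell.total D.l
  c := Cell.total D.c

/-- A tangent fibration: the total and the base category are tangent categories, and (this is what
it means that the data `D` live in `Fib`) the fibration strictly preserves the tangent structures
and the tangent bundle functors form a morphism of fibrations. -/
structure IsTangentFibration {P : Fib.{v, u}} (D : TangentData P) : Prop where
  total : (totalData D).IsTangentCategory
  base : (baseData D).IsTangentCategory

end TangentFibration

section Result

variable {P : Fib.{v, max u v}} (D : TangentData P)

/-- The fibration `VF(Π)`, whose total and base category are the categories of vector fields. -/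
noncomputable def VF : Fib.{v, max u v} := vf.{v, max u v} D.T D.p

/-- The forgetful `1`-morphism `U : VF(Π) ⟶ Π`. -/
noncomputable def U : VF.{v, u} D ⟶ P := vfForget.{v, u} D.T D.p

/-- The tautological `2`-morphism `U ⟶ T ∘ U`. -/
noncomputable def univCell : U.{v, u} D ⟶ U.{v, u} D ≫ D.T := vfCell.{v, u} D.T D.p

lemma univCell_section :
    univCell.{v, u} D ≫ U.{v, u} D ◁ D.p ≫ (ρ_ (U.{v, u} D)).hom = 𝟙 (U.{v, u} D) :=
  cell_ext
    (NatTrans.ext (funext fun (X : VFBase D.T D.p) =>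
      (congrArg (fun x => X.field ≫ x) (Category.comp_id _)).trans X.field_p))
    (NatTrans.ext (funext fun (X : VFTotal D.T D.p) =>
      (congrArg (fun x => X.field ≫ x) (Category.comp_id _)).trans X.field_p))

/-- The vector field in the Hom-tangent category `[VF(Π) ‖ Π]` formed by `U` and the tautological
`2`-morphism. -/
noncomputable def universalField {D : TangentData P} (hD : D.IsTangentad)
    (E : TangentData (VF.{v, u} D)) (hE : E.IsTangentad)
    (law : E.T ≫ U.{v, u} D ⟶ U.{v, u} D ≫ D.T)
    (hlaw : IsLax (A := ⟨VF.{v, u} D, E, hE⟩) (B := ⟨P, D, hD⟩) (U.{v, u} D) law)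
    (hcell : law ≫ univCell.{v, u} D ▷ D.T =
      E.T ◁ univCell.{v, u} D ≫ compLaw (A := ⟨VF.{v, u} D, E, hE⟩) (B := ⟨P, D, hD⟩)
        (D := ⟨P, D, hD⟩) (U.{v, u} D) law D.T D.c) :
    VecField (homTangent (⟨VF.{v, u} D, E, hE⟩ : Tangentad Fib.{v, max u v}) ⟨P, D, hD⟩)
      (homProj ⟨VF.{v, u} D, E, hE⟩ ⟨P, D, hD⟩) where
  obj := ⟨U.{v, u} D, law, hlaw⟩
  field := ⟨univCell.{v, u} D, hcell⟩
  field_p := LaxMor.hom_ext (univCell_section D)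

/-- `VF(Π)` with the tangent structure `E` is the tangentad of vector fields of `Π`, by means of
the forgetful `1`-morphism, with its distributive law, and the tautological vector field. -/
def IsTangentadOfVectorFields {D : TangentData P} (hD : D.IsTangentad)
    (E : TangentData (VF.{v, u} D)) (hE : E.IsTangentad) : Prop :=
  ∃ (law : E.T ≫ U.{v, u} D ⟶ U.{v, u} D ≫ D.T)
    (hlaw : IsLax (A := ⟨VF.{v, u} D, E, hE⟩) (B := ⟨P, D, hD⟩) (U.{v, u} D) law)
    (hcell : law ≫ univCell.{v, u} D ▷ D.T =
      E.T ◁ univCell.{v, u} D ≫ compLaw (A := ⟨VF.{v, u} D, E, hE⟩) (B := ⟨P, D, hD⟩)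
        (D := ⟨P, D, hD⟩) (U.{v, u} D) law D.T D.c),
    IsUniversalVectorField (universalField.{v, u} hD E hE law hlaw hcell)

end Result

end Fib
end TangentFib

/-! Everything reduces to computations carried out separately in the base and in the total category,
and two principles glue the halves together. First, that a morphism of the total category lies over
a prescribed `f` amounts to an equation in the base, so it can be tested there against a jointly
monic family (`isHomLift_of_unique`, `comp_eq_comp_of_isHomLift`). Secondly, a morphism into the
source of a Cartesian arrow is determined by the morphism it lies over and by its composite with
that arrow, so structure on the target of a Cartesian arrow pulls back to the source in a unique
way.

Tangentads in `Fib` are the tangent fibrations (`isTangentad_iff`). Objects of the base and of the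
total category of `Π` are `1`-morphisms into `Π` from two test fibrations over a point, with empty
total category and with one-object total category. Precomposing a pointwise limit with them yields
limits in the two categories. Conversely, objectwise limits in both categories form a limit in the
Hom-category, by the first principle.

For the vector fields of a tangent category, the equational axioms are inherited from the underlying
morphisms and only the limits need an argument. A factorisation through a limit `P` respects the
fields as soon as an equation between morphisms into `TP` holds, and for this the `T`-image of the
limit cone only has to be jointly monic. For fibre powers this is part of the axioms. For the square
of the vertical lift it is `universal_ext`: the flip compares the `T`-image of the square at `M`
with the square at `TM`. Applied to base and total category this gives the tangent structure
`vfData` on `VF(Π)`.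

A vector field in `[Y ‖ Π]` consists of a `1`-morphism `F`, a law `a` and a section `w` of `TF ⟶ F`.
The pair `(F, w)` is the same as a `1`-morphism `H` from `Y` to `VF(Π)`. Compatibility of `w` with
`a` says, because the flip is an involution, that the components of `a` are morphisms of vector
fields, so `a` lifts to a law for `H`. That law satisfies the axioms because `U` is faithful
(`isLax_of_comp_U`). Morphisms are treated in the same way, so `Γ` is fully faithful and bijective
on objects, hence an isomorphism.

PIE limits are formed in the base and in the total category as for categories. The projection is
again a fibration: coordinatewise for products; for equifiers because the source of a Cartesian lift
is again equified (`eqTotal_of_isStronglyCartesian`); for inserters because the cell pulls back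
along a Cartesian arrow (`exists_inserter_lift`). -/

namespace TangentFib

/-! ### Fibre powers and pullbacks through existence and uniqueness of factorisations -/

section FiberPower

variable {C : Type u} [Category.{v} C]

/-- Existence and uniqueness as separate propositions suit the later constructions, where
factorisations come from existential statements. The leg `b` is kept apart from the projections
because for `n = 0` no projection determines it. -/
lemma IsFiberPower.intro {E B P : C} {q : E ⟶ B} {n : ℕ} {b : P ⟶ B} {π : Fin n → (P ⟶ E)}
    (hπ : ∀ i, π i ≫ q = b)
    (hl : ∀ {Z : C} (b' : Z ⟶ B) (π' : Fin n → (Z ⟶ E)), (∀ i, π' i ≫ q = b') →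
      ∃ f : Z ⟶ P, f ≫ b = b' ∧ ∀ i, f ≫ π i = π' i)
    (hu : ∀ {Z : C} {f g : Z ⟶ P}, f ≫ b = g ≫ b → (∀ i, f ≫ π i = g ≫ π i) → f = g) :
    IsFiberPower q b π := by
  choose f hf using fun t : WidePullbackCone (fun _ : Fin n => q) => hl t.base t.π t.condition
  refine ⟨hπ, ⟨WidePullbackCone.IsLimit.mk _ f (fun t => (hf t).1) (fun t => (hf t).2) ?_⟩⟩
  exact fun t m h₁ h₂ => hu (h₁.trans (hf t).1.symm) fun i => (h₂ i).trans ((hf t).2 i).symm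

/-- Morphisms into a nonempty fibre power are determined by the projections. -/
lemma IsFiberPower.hom_ext_proj {E B P : C} {q : E ⟶ B} {n : ℕ} {b : P ⟶ B}
    {π : Fin n → (P ⟶ E)} (h : IsFiberPower q b π) (i : Fin n) {Z : C} {f g : Z ⟶ P}
    (hq : ∀ i, f ≫ π i = g ≫ π i) : f = g :=
  h.hom_ext (by rw [← h.comp_eq i, reassoc_of% hq i]) hq

lemma IsFiberPower.hom_ext_two {E B P : C} {q : E ⟶ B} {b : P ⟶ B}
    {π : Fin 2 → (P ⟶ E)} (h : IsFiberPower q b π) {Z : C} {f g : Z ⟶ P}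
    (h₁ : f ≫ π 0 = g ≫ π 0) (h₂ : f ≫ π 1 = g ≫ π 1) : f = g :=
  h.hom_ext_proj 0 (Fin.forall_fin_two.2 ⟨h₁, h₂⟩)

lemma IsFiberPower.exists_lift_two {E B P : C} {q : E ⟶ B} {b : P ⟶ B}
    {π : Fin 2 → (P ⟶ E)} (h : IsFiberPower q b π) {Z : C} (a₁ a₂ : Z ⟶ E)
    (ha : a₁ ≫ q = a₂ ≫ q) : ∃ f : Z ⟶ P, f ≫ π 0 = a₁ ∧ f ≫ π 1 = a₂ := by
  obtain ⟨f, -, hf⟩ := h.exists_lift (a₁ ≫ q) ![a₁, a₂] (Fin.forall_fin_two.2 ⟨rfl, ha.symm⟩)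
  exact ⟨f, hf 0, hf 1⟩

lemma isPullback_intro {P X Y Z : C} {fst : P ⟶ X} {snd : P ⟶ Y} {f : X ⟶ Z} {g : Y ⟶ Z}
    (w : fst ≫ f = snd ≫ g)
    (hl : ∀ {W : C} (a : W ⟶ X) (b : W ⟶ Y), a ≫ f = b ≫ g →
      ∃ k : W ⟶ P, k ≫ fst = a ∧ k ≫ snd = b)
    (hu : ∀ {W : C} {k k' : W ⟶ P}, k ≫ fst = k' ≫ fst → k ≫ snd = k' ≫ snd → k = k') :
    IsPullback fst snd f g := by
  choose k hk using fun s : PullbackCone f g => hl s.fst s.snd s.condition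
  exact ⟨⟨w⟩, ⟨PullbackCone.IsLimit.mk w k (fun s => (hk s).1) (fun s => (hk s).2)
    fun s m h₁ h₂ => hu (h₁.trans (hk s).1.symm) (h₂.trans (hk s).2.symm)⟩⟩

end FiberPower

/-! ### Limits of vector fields -/

section VecFieldLimits

variable {C : Type u} [Category.{v} C] {T : C ⥤ C} {p : T ⟶ 𝟭 C}

lemma VecField.hom_comm {X Y : VecField T p} (f : X ⟶ Y) :
    X.field ≫ T.map (Hom.hom f) = Hom.hom f ≫ Y.field := Hom.comm f

/-- The obstruction to `f` being a morphism of vector fields vanishes after composition with `T g`,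
because both `g` and `f ≫ g` respect the fields. Letting `g` run through a cone whose `T`-image is
jointly monic makes `f` itself a morphism of vector fields. -/
lemma VecField.comp_comm {X Y Z : VecField T p} {f : X.obj ⟶ Y.obj} {g : Y ⟶ Z} {h : X ⟶ Z}
    (hfg : f ≫ Hom.hom g = Hom.hom h) :
    (X.field ≫ T.map f) ≫ T.map (Hom.hom g) = (f ≫ Y.field) ≫ T.map (Hom.hom g) := by
  rw [Category.assoc, Category.assoc, ← T.map_comp, hfg, VecField.hom_comm, VecField.hom_comm,
    reassoc_of% hfg]

/-- A morphism into a fibre power preserved by `T` lifts to vector fields as soon as its components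
do. -/
lemma VecField.exists_hom_of_isFiberPower {E B P Z : VecField T p} {q : E ⟶ B} {n : ℕ}
    {b : P ⟶ B} {π : Fin n → (P ⟶ E)}
    (hT : IsFiberPower (T.map (Hom.hom q)) (T.map (Hom.hom b)) fun i => T.map (Hom.hom (π i)))
    (f : Z.obj ⟶ P.obj) (b' : Z ⟶ B) (π' : Fin n → (Z ⟶ E))
    (hb : f ≫ Hom.hom b = Hom.hom b') (hπ : ∀ i, f ≫ Hom.hom (π i) = Hom.hom (π' i)) :
    ∃ f' : Z ⟶ P, Hom.hom f' = f :=
  ⟨⟨f, hT.hom_ext (comp_comm hb) fun i => comp_comm (hπ i)⟩, rfl⟩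

lemma VecField.exists_hom_of_isFiberPower_two {E B P Z : VecField T p} {q : E ⟶ B}
    {b : P ⟶ B} {π : Fin 2 → (P ⟶ E)}
    (hT : IsFiberPower (T.map (Hom.hom q)) (T.map (Hom.hom b)) fun i => T.map (Hom.hom (π i)))
    (f : Z.obj ⟶ P.obj) (a₁ a₂ : Z ⟶ E)
    (h₁ : f ≫ Hom.hom (π 0) = Hom.hom a₁) (h₂ : f ≫ Hom.hom (π 1) = Hom.hom a₂) :
    ∃ f' : Z ⟶ P, Hom.hom f' = f :=
  ⟨⟨f, hT.hom_ext_two (comp_comm h₁) (comp_comm h₂)⟩, rfl⟩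

/-- The factorisation is the one in `C`; the hypothesis on the `T`-image of the cone is what makes
it respect the fields. -/
lemma VecField.isFiberPower {E B P : VecField T p} {q : E ⟶ B} {n : ℕ} {b : P ⟶ B}
    {π : Fin n → (P ⟶ E)}
    (h : IsFiberPower (Hom.hom q) (Hom.hom b) fun i => Hom.hom (π i))
    (hT : IsFiberPower (T.map (Hom.hom q)) (T.map (Hom.hom b)) fun i => T.map (Hom.hom (π i))) :
    IsFiberPower q b π := by
  refine .intro (fun i => hom_ext (h.comp_eq i)) (fun b' π' hq => ?_) fun hb hπ => ?_
  · obtain ⟨f, hf, hf'⟩ := h.exists_lift (Hom.hom b') (fun i => Hom.hom (π' i))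
      fun i => congrArg Hom.hom (hq i)
    obtain ⟨f, rfl⟩ := exists_hom_of_isFiberPower hT f b' π' hf hf'
    exact ⟨f, hom_ext hf, fun i => hom_ext (hf' i)⟩
  · exact hom_ext (h.hom_ext (congrArg Hom.hom hb) fun i => congrArg Hom.hom (hπ i))

/-- Only joint monicity of the `T`-image is required, not that `T` preserves the pullback: the
axioms of a tangent category do not include preservation of the square of the vertical lift. -/
lemma VecField.isPullback {P X Y Z : VecField T p} {fst : P ⟶ X} {snd : P ⟶ Y} {f : X ⟶ Z}
    {g : Y ⟶ Z} (h : IsPullback (Hom.hom fst) (Hom.hom snd) (Hom.hom f) (Hom.hom g))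
    (hT : ∀ {W : C} {k k' : W ⟶ T.obj P.obj}, k ≫ T.map (Hom.hom fst) = k' ≫ T.map (Hom.hom fst) →
      k ≫ T.map (Hom.hom snd) = k' ≫ T.map (Hom.hom snd) → k = k') :
    IsPullback fst snd f g := by
  refine isPullback_intro (hom_ext h.w) (fun a b hab => ?_) fun h₁ h₂ => ?_
  · obtain ⟨k, h₁, h₂⟩ := h.exists_lift (Hom.hom a) (Hom.hom b) (congrArg Hom.hom hab)
    exact ⟨⟨k, hT (comp_comm h₁) (comp_comm h₂)⟩, hom_ext h₁, hom_ext h₂⟩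
  · exact hom_ext (h.hom_ext (congrArg Hom.hom h₁) (congrArg Hom.hom h₂))

end VecFieldLimits
-- The tangent category of vector fields
namespace TangentCatData

section
variable {C : Type u} [Category.{v} C] {D : TangentCatData C}

/-- The axiom provides one quadruple of induced morphisms. Morphisms into `T₂` are determined by
their two projections, so any quadruple with the same components is that one. -/
lemma IsTangentCategory.s_assoc_of (h : D.IsTangentCategory) {M : C}
    {e₁ e₂ g₁ g₂ : (D.Tn 3).obj M ⟶ (D.Tn 2).obj M}
    (he₁ : e₁ ≫ D.pr₁.app M = (D.proj 3 0).app M ∧ e₁ ≫ D.pr₂.app M = (D.proj 3 1).app M)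
    (he₂ : e₂ ≫ D.pr₁.app M = (D.proj 3 1).app M ∧ e₂ ≫ D.pr₂.app M = (D.proj 3 2).app M)
    (hg₁ : g₁ ≫ D.pr₁.app M = e₁ ≫ D.s.app M ∧ g₁ ≫ D.pr₂.app M = (D.proj 3 2).app M)
    (hg₂ : g₂ ≫ D.pr₁.app M = (D.proj 3 0).app M ∧ g₂ ≫ D.pr₂.app M = e₂ ≫ D.s.app M) :
    g₁ ≫ D.s.app M = g₂ ≫ D.s.app M := by
  obtain ⟨e₁', e₂', g₁', g₂', he₁', he₂', hg₁', hg₂', hs⟩ := h.s_assoc M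
  obtain rfl := (h.power 2 M).hom_ext_two (he₁.1.trans he₁'.1.symm) (he₁.2.trans he₁'.2.symm)
  obtain rfl := (h.power 2 M).hom_ext_two (he₂.1.trans he₂'.1.symm) (he₂.2.trans he₂'.2.symm)
  obtain rfl := (h.power 2 M).hom_ext_two (hg₁.1.trans hg₁'.1.symm) (hg₁.2.trans hg₁'.2.symm)
  obtain rfl := (h.power 2 M).hom_ext_two (hg₂.1.trans hg₂'.1.symm) (hg₂.2.trans hg₂'.2.symm)
  exact hs

/-- The square of the universality of the vertical lift is carried by `T` to a jointly monic pair,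
since its image is isomorphic, via the flip, to the same square at `TM`. -/
lemma IsTangentCategory.universal_ext (h : D.IsTangentCategory) {M : C}
    {g : (D.Tn 2).obj M ⟶ D.T.obj ((D.Tn 2).obj M)}
    (g₁ : g ≫ D.T.map (D.pr₁.app M) = D.pr₁.app M ≫ D.l.app M)
    (g₂ : g ≫ D.T.map (D.pr₂.app M) = D.pr₂.app M ≫ D.z.app (D.T.obj M))
    {W : C} {k k' : W ⟶ D.T.obj ((D.Tn 2).obj M)}
    (h₁ : k ≫ D.T.map (g ≫ D.T.map (D.s.app M)) = k' ≫ D.T.map (g ≫ D.T.map (D.s.app M)))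
    (h₂ : k ≫ D.T.map (D.pr₁.app M ≫ D.p.app M) = k' ≫ D.T.map (D.pr₁.app M ≫ D.p.app M)) :
    k = k' := by
  -- `φ : T T₂M ⟶ T₂ TM` is the flip on fibre products; it will carry the `T`-image of the square at
  -- `M` to the square at `TM`.
  obtain ⟨φ, φ₁, φ₂, φs⟩ := h.s_c M
  obtain ⟨g', g'₁, g'₂, hg'⟩ := h.universal (D.T.obj M)
  have hc : IsIso (D.c.app M) := ⟨D.c.app M, h.c_c M, h.c_c M⟩
  -- This is `c_l` solved for `l` at `TM`, using that `c` is an involution at `M` and at `TM`.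
  have cl : D.c.app M ≫ D.l.app (D.T.obj M) =
      D.T.map (D.l.app M) ≫ D.c.app (D.T.obj M) ≫ D.T.map (D.c.app M) := by
    have e := h.c_l M
    have e₁ := h.c_c M
    have e₂ := h.c_c (D.T.obj M)
    have e₃ : D.T.map (D.c.app M) ≫ D.T.map (D.c.app M) = 𝟙 _ := by
      rw [← D.T.map_comp, e₁]; exact D.T.map_id _
    rw [← cancel_epi (D.c.app M), reassoc_of% e₁, ← reassoc_of% e, reassoc_of% e₂, e₃]
    exact (Category.comp_id _).symm
  -- Up to flips, `φ` intertwines `T g` with its analogue `g'` at `TM`. Both sides land in `T T₂TM`,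
  -- so it suffices to compare the two projections; the first uses `cl` and the second the
  -- compatibility of `z` with `c`.
  have hψ : φ ≫ g' = D.T.map g ≫ D.c.app ((D.Tn 2).obj M) ≫ D.T.map φ := by
    refine (h.powerT 2 (D.T.obj M)).hom_ext_two ?_ ?_
    · have e := congrArg D.T.map g₁
      simp only [D.T.map_comp] at e
      have n := nat_c (D := D) (D.pr₁.app M)
      rw [Category.assoc, g'₁, reassoc_of% φ₁, cl, Category.assoc, Category.assoc,
        ← D.T.map_comp, φ₁, D.T.map_comp, ← reassoc_of% n, reassoc_of% e]
    · have e := congrArg D.T.map g₂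
      simp only [D.T.map_comp] at e
      have n := nat_c (D := D) (D.pr₂.app M)
      have zc := h.z_c (D.T.obj M)
      rw [Category.assoc, g'₂, reassoc_of% φ₂, nat_z, Category.assoc, Category.assoc,
        ← D.T.map_comp, φ₂, D.T.map_comp, ← reassoc_of% n, reassoc_of% e, reassoc_of% zc]
  -- `hs` and `hp` match the two sides of the squares: the top sides agree up to two flips and the
  -- left sides agree exactly.
  have hs : φ ≫ g' ≫ D.T.map (D.s.app (D.T.obj M)) = D.T.map (g ≫ D.T.map (D.s.app M)) ≫
      D.c.app (D.T.obj M) ≫ D.T.map (D.c.app M) := by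
    have n := nat_c (D := D) (D.s.app M)
    rw [reassoc_of% hψ, ← D.T.map_comp, ← φs, D.T.map_comp, D.T.map_comp, Category.assoc,
      ← reassoc_of% n]
  have hp : φ ≫ D.pr₁.app (D.T.obj M) ≫ D.p.app (D.T.obj M) =
      D.T.map (D.pr₁.app M ≫ D.p.app M) := by
    rw [reassoc_of% φ₁, h.c_p, D.T.map_comp]
  have hφ : k ≫ φ = k' ≫ φ := by
    apply hg'.hom_ext
    · simp only [Category.assoc]
      rw [hs, reassoc_of% h₁]
    · rw [Category.assoc, Category.assoc, hp, h₂]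
  -- Equality survives cancellation of `φ`, because the projections of `φ` are the `T`-images of the
  -- projections followed by the isomorphism `c`.
  refine (h.powerT 2 M).hom_ext_two ?_ ?_ <;> rw [← cancel_mono (D.c.app M)]
  · rw [Category.assoc, Category.assoc, ← φ₁, reassoc_of% hφ]
  · rw [Category.assoc, Category.assoc, ← φ₂, reassoc_of% hφ]

end

variable {C : Type u} [Category.{v} C] {D : TangentCatData C} (h : D.IsTangentCategory)

lemma IsTangentCategory.iterate_vf_forget (k : ℕ) :
    h.vf.iterate k ⋙ VecField.forget D.T D.p = VecField.forget D.T D.p ⋙ D.iterate k := by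
  induction k with
  | zero => rfl
  | succ k ih =>
    change h.vf.iterate k ⋙ (VecField.forget D.T D.p ⋙ D.T) = _
    rw [← Functor.assoc, ih]
    rfl

lemma IsTangentCategory.vf_isFiberPower (n : ℕ) (X : VecField D.T D.p) (k : ℕ) :
    IsFiberPower ((h.vf.iterate k).map (h.vf.p.app X)) ((h.vf.iterate k).map ((h.vf.leg n).app X))
      (fun i => (h.vf.iterate k).map ((h.vf.proj n i).app X)) := by
  -- The equality of functors for iterates is only propositional. With a variable functor `G` it can
  -- be substituted, which transports source, target and all morphisms of the cone at once.
  have key : ∀ G : VecField D.T D.p ⥤ C, ∀ j, G = VecField.forget D.T D.p ⋙ D.iterate j →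
      IsFiberPower (G.map (h.vf.p.app X)) (G.map ((h.vf.leg n).app X))
        (fun i => G.map ((h.vf.proj n i).app X)) := by
    rintro _ j rfl
    exact h.isFiberPower n X.obj j
  refine VecField.isFiberPower (key _ k (h.iterate_vf_forget k))
    -- The `T`-image of the `k`-th iterate of the cone is its iterate `k + 1` in `C`, again a fibre
    -- power.
    (key (h.vf.iterate k ⋙ VecField.forget D.T D.p ⋙ D.T) (k + 1) ?_)
  rw [← Functor.assoc, h.iterate_vf_forget]
  rfl

/-- Vector fields form a tangent category. -/
theorem IsTangentCategory.vf_isTangentCategory : h.vf.IsTangentCategory where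
  isFiberPower n X k := h.vf_isFiberPower n X k
  z_p X := VecField.hom_ext (h.z_p X.obj)
  s_p X := VecField.hom_ext (h.s_p X.obj)
  s_assoc X := by
    obtain ⟨e₁, e₂, g₁, g₂, ⟨he₁, he₁'⟩, ⟨he₂, he₂'⟩, ⟨hg₁, hg₁'⟩, ⟨hg₂, hg₂'⟩, hs⟩ :=
      h.s_assoc X.obj
    -- The components of `g₁` and `g₂` involve `e₁` and `e₂`, so the latter must be lifted to vector
    -- fields first.
    have lift : ∀ (f : (D.Tn 3).obj X.obj ⟶ (D.Tn 2).obj X.obj)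
        (a₁ a₂ : (h.vf.Tn 3).obj X ⟶ h.vf.T.obj X), f ≫ D.pr₁.app X.obj = VecField.Hom.hom a₁ →
        f ≫ D.pr₂.app X.obj = VecField.Hom.hom a₂ →
        ∃ f' : (h.vf.Tn 3).obj X ⟶ (h.vf.Tn 2).obj X, VecField.Hom.hom f' = f := fun f a₁ a₂ =>
      VecField.exists_hom_of_isFiberPower_two (q := h.vf.p.app X)
        (b := (h.vf.leg 2).app X) (π := fun i => (h.vf.proj 2 i).app X)
        (h.powerT 2 X.obj) f a₁ a₂
    obtain ⟨e₁, rfl⟩ := lift e₁ ((h.vf.proj 3 0).app X) ((h.vf.proj 3 1).app X) he₁ he₁'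
    obtain ⟨e₂, rfl⟩ := lift e₂ ((h.vf.proj 3 1).app X) ((h.vf.proj 3 2).app X) he₂ he₂'
    obtain ⟨g₁, rfl⟩ := lift g₁ (e₁ ≫ h.vf.s.app X) ((h.vf.proj 3 2).app X) hg₁ hg₁'
    obtain ⟨g₂, rfl⟩ := lift g₂ ((h.vf.proj 3 0).app X) (e₂ ≫ h.vf.s.app X) hg₂ hg₂'
    exact ⟨e₁, e₂, g₁, g₂, ⟨VecField.hom_ext he₁, VecField.hom_ext he₁'⟩,
      ⟨VecField.hom_ext he₂, VecField.hom_ext he₂'⟩, ⟨VecField.hom_ext hg₁, VecField.hom_ext hg₁'⟩,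
      ⟨VecField.hom_ext hg₂, VecField.hom_ext hg₂'⟩, VecField.hom_ext hs⟩
  s_unit X := by
    obtain ⟨g, h₁, h₂, h₃⟩ := h.s_unit X.obj
    obtain ⟨g, rfl⟩ := VecField.exists_hom_of_isFiberPower_two (q := h.vf.p.app X)
      (Z := h.vf.T.obj X) (b := (h.vf.leg 2).app X) (π := fun i => (h.vf.proj 2 i).app X)
      (h.powerT 2 X.obj) g (h.vf.p.app X ≫ h.vf.z.app X) (𝟙 _) h₁ h₂
    exact ⟨g, VecField.hom_ext h₁, VecField.hom_ext h₂, VecField.hom_ext h₃⟩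
  s_comm X := by
    obtain ⟨g, h₁, h₂, h₃⟩ := h.s_comm X.obj
    obtain ⟨g, rfl⟩ := VecField.exists_hom_of_isFiberPower_two (q := h.vf.p.app X)
      (Z := (h.vf.Tn 2).obj X) (b := (h.vf.leg 2).app X) (π := fun i => (h.vf.proj 2 i).app X)
      (h.powerT 2 X.obj) g (h.vf.pr₂.app X) (h.vf.pr₁.app X) h₁ h₂
    exact ⟨g, VecField.hom_ext h₁, VecField.hom_ext h₂, VecField.hom_ext h₃⟩
  l_p X := VecField.hom_ext (h.l_p X.obj)
  z_l X := VecField.hom_ext (h.z_l X.obj)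
  s_l X := by
    obtain ⟨g, h₁, h₂, h₃⟩ := h.s_l X.obj
    -- The target is already the `T`-image of a fibre power, so the joint monicity needed is that of
    -- its second iterate.
    obtain ⟨g, rfl⟩ := VecField.exists_hom_of_isFiberPower_two (q := h.vf.T.map (h.vf.p.app X))
      (Z := (h.vf.Tn 2).obj X) (b := h.vf.T.map ((h.vf.leg 2).app X))
      (π := fun i => h.vf.T.map ((h.vf.proj 2 i).app X))
      (h.isFiberPower 2 X.obj 2) g (h.vf.pr₁.app X ≫ h.vf.l.app X)
      (h.vf.pr₂.app X ≫ h.vf.l.app X) h₁ h₂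
    exact ⟨g, VecField.hom_ext h₁, VecField.hom_ext h₂, VecField.hom_ext h₃⟩
  c_p X := VecField.hom_ext (h.c_p X.obj)
  z_c X := VecField.hom_ext (h.z_c X.obj)
  s_c X := by
    obtain ⟨g, h₁, h₂, h₃⟩ := h.s_c X.obj
    obtain ⟨g, rfl⟩ := VecField.exists_hom_of_isFiberPower_two
      (q := h.vf.p.app (h.vf.T.obj X)) (Z := h.vf.T.obj ((h.vf.Tn 2).obj X))
      (b := (h.vf.leg 2).app (h.vf.T.obj X)) (π := fun i => (h.vf.proj 2 i).app (h.vf.T.obj X))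
      (h.powerT 2 (D.T.obj X.obj)) g (h.vf.T.map (h.vf.pr₁.app X) ≫ h.vf.c.app X)
      (h.vf.T.map (h.vf.pr₂.app X) ≫ h.vf.c.app X) h₁ h₂
    exact ⟨g, VecField.hom_ext h₁, VecField.hom_ext h₂, VecField.hom_ext h₃⟩
  l_l X := VecField.hom_ext (h.l_l X.obj)
  l_c X := VecField.hom_ext (h.l_c X.obj)
  c_l X := VecField.hom_ext (h.c_l X.obj)
  c_c X := VecField.hom_ext (h.c_c X.obj)
  yang_baxter X := VecField.hom_ext (h.yang_baxter X.obj)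
  universal X := by
    obtain ⟨g, h₁, h₂, h₃⟩ := h.universal X.obj
    obtain ⟨g, rfl⟩ := VecField.exists_hom_of_isFiberPower_two (q := h.vf.T.map (h.vf.p.app X))
      (Z := (h.vf.Tn 2).obj X) (b := h.vf.T.map ((h.vf.leg 2).app X))
      (π := fun i => h.vf.T.map ((h.vf.proj 2 i).app X))
      (h.isFiberPower 2 X.obj 2) g (h.vf.pr₁.app X ≫ h.vf.l.app X)
      (h.vf.pr₂.app X ≫ h.vf.z.app (h.vf.T.obj X)) h₁ h₂
    exact ⟨g, VecField.hom_ext h₁, VecField.hom_ext h₂,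
      VecField.isPullback h₃ (h.universal_ext h₁ h₂)⟩

end TangentCatData

/-! ### Objectwise limits in functor categories -/

section NatTransLimits

variable {A : Type*} [Category* A] {C : Type u} [Category.{v} C]

/-- The chosen components of the factorisation are natural because two morphisms into the fibre
power at the target object are compared through the leg and the projections. -/
lemma isFiberPower_of_app {E B P : A ⥤ C} {q : E ⟶ B} {n : ℕ} {b : P ⟶ B} {π : Fin n → (P ⟶ E)}
    (h : ∀ M, IsFiberPower (q.app M) (b.app M) fun i => (π i).app M) : IsFiberPower q b π := by
  refine .intro (fun i => by ext M; exact (h M).comp_eq i) (fun {Z} b' π' hq => ?_) fun hb hπ => ?_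
  · choose f hf using fun M => (h M).exists_lift (b'.app M) (fun i => (π' i).app M)
      fun i => NatTrans.congr_app (hq i) M
    refine ⟨⟨f, fun M N k => (h N).hom_ext ?_ fun i => ?_⟩, ?_, fun i => ?_⟩
    · simp [(hf _).1, reassoc_of% (hf _).1]
    · simp [(hf _).2, reassoc_of% (hf _).2]
    · ext M; exact (hf M).1
    · ext M; exact (hf M).2 i
  · ext M
    exact (h M).hom_ext (NatTrans.congr_app hb M) fun i => NatTrans.congr_app (hπ i) M

lemma isPullback_of_app {P X Y Z : A ⥤ C} {fst : P ⟶ X} {snd : P ⟶ Y} {f : X ⟶ Z} {g : Y ⟶ Z}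
    (h : ∀ M, IsPullback (fst.app M) (snd.app M) (f.app M) (g.app M)) :
    IsPullback fst snd f g := by
  refine isPullback_intro (by ext M; exact (h M).w) (fun a b hab => ?_) fun h₁ h₂ => ?_
  · choose k hk using fun M => (h M).exists_lift (a.app M) (b.app M) (NatTrans.congr_app hab M)
    refine ⟨⟨k, fun M N x => (h N).hom_ext ?_ ?_⟩, ?_, ?_⟩
    · simp [(hk _).1, reassoc_of% (hk _).1]
    · simp [(hk _).2, reassoc_of% (hk _).2]
    · ext M; exact (hk M).1
    · ext M; exact (hk M).2
  · ext M
    exact (h M).hom_ext (NatTrans.congr_app h₁ M) (NatTrans.congr_app h₂ M)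

end NatTransLimits

/-! ### Lying over a morphism as an equation in the base -/

section HomLift

variable {E : Type*} {B : Type*} [Category* E] [Category* B] (P : E ⥤ B)

lemma isHomLift_unique {R S : B} {X Y : E} {f f' : R ⟶ S} (φ : X ⟶ Y) (h : P.IsHomLift f φ)
    (h' : P.IsHomLift f' φ) : f = f' :=
  (IsHomLift.fac P f φ).trans (IsHomLift.fac P f' φ).symm

variable {P} in
lemma isHomLift_domain {R S : B} {X Y : E} {f : R ⟶ S} {φ : X ⟶ Y} (h : P.IsHomLift f φ) :
    P.obj X = R := IsHomLift.domain_eq P f φ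

lemma isHomLift_comp {R S T : B} {X Y Z : E} {f : R ⟶ S} {g : S ⟶ T} {φ : X ⟶ Y} {ψ : Y ⟶ Z}
    (h : P.IsHomLift f φ) (h' : P.IsHomLift g ψ) : P.IsHomLift (f ≫ g) (φ ≫ ψ) :=
  IsHomLift.comp P f g φ ψ

/-- Once the endpoints match, `φ` lies over some morphism, namely its image. It therefore suffices
that every candidate equals `f`, which may be checked after composition with a jointly monic family
of the base. -/
lemma isHomLift_of_unique {R S : B} {X Y : E} (f : R ⟶ S) (φ : X ⟶ Y) (hX : P.obj X = R)
    (hY : P.obj Y = S) (h : ∀ f' : R ⟶ S, P.IsHomLift f' φ → f = f') : P.IsHomLift f φ := by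
  subst hX hY
  obtain rfl := h (P.map φ) (.map φ)
  exact .map φ

/-- Both composites with `β` lie under the single morphism `φ ≫ β' = ψ`, the first because it equals
`g`. This supplies one of the tests needed to identify `f` with `f'`. -/
lemma comp_eq_comp_of_isHomLift {R S S' : B} {X Y Y' : E} {f f' : R ⟶ S} {β : S ⟶ S'}
    {φ : X ⟶ Y} {β' : Y ⟶ Y'} {g : R ⟶ S'} {ψ : X ⟶ Y'} (hf' : P.IsHomLift f' φ)
    (hβ : P.IsHomLift β β') (hg : P.IsHomLift g ψ) (e : f ≫ β = g) (e' : φ ≫ β' = ψ) :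
    f ≫ β = f' ≫ β := by
  subst e e'
  exact isHomLift_unique P (φ ≫ β') hg (isHomLift_comp P hf' hβ)

end HomLift

namespace Fib

/-! ### Objectwise limits in the Hom-categories of `Fib` -/

section Components

variable {P Q R : Fib.{v, u}}

lemma hom_ext_app {F G : P ⟶ Q} {α β : F ⟶ G}
    (hb : ∀ M, (Cell.base α).app M = (Cell.base β).app M)
    (ht : ∀ X, (Cell.total α).app X = (Cell.total β).app X) : α = β :=
  cell_ext (NatTrans.ext (funext hb)) (NatTrans.ext (funext ht))

lemma base_app_congr {F G : P ⟶ Q} {α β : F ⟶ G} (h : α = β) (M : P.base) :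
    (Cell.base α).app M = (Cell.base β).app M := by rw [h]

lemma total_app_congr {F G : P ⟶ Q} {α β : F ⟶ G} (h : α = β) (X : P.total) :
    (Cell.total α).app X = (Cell.total β).app X := by rw [h]

/-- Factorisations are built independently on the base and on the total categories. The second
automatically lies over the first: whatever it lies over has the same leg and projections in the
base, where these are jointly monic. -/
lemma isFiberPower_of_app {E B W : P ⟶ Q} {q : E ⟶ B} {n : ℕ} {b : W ⟶ B} {π : Fin n → (W ⟶ E)}
    (hb : ∀ M, IsFiberPower ((Cell.base q).app M) ((Cell.base b).app M)
      fun i => (Cell.base (π i)).app M)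
    (ht : ∀ X, IsFiberPower ((Cell.total q).app X) ((Cell.total b).app X)
      fun i => (Cell.total (π i)).app X) : IsFiberPower q b π := by
  refine .intro (fun i => hom_ext_app (fun M => (hb M).comp_eq i) fun X => (ht X).comp_eq i)
    (fun {Z} b' π' hq => ?_) fun h hπ => ?_
  · obtain ⟨f, hf, hf'⟩ := (TangentFib.isFiberPower_of_app hb).exists_lift (Cell.base b')
      (fun i => Cell.base (π' i)) fun i => congrArg Cell.base (hq i)
    obtain ⟨g, hg, hg'⟩ := (TangentFib.isFiberPower_of_app ht).exists_lift (Cell.total b')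
      (fun i => Cell.total (π' i)) fun i => congrArg Cell.total (hq i)
    refine ⟨Cell.mk (F := Z) (G := W) f g fun X => ?_, cell_ext hf hg,
      fun i => cell_ext (hf' i) (hg' i)⟩
    refine isHomLift_of_unique Q.proj _ _ (Mor.comm_obj Z X) (Mor.comm_obj W X) fun f' hf'' =>
      (hb _).hom_ext ?_ fun i => ?_
    · exact comp_eq_comp_of_isHomLift Q.proj hf'' (Cell.comm b X) (Cell.comm b' X)
        (NatTrans.congr_app hf _) (NatTrans.congr_app hg _)
    · exact comp_eq_comp_of_isHomLift Q.proj hf'' (Cell.comm (π i) X) (Cell.comm (π' i) X)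
        (NatTrans.congr_app (hf' i) _) (NatTrans.congr_app (hg' i) _)
  · exact hom_ext_app (fun M => (hb M).hom_ext (base_app_congr h M) fun i => base_app_congr (hπ i) M)
      fun X => (ht X).hom_ext (total_app_congr h X) fun i => total_app_congr (hπ i) X

lemma isPullback_of_app {W X Y Z : P ⟶ Q} {fst : W ⟶ X} {snd : W ⟶ Y} {f : X ⟶ Z} {g : Y ⟶ Z}
    (hb : ∀ M, IsPullback ((Cell.base fst).app M) ((Cell.base snd).app M)
      ((Cell.base f).app M) ((Cell.base g).app M))
    (ht : ∀ M, IsPullback ((Cell.total fst).app M) ((Cell.total snd).app M)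
      ((Cell.total f).app M) ((Cell.total g).app M)) : IsPullback fst snd f g := by
  refine isPullback_intro (hom_ext_app (fun M => (hb M).w) fun X => (ht X).w)
    (fun {V} a b hab => ?_) fun h₁ h₂ => ?_
  · obtain ⟨k, hk, hk'⟩ := (TangentFib.isPullback_of_app hb).exists_lift (Cell.base a)
      (Cell.base b) (congrArg Cell.base hab)
    obtain ⟨m, hm, hm'⟩ := (TangentFib.isPullback_of_app ht).exists_lift (Cell.total a)
      (Cell.total b) (congrArg Cell.total hab)
    refine ⟨Cell.mk (F := V) (G := W) k m fun X => ?_, cell_ext hk hm, cell_ext hk' hm'⟩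
    refine isHomLift_of_unique Q.proj _ _ (Mor.comm_obj V X) (Mor.comm_obj W X) fun f' hf' =>
      (hb _).hom_ext ?_ ?_
    · exact comp_eq_comp_of_isHomLift Q.proj hf' (Cell.comm fst X) (Cell.comm a X)
        (NatTrans.congr_app hk _) (NatTrans.congr_app hm _)
    · exact comp_eq_comp_of_isHomLift Q.proj hf' (Cell.comm snd X) (Cell.comm b X)
        (NatTrans.congr_app hk' _) (NatTrans.congr_app hm' _)
  · exact hom_ext_app (fun M => (hb M).hom_ext (base_app_congr h₁ M) (base_app_congr h₂ M))
      fun X => (ht X).hom_ext (total_app_congr h₁ X) (total_app_congr h₂ X)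

end Components

/-! ### Test fibrations detecting objects of the base and of the total category -/

section Points

/-- The type `α` with a unique morphism between any two objects. -/
def Indiscrete (α : Type u) : Type u := α

instance (α : Type u) : Category.{v} (Indiscrete α) where
  Hom _ _ := PUnit
  id _ := ⟨⟩
  comp _ _ := ⟨⟩

/-- The indiscrete category on `α` as a fibration over the terminal category. -/
def indiscrete (α : Type u) : Fib.{v, u} where
  total := Indiscrete α
  base := Indiscrete PUnit
  proj := { obj _ := PUnit.unit, map _ := PUnit.unit }
  cleavage :=
    { obj {_ X} _ := X
      lift _ := PUnit.unit
      cartesian {M X} f := by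
        let P : Indiscrete.{u} α ⥤ Indiscrete.{u} PUnit.{u + 1} :=
          { obj _ := PUnit.unit, map _ := PUnit.unit }
        have h : ∀ {X Y : Indiscrete.{u} α} (f : P.obj X ⟶ P.obj Y) (φ : X ⟶ Y),
          P.IsHomLift f φ := fun _ φ => .map (p := P) φ
        exact
          { toIsHomLift := h (X := X) (Y := X) _ _
            universal_property' _ _ _ := ⟨PUnit.unit, ⟨h _ _, rfl⟩, fun _ _ => rfl⟩ } }

/-- The object of the base of an indiscrete fibration. -/
def indiscreteBase (α : Type u) : (indiscrete.{v, u} α).base := PUnit.unit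

/-- The object of the total category of the terminal fibration. -/
def indiscreteTotal : (indiscrete.{v, u} PUnit).total := PUnit.unit

lemma indiscrete_base_hom {α : Type u} {M N : (indiscrete.{v, u} α).base} (f : M ⟶ N) :
    f = 𝟙 M := rfl

lemma indiscrete_total_hom {M N : (indiscrete.{v, u} PUnit).total} (f : M ⟶ N) : f = 𝟙 M := rfl

/-- Elimination from the empty total category. -/
def indiscreteElim {γ : Sort*} (X : (indiscrete.{v, u} PEmpty).total) : γ :=
  PEmpty.elim (show PEmpty from X)

variable {P Q : Fib.{v, u}}

/-- An object of the base category, as a `1`-morphism. -/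
def basePoint (M : P.base) : indiscrete.{v, u} PEmpty ⟶ P :=
  Mor.mk (P := indiscrete.{v, u} PEmpty) (Q := P) ((Functor.const _).obj M)
    { obj X := indiscreteElim X
      map {X} := indiscreteElim X
      map_id X := indiscreteElim X
      map_comp {X} := indiscreteElim X }
    (CategoryTheory.Functor.ext (fun X => indiscreteElim X) fun X => indiscreteElim X)
    fun {_ _ X} => indiscreteElim X

/-- A morphism of the base category, as a `2`-morphism. -/
def basePointHom {G : indiscrete.{v, u} PEmpty ⟶ Q} {Z : Q.base}
    (f : Z ⟶ (Mor.base G).obj (indiscreteBase _)) : basePoint Z ⟶ G :=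
  Cell.mk (F := basePoint Z) (G := G)
    { app _ := f
      naturality M N k := by
        rw [indiscrete_base_hom k]
        exact (Category.id_comp _).trans ((Category.comp_id _).symm.trans
          (congrArg (fun x => f ≫ x) ((Mor.base G).map_id _).symm)) }
    { app X := indiscreteElim X, naturality X := indiscreteElim X } fun X => indiscreteElim X

lemma basePoint_hom_ext {F G : indiscrete.{v, u} PEmpty ⟶ Q} {α β : F ⟶ G}
    (h : (Cell.base α).app (indiscreteBase _) = (Cell.base β).app (indiscreteBase _)) : α = β :=
  hom_ext_app (fun _ => h) fun X => indiscreteElim X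

/-- An object of the total category, as a `1`-morphism. -/
def totalPoint (X : P.total) : indiscrete.{v, u} PUnit ⟶ P :=
  Mor.mk (P := indiscrete.{v, u} PUnit) (Q := P) ((Functor.const _).obj (P.proj.obj X))
    ((Functor.const _).obj X)
    (CategoryTheory.Functor.ext (fun _ => rfl) fun _ _ _ => (P.proj.map_id X).trans (by simp))
    fun {_ _ _ _} _ _ _ => inferInstanceAs (P.proj.IsStronglyCartesian (𝟙 (P.proj.obj X)) (𝟙 X))

/-- A morphism of the total category, as a `2`-morphism. -/
def totalPointHom {G : indiscrete.{v, u} PUnit ⟶ Q} {Z : Q.total}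
    (f : Z ⟶ (Mor.total G).obj indiscreteTotal) : totalPoint Z ⟶ G :=
  Cell.mk (F := totalPoint Z) (G := G)
    { app _ := Q.proj.map f ≫ eqToHom (Mor.comm_obj G indiscreteTotal)
      naturality M N k := by
        rw [indiscrete_base_hom k]
        exact (Category.id_comp _).trans ((Category.comp_id _).symm.trans
          (congrArg (fun x => (Q.proj.map f ≫ eqToHom (Mor.comm_obj G indiscreteTotal)) ≫ x)
            ((Mor.base G).map_id _).symm)) }
    { app _ := f
      naturality M N k := by
        rw [indiscrete_total_hom k]
        exact (Category.id_comp _).trans ((Category.comp_id _).symm.trans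
          (congrArg (fun x => f ≫ x) ((Mor.total G).map_id _).symm)) }
    fun _ => (inferInstance : Q.proj.IsHomLift
      (Q.proj.map f ≫ eqToHom (Mor.comm_obj G indiscreteTotal)) f)

/-- The base component of a `2`-morphism is forced by the total one, over which it has no freedom of
its own once there is an object upstairs. -/
lemma totalPoint_hom_ext {F G : indiscrete.{v, u} PUnit ⟶ Q} {α β : F ⟶ G}
    (h : (Cell.total α).app indiscreteTotal = (Cell.total β).app indiscreteTotal) : α = β := by
  refine hom_ext_app (fun _ => ?_) fun _ => h
  have h₁ := Cell.comm α indiscreteTotal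
  rw [h] at h₁
  exact isHomLift_unique Q.proj _ h₁ (Cell.comm β indiscreteTotal)

/-- With empty total category, a `2`-morphism out of `basePoint Z` is just a morphism of the base
category. Evaluated at `basePoint M`, the universal property in the Hom-category therefore becomes
the one in the base. -/
lemma isFiberPower_base_app {E B W : P ⟶ Q} {q : E ⟶ B} {n : ℕ} {b : W ⟶ B}
    {π : Fin n → (W ⟶ E)}
    (h : ∀ {Y : Fib.{v, u}} (F : Y ⟶ P), IsFiberPower (F ◁ q) (F ◁ b) fun i => F ◁ π i)
    (M : P.base) : IsFiberPower ((Cell.base q).app M) ((Cell.base b).app M)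
      fun i => (Cell.base (π i)).app M := by
  have h := h (basePoint M)
  refine .intro (fun i => base_app_congr (h.comp_eq i) (indiscreteBase _)) (fun b' π' hq => ?_)
    fun {Z f g} hb hπ => ?_
  · obtain ⟨f, hf, hf'⟩ := h.exists_lift (basePointHom (G := basePoint M ≫ B) b')
      (fun i => basePointHom (G := basePoint M ≫ E) (π' i)) fun i => basePoint_hom_ext (hq i)
    exact ⟨(Cell.base f).app (indiscreteBase _), base_app_congr hf (indiscreteBase _),
      fun i => base_app_congr (hf' i) (indiscreteBase _)⟩
  · exact base_app_congr (h.hom_ext (f := basePointHom (G := basePoint M ≫ W) f)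
      (g := basePointHom (G := basePoint M ≫ W) g) (basePoint_hom_ext hb)
      fun i => basePoint_hom_ext (hπ i)) (indiscreteBase _)

/-- A `2`-morphism out of `totalPoint Z` is a morphism of the total category, its base component
being the image under the projection. Evaluation at `totalPoint X` thus gives the universal property
upstairs. -/
lemma isFiberPower_total_app {E B W : P ⟶ Q} {q : E ⟶ B} {n : ℕ} {b : W ⟶ B}
    {π : Fin n → (W ⟶ E)}
    (h : ∀ {Y : Fib.{v, u}} (F : Y ⟶ P), IsFiberPower (F ◁ q) (F ◁ b) fun i => F ◁ π i)
    (X : P.total) : IsFiberPower ((Cell.total q).app X) ((Cell.total b).app X)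
      fun i => (Cell.total (π i)).app X := by
  have h := h (totalPoint X)
  refine .intro (fun i => total_app_congr (h.comp_eq i) indiscreteTotal) (fun b' π' hq => ?_)
    fun {Z f g} hb hπ => ?_
  · obtain ⟨f, hf, hf'⟩ := h.exists_lift (totalPointHom (G := totalPoint X ≫ B) b')
      (fun i => totalPointHom (G := totalPoint X ≫ E) (π' i)) fun i => totalPoint_hom_ext (hq i)
    exact ⟨(Cell.total f).app indiscreteTotal, total_app_congr hf indiscreteTotal,
      fun i => total_app_congr (hf' i) indiscreteTotal⟩
  · exact total_app_congr (h.hom_ext (f := totalPointHom (G := totalPoint X ≫ W) f)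
      (g := totalPointHom (G := totalPoint X ≫ W) g) (totalPoint_hom_ext hb)
      fun i => totalPoint_hom_ext (hπ i)) indiscreteTotal

lemma isPullback_base_app {W X Y Z : P ⟶ Q} {fst : W ⟶ X} {snd : W ⟶ Y} {f : X ⟶ Z} {g : Y ⟶ Z}
    (h : ∀ {Y : Fib.{v, u}} (F : Y ⟶ P), IsPullback (F ◁ fst) (F ◁ snd) (F ◁ f) (F ◁ g))
    (M : P.base) : IsPullback ((Cell.base fst).app M) ((Cell.base snd).app M)
      ((Cell.base f).app M) ((Cell.base g).app M) := by
  have h := h (basePoint M)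
  refine isPullback_intro (base_app_congr h.w (indiscreteBase _)) (fun a b hab => ?_)
    fun {V k k'} h₁ h₂ => ?_
  · obtain ⟨k, hk, hk'⟩ := h.exists_lift (basePointHom (G := basePoint M ≫ X) a)
      (basePointHom (G := basePoint M ≫ Y) b) (basePoint_hom_ext hab)
    exact ⟨(Cell.base k).app (indiscreteBase _), base_app_congr hk (indiscreteBase _),
      base_app_congr hk' (indiscreteBase _)⟩
  · exact base_app_congr (h.hom_ext (k := basePointHom (G := basePoint M ≫ W) k)
      (l := basePointHom (G := basePoint M ≫ W) k') (basePoint_hom_ext h₁)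
      (basePoint_hom_ext h₂)) (indiscreteBase _)

lemma isPullback_total_app {W X Y Z : P ⟶ Q} {fst : W ⟶ X} {snd : W ⟶ Y} {f : X ⟶ Z} {g : Y ⟶ Z}
    (h : ∀ {Y : Fib.{v, u}} (F : Y ⟶ P), IsPullback (F ◁ fst) (F ◁ snd) (F ◁ f) (F ◁ g))
    (M : P.total) : IsPullback ((Cell.total fst).app M) ((Cell.total snd).app M)
      ((Cell.total f).app M) ((Cell.total g).app M) := by
  have h := h (totalPoint M)
  refine isPullback_intro (total_app_congr h.w indiscreteTotal) (fun a b hab => ?_)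
    fun {V k k'} h₁ h₂ => ?_
  · obtain ⟨k, hk, hk'⟩ := h.exists_lift (totalPointHom (G := totalPoint M ≫ X) a)
      (totalPointHom (G := totalPoint M ≫ Y) b) (totalPoint_hom_ext hab)
    exact ⟨(Cell.total k).app indiscreteTotal, total_app_congr hk indiscreteTotal,
      total_app_congr hk' indiscreteTotal⟩
  · exact total_app_congr (h.hom_ext (k := totalPointHom (G := totalPoint M ≫ W) k)
      (l := totalPointHom (G := totalPoint M ≫ W) k') (totalPoint_hom_ext h₁)
      (totalPoint_hom_ext h₂)) indiscreteTotal

end Points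

end Fib

/-! ### Tangentads in `Fib` are tangent fibrations -/

namespace Fib

section Components

variable {P Q R S : Fib.{v, u}}

@[simp] lemma mor_comp_base (F : P ⟶ Q) (G : Q ⟶ R) : Mor.base (F ≫ G) = Mor.base F ⋙ Mor.base G := rfl

@[simp] lemma mor_comp_total (F : P ⟶ Q) (G : Q ⟶ R) : Mor.total (F ≫ G) = Mor.total F ⋙ Mor.total G :=
  rfl

@[simp] lemma mor_id_base : Mor.base (𝟙 P) = 𝟭 P.base := rfl

@[simp] lemma mor_id_total : Mor.total (𝟙 P) = 𝟭 P.total := rfl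

@[simp] lemma cell_id_base (F : P ⟶ Q) (M : P.base) :
    (Cell.base (𝟙 F)).app M = 𝟙 ((Mor.base F).obj M) := rfl

@[simp] lemma cell_id_total (F : P ⟶ Q) (M : P.total) :
    (Cell.total (𝟙 F)).app M = 𝟙 ((Mor.total F).obj M) := rfl

@[simp] lemma cell_comp_base {F G H : P ⟶ Q} (α : F ⟶ G) (β : G ⟶ H) (M : P.base) :
    (Cell.base (α ≫ β)).app M = (Cell.base α).app M ≫ (Cell.base β).app M := rfl

@[simp] lemma cell_comp_total {F G H : P ⟶ Q} (α : F ⟶ G) (β : G ⟶ H) (M : P.total) :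
    (Cell.total (α ≫ β)).app M = (Cell.total α).app M ≫ (Cell.total β).app M := rfl

@[simp] lemma cell_whiskerLeft_base (F : P ⟶ Q) {G H : Q ⟶ R} (α : G ⟶ H) (M : P.base) :
    (Cell.base (F ◁ α)).app M = (Cell.base α).app ((Mor.base F).obj M) := rfl

@[simp] lemma cell_whiskerLeft_total (F : P ⟶ Q) {G H : Q ⟶ R} (α : G ⟶ H) (M : P.total) :
    (Cell.total (F ◁ α)).app M = (Cell.total α).app ((Mor.total F).obj M) := rfl

@[simp] lemma cell_whiskerRight_base {F G : P ⟶ Q} (α : F ⟶ G) (H : Q ⟶ R) (M : P.base) :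
    (Cell.base (α ▷ H)).app M = (Mor.base H).map ((Cell.base α).app M) := rfl

@[simp] lemma cell_whiskerRight_total {F G : P ⟶ Q} (α : F ⟶ G) (H : Q ⟶ R) (M : P.total) :
    (Cell.total (α ▷ H)).app M = (Mor.total H).map ((Cell.total α).app M) := rfl

@[simp] lemma cell_associator_hom_base (F : P ⟶ Q) (G : Q ⟶ R) (H : R ⟶ S) (M : P.base) :
    (Cell.base (α_ F G H).hom).app M = 𝟙 ((Mor.base H).obj ((Mor.base G).obj ((Mor.base F).obj M))) :=
  rfl

@[simp] lemma cell_associator_inv_base (F : P ⟶ Q) (G : Q ⟶ R) (H : R ⟶ S) (M : P.base) :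
    (Cell.base (α_ F G H).inv).app M = 𝟙 ((Mor.base H).obj ((Mor.base G).obj ((Mor.base F).obj M))) :=
  rfl

@[simp] lemma cell_associator_hom_total (F : P ⟶ Q) (G : Q ⟶ R) (H : R ⟶ S) (M : P.total) :
    (Cell.total (α_ F G H).hom).app M =
      𝟙 ((Mor.total H).obj ((Mor.total G).obj ((Mor.total F).obj M))) :=
  rfl

@[simp] lemma cell_associator_inv_total (F : P ⟶ Q) (G : Q ⟶ R) (H : R ⟶ S) (M : P.total) :
    (Cell.total (α_ F G H).inv).app M =
      𝟙 ((Mor.total H).obj ((Mor.total G).obj ((Mor.total F).obj M))) :=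
  rfl

@[simp] lemma cell_leftUnitor_hom_base (F : P ⟶ Q) (M : P.base) :
    (Cell.base (λ_ F).hom).app M = 𝟙 ((Mor.base F).obj M) := rfl

@[simp] lemma cell_leftUnitor_inv_base (F : P ⟶ Q) (M : P.base) :
    (Cell.base (λ_ F).inv).app M = 𝟙 ((Mor.base F).obj M) := rfl

@[simp] lemma cell_leftUnitor_hom_total (F : P ⟶ Q) (M : P.total) :
    (Cell.total (λ_ F).hom).app M = 𝟙 ((Mor.total F).obj M) := rfl

@[simp] lemma cell_leftUnitor_inv_total (F : P ⟶ Q) (M : P.total) :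
    (Cell.total (λ_ F).inv).app M = 𝟙 ((Mor.total F).obj M) := rfl

@[simp] lemma cell_rightUnitor_hom_base (F : P ⟶ Q) (M : P.base) :
    (Cell.base (ρ_ F).hom).app M = 𝟙 ((Mor.base F).obj M) := rfl

@[simp] lemma cell_rightUnitor_inv_base (F : P ⟶ Q) (M : P.base) :
    (Cell.base (ρ_ F).inv).app M = 𝟙 ((Mor.base F).obj M) := rfl

@[simp] lemma cell_rightUnitor_hom_total (F : P ⟶ Q) (M : P.total) :
    (Cell.total (ρ_ F).hom).app M = 𝟙 ((Mor.total F).obj M) := rfl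

@[simp] lemma cell_rightUnitor_inv_total (F : P ⟶ Q) (M : P.total) :
    (Cell.total (ρ_ F).inv).app M = 𝟙 ((Mor.total F).obj M) := rfl

end Components

attribute [local simp] baseData totalData

variable {P : Fib.{v, u}} {D : TangentData P}

lemma baseData_iterate (D : TangentData P) (k : ℕ) :
    (baseData D).iterate k = Mor.base (iter D.T k) := by
  induction k with
  | zero => rfl
  | succ k ih => exact congrArg (· ⋙ Mor.base D.T) ih

lemma totalData_iterate (D : TangentData P) (k : ℕ) :
    (totalData D).iterate k = Mor.total (iter D.T k) := by
  induction k with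
  | zero => rfl
  | succ k ih => exact congrArg (· ⋙ Mor.total D.T) ih

/-- Equational axioms are evaluated at an object, where associators and unitors become identities;
the limits are evaluated through the test fibrations. -/
theorem base_isTangentCategory (hD : D.IsTangentad) : (baseData D).IsTangentCategory where
  isFiberPower n M k := by
    rw [baseData_iterate]
    exact isFiberPower_base_app (fun F => hD.isFiberPower n F k) M
  z_p M := by simpa using base_app_congr hD.z_p M
  s_p M := by simpa using base_app_congr hD.s_p M
  s_assoc M := by
    obtain ⟨e₁, e₂, g₁, g₂, ⟨he₁, he₁'⟩, ⟨he₂, he₂'⟩, ⟨hg₁, hg₁'⟩, ⟨hg₂, hg₂'⟩, hs⟩ := hD.s_assoc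
    exact ⟨(Cell.base e₁).app M, (Cell.base e₂).app M, (Cell.base g₁).app M, (Cell.base g₂).app M,
      ⟨base_app_congr he₁ M, base_app_congr he₁' M⟩, ⟨base_app_congr he₂ M, base_app_congr he₂' M⟩,
      ⟨base_app_congr hg₁ M, base_app_congr hg₁' M⟩, ⟨base_app_congr hg₂ M, base_app_congr hg₂' M⟩,
      base_app_congr hs M⟩
  s_unit M := by
    obtain ⟨g, h₁, h₂, h₃⟩ := hD.s_unit
    exact ⟨(Cell.base g).app M, base_app_congr h₁ M, base_app_congr h₂ M, base_app_congr h₃ M⟩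
  s_comm M := by
    obtain ⟨g, h₁, h₂, h₃⟩ := hD.s_comm
    exact ⟨(Cell.base g).app M, base_app_congr h₁ M, base_app_congr h₂ M, base_app_congr h₃ M⟩
  l_p M := by simpa using base_app_congr hD.l_p M
  z_l M := by simpa using base_app_congr hD.z_l M
  s_l M := by
    obtain ⟨g, h₁, h₂, h₃⟩ := hD.s_l
    exact ⟨(Cell.base g).app M, base_app_congr h₁ M, base_app_congr h₂ M, base_app_congr h₃ M⟩
  c_p M := by simpa using base_app_congr hD.c_p M
  z_c M := by simpa using base_app_congr hD.z_c M
  s_c M := by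
    obtain ⟨g, h₁, h₂, h₃⟩ := hD.s_c
    exact ⟨(Cell.base g).app M, base_app_congr h₁ M, base_app_congr h₂ M, base_app_congr h₃ M⟩
  l_l M := by simpa using base_app_congr hD.l_l M
  l_c M := by simpa using base_app_congr hD.l_c M
  c_l M := by simpa using base_app_congr hD.c_l M
  c_c M := by simpa using base_app_congr hD.c_c M
  yang_baxter M := by simpa using base_app_congr hD.yang_baxter M
  universal M := by
    obtain ⟨g, h₁, h₂, h₃⟩ := hD.universal
    refine ⟨(Cell.base g).app M, base_app_congr h₁ M, ?_, ?_⟩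
    · simpa using base_app_congr h₂ M
    · simpa using isPullback_base_app h₃ M

theorem total_isTangentCategory (hD : D.IsTangentad) : (totalData D).IsTangentCategory where
  isFiberPower n M k := by
    rw [totalData_iterate]
    exact isFiberPower_total_app (fun F => hD.isFiberPower n F k) M
  z_p M := by simpa using total_app_congr hD.z_p M
  s_p M := by simpa using total_app_congr hD.s_p M
  s_assoc M := by
    obtain ⟨e₁, e₂, g₁, g₂, ⟨he₁, he₁'⟩, ⟨he₂, he₂'⟩, ⟨hg₁, hg₁'⟩, ⟨hg₂, hg₂'⟩, hs⟩ := hD.s_assoc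
    exact ⟨(Cell.total e₁).app M, (Cell.total e₂).app M, (Cell.total g₁).app M, (Cell.total g₂).app M,
      ⟨total_app_congr he₁ M, total_app_congr he₁' M⟩, ⟨total_app_congr he₂ M, total_app_congr he₂' M⟩,
      ⟨total_app_congr hg₁ M, total_app_congr hg₁' M⟩, ⟨total_app_congr hg₂ M, total_app_congr hg₂' M⟩,
      total_app_congr hs M⟩
  s_unit M := by
    obtain ⟨g, h₁, h₂, h₃⟩ := hD.s_unit
    exact ⟨(Cell.total g).app M, total_app_congr h₁ M, total_app_congr h₂ M, total_app_congr h₃ M⟩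
  s_comm M := by
    obtain ⟨g, h₁, h₂, h₃⟩ := hD.s_comm
    exact ⟨(Cell.total g).app M, total_app_congr h₁ M, total_app_congr h₂ M, total_app_congr h₃ M⟩
  l_p M := by simpa using total_app_congr hD.l_p M
  z_l M := by simpa using total_app_congr hD.z_l M
  s_l M := by
    obtain ⟨g, h₁, h₂, h₃⟩ := hD.s_l
    exact ⟨(Cell.total g).app M, total_app_congr h₁ M, total_app_congr h₂ M, total_app_congr h₃ M⟩
  c_p M := by simpa using total_app_congr hD.c_p M
  z_c M := by simpa using total_app_congr hD.z_c M
  s_c M := by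
    obtain ⟨g, h₁, h₂, h₃⟩ := hD.s_c
    exact ⟨(Cell.total g).app M, total_app_congr h₁ M, total_app_congr h₂ M, total_app_congr h₃ M⟩
  l_l M := by simpa using total_app_congr hD.l_l M
  l_c M := by simpa using total_app_congr hD.l_c M
  c_l M := by simpa using total_app_congr hD.c_l M
  c_c M := by simpa using total_app_congr hD.c_c M
  yang_baxter M := by simpa using total_app_congr hD.yang_baxter M
  universal M := by
    obtain ⟨g, h₁, h₂, h₃⟩ := hD.universal
    refine ⟨(Cell.total g).app M, total_app_congr h₁ M, ?_, ?_⟩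
    · simpa using total_app_congr h₂ M
    · simpa using isPullback_total_app h₃ M

/-- A `2`-morphism into a fibre square is determined componentwise, together with any property of
its components. -/
lemma exists_cell_two {P Q : Fib.{v, u}} {E B W Z : P ⟶ Q} {q : E ⟶ B} {b : W ⟶ B}
    {π : Fin 2 → (W ⟶ E)}
    (hb : ∀ M, IsFiberPower ((Cell.base q).app M) ((Cell.base b).app M)
      fun i => (Cell.base (π i)).app M)
    (ht : ∀ X, IsFiberPower ((Cell.total q).app X) ((Cell.total b).app X)
      fun i => (Cell.total (π i)).app X) (a₁ a₂ : Z ⟶ E)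
    {Rb : ∀ M, ((Mor.base Z).obj M ⟶ (Mor.base W).obj M) → Prop}
    {Rt : ∀ M, ((Mor.total Z).obj M ⟶ (Mor.total W).obj M) → Prop}
    (gb : ∀ M, ∃ g, g ≫ (Cell.base (π 0)).app M = (Cell.base a₁).app M ∧
      g ≫ (Cell.base (π 1)).app M = (Cell.base a₂).app M ∧ Rb M g)
    (gt : ∀ M, ∃ g, g ≫ (Cell.total (π 0)).app M = (Cell.total a₁).app M ∧
      g ≫ (Cell.total (π 1)).app M = (Cell.total a₂).app M ∧ Rt M g) :
    ∃ g : Z ⟶ W, g ≫ π 0 = a₁ ∧ g ≫ π 1 = a₂ ∧ (∀ M, Rb M ((Cell.base g).app M)) ∧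
      ∀ M, Rt M ((Cell.total g).app M) := by
  -- The compatibility of `a₁` and `a₂` over `q` need not be assumed: it follows from the mere
  -- existence of componentwise factorisations.
  obtain ⟨g, h₁, h₂⟩ := (isFiberPower_of_app hb ht).exists_lift_two a₁ a₂ (by
    refine hom_ext_app (fun M => ?_) fun M => ?_
    · obtain ⟨g, h₁, h₂, -⟩ := gb M
      rw [cell_comp_base, cell_comp_base, ← h₁, ← h₂, Category.assoc, Category.assoc,
        (hb M).comp_eq 0, (hb M).comp_eq 1]
    · obtain ⟨g, h₁, h₂, -⟩ := gt M
      rw [cell_comp_total, cell_comp_total, ← h₁, ← h₂, Category.assoc, Category.assoc,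
        (ht M).comp_eq 0, (ht M).comp_eq 1])
  refine ⟨g, h₁, h₂, fun M => ?_, fun M => ?_⟩
  -- By uniqueness the component of `g` is the given factorisation, so it inherits its property.
  · obtain ⟨g', h₁', h₂', hR⟩ := gb M
    rwa [(hb M).hom_ext_two ((base_app_congr h₁ M).trans h₁'.symm)
      ((base_app_congr h₂ M).trans h₂'.symm)]
  · obtain ⟨g', h₁', h₂', hR⟩ := gt M
    rwa [(ht M).hom_ext_two ((total_app_congr h₁ M).trans h₁'.symm)
      ((total_app_congr h₂ M).trans h₂'.symm)]

/-- Tangent fibrations are tangentads in `Fib`. -/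
theorem IsTangentFibration.isTangentad (h : IsTangentFibration D) : D.IsTangentad where
  isFiberPower n Y F k := by
    refine isFiberPower_of_app (fun M => ?_) fun X => ?_
    · have := h.base.isFiberPower n ((Mor.base F).obj M) k
      rw [baseData_iterate] at this
      exact this
    · have := h.total.isFiberPower n ((Mor.total F).obj X) k
      rw [totalData_iterate] at this
      exact this
  z_p := hom_ext_app (fun M => by simpa using h.base.z_p M) fun M => by simpa using h.total.z_p M
  s_p := hom_ext_app (fun M => by simpa using h.base.s_p M) fun M => by simpa using h.total.s_p M
  s_assoc := by
    -- Associativity involves four interdependent induced morphisms. They are constructed as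
    -- `2`-morphisms, and `s_assoc_of` then applies to their components.
    have hp : IsFiberPower D.p (D.leg 2) (D.proj 2) :=
      isFiberPower_of_app (h.base.power 2) (h.total.power 2)
    have hp3 : IsFiberPower D.p (D.leg 3) (D.proj 3) :=
      isFiberPower_of_app (h.base.power 3) (h.total.power 3)
    have sp : D.s ≫ D.p = D.pr₁ ≫ D.p := hom_ext_app h.base.s_p h.total.s_p
    have he : ∀ i j, D.proj 3 i ≫ D.p = D.proj 3 j ≫ D.p := fun i j =>
      (hp3.comp_eq i).trans (hp3.comp_eq j).symm
    obtain ⟨e₁, he₁⟩ := hp.exists_lift_two (D.proj 3 0) (D.proj 3 1) (he _ _)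
    obtain ⟨e₂, he₂⟩ := hp.exists_lift_two (D.proj 3 1) (D.proj 3 2) (he _ _)
    obtain ⟨g₁, hg₁⟩ := hp.exists_lift_two (e₁ ≫ D.s) (D.proj 3 2) (by
      rw [Category.assoc, sp, reassoc_of% he₁.1]; exact he _ _)
    obtain ⟨g₂, hg₂⟩ := hp.exists_lift_two (D.proj 3 0) (e₂ ≫ D.s) (by
      rw [Category.assoc, sp, reassoc_of% he₂.1]; exact he _ _)
    refine ⟨e₁, e₂, g₁, g₂, he₁, he₂, hg₁, hg₂, hom_ext_app (fun M => ?_) fun M => ?_⟩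
    · exact h.base.s_assoc_of ⟨base_app_congr he₁.1 M, base_app_congr he₁.2 M⟩
        ⟨base_app_congr he₂.1 M, base_app_congr he₂.2 M⟩
        ⟨base_app_congr hg₁.1 M, base_app_congr hg₁.2 M⟩
        ⟨base_app_congr hg₂.1 M, base_app_congr hg₂.2 M⟩
    · exact h.total.s_assoc_of ⟨total_app_congr he₁.1 M, total_app_congr he₁.2 M⟩
        ⟨total_app_congr he₂.1 M, total_app_congr he₂.2 M⟩
        ⟨total_app_congr hg₁.1 M, total_app_congr hg₁.2 M⟩
        ⟨total_app_congr hg₂.1 M, total_app_congr hg₂.2 M⟩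
  s_unit := by
    obtain ⟨g, h₁, h₂, hb, ht⟩ := exists_cell_two (h.base.power 2) (h.total.power 2)
      (D.p ≫ D.z) (𝟙 D.T) h.base.s_unit h.total.s_unit
    exact ⟨g, h₁, h₂, hom_ext_app hb ht⟩
  s_comm := by
    obtain ⟨g, h₁, h₂, hb, ht⟩ := exists_cell_two (h.base.power 2) (h.total.power 2)
      D.pr₂ D.pr₁ h.base.s_comm h.total.s_comm
    exact ⟨g, h₁, h₂, hom_ext_app hb ht⟩
  l_p := hom_ext_app (fun M => by simpa using h.base.l_p M) fun M => by simpa using h.total.l_p M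
  z_l := hom_ext_app (fun M => by simpa using h.base.z_l M) fun M => by simpa using h.total.z_l M
  s_l := by
    obtain ⟨g, h₁, h₂, hb, ht⟩ := exists_cell_two (q := D.p ▷ D.T) (b := D.leg 2 ▷ D.T)
      (π := fun i => D.proj 2 i ▷ D.T) (h.base.powerT 2) (h.total.powerT 2)
      (D.pr₁ ≫ D.l) (D.pr₂ ≫ D.l) h.base.s_l h.total.s_l
    exact ⟨g, h₁, h₂, hom_ext_app hb ht⟩
  c_p := hom_ext_app (fun M => by simpa using h.base.c_p M) fun M => by simpa using h.total.c_p M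
  z_c := hom_ext_app (fun M => by simpa using h.base.z_c M) fun M => by simpa using h.total.z_c M
  s_c := by
    obtain ⟨g, h₁, h₂, hb, ht⟩ := exists_cell_two (q := D.T ◁ D.p) (b := D.T ◁ D.leg 2)
      (π := fun i => D.T ◁ D.proj 2 i) (fun M => h.base.power 2 _) (fun M => h.total.power 2 _)
      (D.pr₁ ▷ D.T ≫ D.c) (D.pr₂ ▷ D.T ≫ D.c) h.base.s_c h.total.s_c
    exact ⟨g, h₁, h₂, hom_ext_app hb ht⟩
  l_l := hom_ext_app (fun M => by simpa using h.base.l_l M) fun M => by simpa using h.total.l_l M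
  l_c := hom_ext_app (fun M => by simpa using h.base.l_c M) fun M => by simpa using h.total.l_c M
  c_l := hom_ext_app (fun M => by simpa using h.base.c_l M) fun M => by simpa using h.total.c_l M
  c_c := hom_ext_app (fun M => by simpa using h.base.c_c M) fun M => by simpa using h.total.c_c M
  yang_baxter := hom_ext_app (fun M => by simpa using h.base.yang_baxter M)
    fun M => by simpa using h.total.yang_baxter M
  universal := by
    -- The property transported to the components of `g` is that the square of the vertical lift is
    -- a pullback.
    obtain ⟨g, h₁, h₂, hb, ht⟩ := exists_cell_two (q := D.p ▷ D.T) (b := D.leg 2 ▷ D.T)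
      (π := fun i => D.proj 2 i ▷ D.T) (h.base.powerT 2) (h.total.powerT 2)
      (D.pr₁ ≫ D.l) (D.pr₂ ≫ (ρ_ D.T).inv ≫ D.T ◁ D.z)
      (fun M => by simpa using h.base.universal M) (fun M => by simpa using h.total.universal M)
    exact ⟨g, h₁, h₂, fun F => isPullback_of_app (fun M => by simpa using hb _)
      fun M => by simpa using ht _⟩

/-- The tangentads in `Fib` are precisely the tangent fibrations. -/
theorem isTangentad_iff : D.IsTangentad ↔ IsTangentFibration D :=
  ⟨fun hD => ⟨total_isTangentCategory hD, base_isTangentCategory hD⟩,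
    IsTangentFibration.isTangentad⟩

end Fib

/-! ### The tangent structure on `VF(Π)` -/

namespace Fib

section VecFieldMor

variable {P Q : Fib.{v, max u v}} {T : Mor P P} {p : T ⟶ idMor P}

lemma vfProj_obj_eq {M : VFBase T p} {X : VFTotal T p} (hX : P.proj.obj X.obj = M.obj)
    (h : P.proj.IsHomLift M.field X.field) : (vfProj T p).obj X = M := by
  apply vfBase_ext hX
  change (P.proj.map X.field ≫ eqToHom (T.comm_obj X.obj)) ≫ T.base.map (eqToHom hX) =
    eqToHom hX ≫ M.field
  rw [IsHomLift.fac' P.proj M.field X.field]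
  simp [eqToHom_map]

lemma isHomLift_vfProj_field (X : VFTotal T p) :
    P.proj.IsHomLift ((vfProj T p).obj X).field X.field :=
  inferInstanceAs (P.proj.IsHomLift (P.proj.map X.field ≫ eqToHom (T.comm_obj X.obj)) X.field)

/-- Strict equality of functors into vector fields: on objects it combines equality of the
underlying objects with `hf` for the fields, and on morphisms the fields play no role since the
forgetful functor is faithful. -/
lemma comp_vfProj_eq {A B : Type*} [Category* A] [Category* B] {K : A ⥤ B} {F : B ⥤ VFBase T p}
    {G : A ⥤ VFTotal T p} (h : (G ⋙ VecField.forget T.total p.total) ⋙ P.proj =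
      K ⋙ F ⋙ VecField.forget T.base p.base)
    (hf : ∀ X, P.proj.IsHomLift (F.obj (K.obj X)).field (G.obj X).field) :
    G ⋙ vfProj T p = K ⋙ F := by
  refine CategoryTheory.Functor.ext
    (fun X => vfProj_obj_eq (Functor.congr_obj h X) (hf X)) fun X Y f => VecField.hom_ext ?_
  rw [VecField.comp_hom, VecField.comp_hom, vfBase_eqToHom_hom _ (Functor.congr_obj h X),
    vfBase_eqToHom_hom _ (Functor.congr_obj h Y).symm]
  exact Functor.congr_hom h f

/-- A `1`-morphism into `VF(Π)`: functors into vector fields over a `1`-morphism into `Π`, whose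
fields lie over each other. -/
noncomputable def vfMor (F : Mor Q P) (B : Q.base ⥤ VFBase T p) (G : Q.total ⥤ VFTotal T p)
    (hB : B ⋙ VecField.forget T.base p.base = F.base)
    (hG : G ⋙ VecField.forget T.total p.total = F.total)
    (hf : ∀ X, P.proj.IsHomLift (B.obj (Q.proj.obj X)).field (G.obj X).field) :
    Mor Q (vf.{v, max u v} T p) where
  base := B
  total := G
  comm := by
    -- Once `F` is split up, its two functors can be replaced by the composites with the forgetful
    -- functors, so its square becomes the hypothesis of `comp_vfProj_eq`.
    obtain ⟨FB, FG, comm, cart⟩ := F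
    obtain rfl : _ = FB := hB
    obtain rfl : _ = FG := hG
    exact comp_vfProj_eq comm hf
  cartesian {M N X Y} f φ h := by
    obtain ⟨FB, FG, comm, cart⟩ := F
    obtain rfl : _ = FB := hB
    obtain rfl : _ = FG := hG
    have hc := cart f φ h
    have hobj : ∀ X, (vfProj T p).obj (G.obj X) = B.obj (Q.proj.obj X) := fun X =>
      vfProj_obj_eq (Functor.congr_obj comm X) (hf X)
    -- An arrow of `VF(Π)` is Cartesian as soon as its underlying arrow is, and the latter is
    -- Cartesian because `F` preserves Cartesian arrows.
    refine vf_isStronglyCartesian _ _ (vfProj_isHomLift _ _ ?_ ?_ hc.toIsHomLift) hc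
    · rw [hobj, IsHomLift.domain_eq Q.proj f φ]
    · rw [hobj, IsHomLift.codomain_eq Q.proj f φ]

/-- A `2`-morphism between `1`-morphisms into `VF(Π)`. -/
def vfCellMk {F G : Q ⟶ vf.{v, max u v} T p} (b : Mor.base F ⟶ Mor.base G)
    (t : Mor.total F ⟶ Mor.total G)
    (h : ∀ X, P.proj.IsHomLift
      (VecField.Hom.hom (T := T.base) (p := p.base) (b.app (Q.proj.obj X)))
      (VecField.Hom.hom (T := T.total) (p := p.total) (t.app X))) : F ⟶ G :=
  Cell.mk (F := F) (G := G) b t fun X =>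
    vfProj_isHomLift _ _ (Mor.comm_obj F X) (Mor.comm_obj G X) (h X)

end VecFieldMor

section VecFieldData

variable {P : Fib.{v, max u v}} {D : TangentData P}

/-- The flips on `Tₙ` are chosen separately upstairs and downstairs. They lie over each other
because the flip downstairs is determined by its leg and projections. -/
lemma isHomLift_flip (h : IsTangentFibration D) (n : ℕ) (X : P.total) :
    P.proj.IsHomLift (TangentCatData.flip h.base n (P.proj.obj X))
      (TangentCatData.flip h.total n X) := by
  refine isHomLift_of_unique P.proj _ _ (Mor.comm_obj (D.T ≫ D.Tn n) X)
    (Mor.comm_obj (D.Tn n ≫ D.T) X) fun f' hf' => (h.base.powerT n _).hom_ext ?_ fun i => ?_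
  · exact comp_eq_comp_of_isHomLift P.proj hf' (Cell.comm (D.leg n ▷ D.T) X)
      (Cell.comm (D.T ◁ D.leg n) X) (TangentCatData.flip_leg h.base n _)
      (TangentCatData.flip_leg h.total n _)
  · exact comp_eq_comp_of_isHomLift P.proj hf' (Cell.comm (D.proj n i ▷ D.T) X)
      (Cell.comm (D.T ◁ D.proj n i ≫ D.c) X) (TangentCatData.flip_proj h.base n _ i)
      (TangentCatData.flip_proj h.total n _ i)

/-- The tangent structure on `VF(Π)`. -/
noncomputable def vfData (h : IsTangentFibration D) : TangentData (VF.{v, u} D) where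
  T := vfMor.{v, u} (U D ≫ D.T) h.base.vf.T h.total.vf.T rfl rfl fun X =>
    isHomLift_comp P.proj (Mor.isHomLift D.T (isHomLift_vfProj_field X)) (Cell.comm D.c X.obj)
  p := vfCellMk.{v, u} h.base.vf.p h.total.vf.p fun X => Cell.comm D.p X.obj
  Tn n := vfMor.{v, u} (U D ≫ D.Tn n) (h.base.vf.Tn n) (h.total.vf.Tn n) rfl rfl fun X =>
    isHomLift_comp P.proj (Mor.isHomLift (D.Tn n) (isHomLift_vfProj_field X))
      (isHomLift_flip h n X.obj)
  leg n := vfCellMk.{v, u} (h.base.vf.leg n) (h.total.vf.leg n)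
    fun X => Cell.comm (D.leg n) X.obj
  proj n i := vfCellMk.{v, u} (h.base.vf.proj n i) (h.total.vf.proj n i)
    fun X => Cell.comm (D.proj n i) X.obj
  z := vfCellMk.{v, u} h.base.vf.z h.total.vf.z fun X => Cell.comm D.z X.obj
  s := vfCellMk.{v, u} h.base.vf.s h.total.vf.s fun X => Cell.comm D.s X.obj
  l := vfCellMk.{v, u} h.base.vf.l h.total.vf.l fun X => Cell.comm D.l X.obj
  c := vfCellMk.{v, u} h.base.vf.c h.total.vf.c fun X => Cell.comm D.c X.obj

/-- The definitional equality here and in `baseData_vfData` allows the tangent axioms of `VF(Π)` to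
be read off from `vf_isTangentCategory` in each category. -/
lemma totalData_vfData (h : IsTangentFibration D) : totalData (vfData.{v, u} h) = h.total.vf := rfl

lemma baseData_vfData (h : IsTangentFibration D) : baseData (vfData.{v, u} h) = h.base.vf := rfl

/-- `VF(Π)` is a tangent fibration. -/
theorem isTangentFibration_vfData (h : IsTangentFibration D) :
    IsTangentFibration (vfData.{v, u} h) :=
  ⟨h.total.vf_isTangentCategory, h.base.vf_isTangentCategory⟩

end VecFieldData

end Fib

/-! ### A criterion for isomorphisms of categories -/

section IsoFunctor

variable {C : Type*} {C' : Type*} [Category* C] [Category* C'] (F : C ⥤ C')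

lemma map_eqToHom_comp_eqToHom {X X' Y Y' : C} (hX : X = X') (hY : Y = Y') (f : X' ⟶ Y') :
    F.map (eqToHom hX ≫ f ≫ eqToHom hY.symm) =
      eqToHom (congrArg F.obj hX) ≫ F.map f ≫ eqToHom (congrArg F.obj hY).symm := by
  subst hX hY
  simp

/-- A fully faithful functor that is bijective on objects is an isomorphism of categories. -/
lemma isIsoFunctor_of_bijective (hF : ∀ {X Y : C} (f : F.obj X ⟶ F.obj Y), ∃ g, F.map g = f)
    (hf : ∀ {X Y : C} {f g : X ⟶ Y}, F.map f = F.map g → f = g)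
    (inj : ∀ {X Y : C}, F.obj X = F.obj Y → X = Y) (surj : ∀ Z, ∃ X, F.obj X = Z) :
    IsIsoFunctor F := by
  choose o ho using surj
  -- A strict inverse must be defined on the given objects, which are only propositionally images of
  -- the chosen ones; hence the conjugation by `eqToHom`.
  choose m hm using fun {X Y : C'} (f : X ⟶ Y) =>
    hF (eqToHom (ho X) ≫ f ≫ eqToHom (ho Y).symm)
  let G : C' ⥤ C :=
    { obj := o
      map := m
      map_id X := hf (by rw [hm]; simp)
      map_comp f g := hf (by rw [F.map_comp, hm, hm, hm]; simp) }
  refine ⟨G, CategoryTheory.Functor.ext (fun X => inj (ho _)) fun X Y f => hf ?_,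
    CategoryTheory.Functor.ext ho fun X Y f => hm f⟩
  have e := map_eqToHom_comp_eqToHom F (inj (ho (F.obj X))) (inj (ho (F.obj Y))) f
  exact (hm _).trans e.symm

end IsoFunctor

/-! ### The forgetful `1`-morphism and its tautological field -/

namespace Fib

attribute [local simp] baseData totalData

section Universal

variable {P : Fib.{v, max u v}} {D : TangentData P} (h : IsTangentFibration D)
  (hD : D.IsTangentad) (hE : (vfData.{v, u} h).IsTangentad)

/-- The distributive law of the forgetful `1`-morphism, an identity. -/
noncomputable def vfLaw : (vfData.{v, u} h).T ≫ U.{v, u} D ⟶ U.{v, u} D ≫ D.T :=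
  𝟙 (U.{v, u} D ≫ D.T)

-- Like the similar lemmas below, this lets `simp` push `U` through the tangent structure of `VF(Π)`
-- without unfolding the vector fields.
@[simp] lemma U_obj_T_base (M : (VF.{v, u} D).base) :
    (Mor.base (U.{v, u} D)).obj ((Mor.base (vfData.{v, u} h).T).obj M) =
      (Mor.base D.T).obj ((Mor.base (U.{v, u} D)).obj M) := rfl

@[simp] lemma U_obj_Tn_base (n : ℕ) (M : (VF.{v, u} D).base) :
    (Mor.base (U.{v, u} D)).obj ((Mor.base ((vfData.{v, u} h).Tn n)).obj M) =
      (Mor.base (D.Tn n)).obj ((Mor.base (U.{v, u} D)).obj M) := rfl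

@[simp] lemma U_map_T_base {M N : (VF.{v, u} D).base} (f : M ⟶ N) :
    (Mor.base (U.{v, u} D)).map ((Mor.base (vfData.{v, u} h).T).map f) =
      (Mor.base D.T).map ((Mor.base (U.{v, u} D)).map f) := rfl

@[simp] lemma U_map_p_base (M : (VF.{v, u} D).base) :
    (Mor.base (U.{v, u} D)).map ((Cell.base (vfData.{v, u} h).p).app M) =
      (Cell.base D.p).app ((Mor.base (U.{v, u} D)).obj M) := rfl

@[simp] lemma U_map_proj_base (n : ℕ) (i : Fin n) (M : (VF.{v, u} D).base) :
    (Mor.base (U.{v, u} D)).map ((Cell.base ((vfData.{v, u} h).proj n i)).app M) =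
      (Cell.base (D.proj n i)).app ((Mor.base (U.{v, u} D)).obj M) := rfl

@[simp] lemma U_map_z_base (M : (VF.{v, u} D).base) :
    (Mor.base (U.{v, u} D)).map ((Cell.base (vfData.{v, u} h).z).app M) =
      (Cell.base D.z).app ((Mor.base (U.{v, u} D)).obj M) := rfl

@[simp] lemma U_map_s_base (M : (VF.{v, u} D).base) :
    (Mor.base (U.{v, u} D)).map ((Cell.base (vfData.{v, u} h).s).app M) =
      (Cell.base D.s).app ((Mor.base (U.{v, u} D)).obj M) := rfl

@[simp] lemma U_map_l_base (M : (VF.{v, u} D).base) :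
    (Mor.base (U.{v, u} D)).map ((Cell.base (vfData.{v, u} h).l).app M) =
      (Cell.base D.l).app ((Mor.base (U.{v, u} D)).obj M) := rfl

@[simp] lemma U_map_c_base (M : (VF.{v, u} D).base) :
    (Mor.base (U.{v, u} D)).map ((Cell.base (vfData.{v, u} h).c).app M) =
      (Cell.base D.c).app ((Mor.base (U.{v, u} D)).obj M) := rfl

@[simp] lemma univCell_T_base (M : (VF.{v, u} D).base) :
    (Cell.base (univCell.{v, u} D)).app ((Mor.base (vfData.{v, u} h).T).obj M) =
      (Mor.base D.T).map ((Cell.base (univCell.{v, u} D)).app M) ≫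
        (Cell.base D.c).app ((Mor.base (U.{v, u} D)).obj M) := rfl

@[simp] lemma vfLaw_base (M : (VF.{v, u} D).base) :
    (Cell.base (vfLaw.{v, u} h)).app M =
      𝟙 ((Mor.base D.T).obj ((Mor.base (U.{v, u} D)).obj M)) := rfl

lemma U_hom_ext_base {M N : (VF.{v, u} D).base} {f g : M ⟶ N}
    (hfg : (Mor.base (U.{v, u} D)).map f = (Mor.base (U.{v, u} D)).map g) : f = g :=
  VecField.hom_ext hfg

@[simp] lemma U_obj_T_total (M : (VF.{v, u} D).total) :
    (Mor.total (U.{v, u} D)).obj ((Mor.total (vfData.{v, u} h).T).obj M) =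
      (Mor.total D.T).obj ((Mor.total (U.{v, u} D)).obj M) := rfl

@[simp] lemma U_obj_Tn_total (n : ℕ) (M : (VF.{v, u} D).total) :
    (Mor.total (U.{v, u} D)).obj ((Mor.total ((vfData.{v, u} h).Tn n)).obj M) =
      (Mor.total (D.Tn n)).obj ((Mor.total (U.{v, u} D)).obj M) := rfl

@[simp] lemma U_map_T_total {M N : (VF.{v, u} D).total} (f : M ⟶ N) :
    (Mor.total (U.{v, u} D)).map ((Mor.total (vfData.{v, u} h).T).map f) =
      (Mor.total D.T).map ((Mor.total (U.{v, u} D)).map f) := rfl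

@[simp] lemma U_map_p_total (M : (VF.{v, u} D).total) :
    (Mor.total (U.{v, u} D)).map ((Cell.total (vfData.{v, u} h).p).app M) =
      (Cell.total D.p).app ((Mor.total (U.{v, u} D)).obj M) := rfl

@[simp] lemma U_map_proj_total (n : ℕ) (i : Fin n) (M : (VF.{v, u} D).total) :
    (Mor.total (U.{v, u} D)).map ((Cell.total ((vfData.{v, u} h).proj n i)).app M) =
      (Cell.total (D.proj n i)).app ((Mor.total (U.{v, u} D)).obj M) := rfl

@[simp] lemma U_map_z_total (M : (VF.{v, u} D).total) :
    (Mor.total (U.{v, u} D)).map ((Cell.total (vfData.{v, u} h).z).app M) =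
      (Cell.total D.z).app ((Mor.total (U.{v, u} D)).obj M) := rfl

@[simp] lemma U_map_s_total (M : (VF.{v, u} D).total) :
    (Mor.total (U.{v, u} D)).map ((Cell.total (vfData.{v, u} h).s).app M) =
      (Cell.total D.s).app ((Mor.total (U.{v, u} D)).obj M) := rfl

@[simp] lemma U_map_l_total (M : (VF.{v, u} D).total) :
    (Mor.total (U.{v, u} D)).map ((Cell.total (vfData.{v, u} h).l).app M) =
      (Cell.total D.l).app ((Mor.total (U.{v, u} D)).obj M) := rfl

@[simp] lemma U_map_c_total (M : (VF.{v, u} D).total) :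
    (Mor.total (U.{v, u} D)).map ((Cell.total (vfData.{v, u} h).c).app M) =
      (Cell.total D.c).app ((Mor.total (U.{v, u} D)).obj M) := rfl

@[simp] lemma univCell_T_total (M : (VF.{v, u} D).total) :
    (Cell.total (univCell.{v, u} D)).app ((Mor.total (vfData.{v, u} h).T).obj M) =
      (Mor.total D.T).map ((Cell.total (univCell.{v, u} D)).app M) ≫
        (Cell.total D.c).app ((Mor.total (U.{v, u} D)).obj M) := rfl

@[simp] lemma vfLaw_total (M : (VF.{v, u} D).total) :
    (Cell.total (vfLaw.{v, u} h)).app M =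
      𝟙 ((Mor.total D.T).obj ((Mor.total (U.{v, u} D)).obj M)) := rfl

lemma U_hom_ext_total {M N : (VF.{v, u} D).total} {f g : M ⟶ N}
    (hfg : (Mor.total (U.{v, u} D)).map f = (Mor.total (U.{v, u} D)).map g) : f = g :=
  VecField.hom_ext hfg

lemma vfLaw_isLax : IsLax (A := ⟨VF.{v, u} D, vfData h, hE⟩) (B := ⟨P, D, hD⟩)
    (U.{v, u} D) (vfLaw h) where
  p := hom_ext_app (fun M => by simp) fun M => by simp
  z := hom_ext_app (fun M => by simp) fun M => by simp
  s := ⟨𝟙 (U.{v, u} D ≫ D.Tn 2), (Category.id_comp _).trans (Category.comp_id _).symm,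
    (Category.id_comp _).trans (Category.comp_id _).symm,
    (Category.comp_id _).trans (Category.id_comp _).symm⟩
  l := hom_ext_app (fun M => by simp [doubleLaw]) fun M => by simp [doubleLaw]
  c := hom_ext_app (fun M => by simp [doubleLaw]) fun M => by simp [doubleLaw]

/-- The field of `T(M, v)` is `Tv` followed by the flip, and the law of `(T, c)` contributes a
second flip. The two flips cancel, leaving `Tv`. -/
lemma vfLaw_univCell : vfLaw.{v, u} h ≫ univCell.{v, u} D ▷ D.T =
    (vfData.{v, u} h).T ◁ univCell.{v, u} D ≫
      compLaw (A := ⟨VF.{v, u} D, vfData h, hE⟩) (B := ⟨P, D, hD⟩)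
        (D := ⟨P, D, hD⟩) (U.{v, u} D) (vfLaw h) D.T D.c := by
  have hb := h.base.c_c
  have ht := h.total.c_c
  dsimp only [baseData, totalData] at hb ht
  refine hom_ext_app (fun M => ?_) fun M => ?_
  · have := hb ((Mor.base (U.{v, u} D)).obj M)
    simp [compLaw, this]
  · have := ht ((Mor.total (U.{v, u} D)).obj M)
    simp [compLaw, this]

end Universal

end Fib

/-! ### The functor `Γ` is fully faithful and bijective on objects -/

namespace Fib

attribute [local simp] baseData totalData

section Gamma

variable {P : Fib.{v, max u v}} {D : TangentData P} (h : IsTangentFibration D)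
  (hD : D.IsTangentad) (hE : (vfData.{v, u} h).IsTangentad)

/-- The universal vector field of a tangent fibration. -/
noncomputable def vfUniversal :
    VecField (homTangent (⟨VF.{v, u} D, vfData h, hE⟩ : Tangentad Fib.{v, max u v}) ⟨P, D, hD⟩)
      (homProj ⟨VF.{v, u} D, vfData h, hE⟩ ⟨P, D, hD⟩) :=
  universalField.{v, u} hD (vfData h) hE (vfLaw h) (vfLaw_isLax h hD hE) (vfLaw_univCell h hD hE)

variable (Y : Tangentad Fib.{v, max u v})

lemma compLaw_vfLaw_base (F : Y.X ⟶ VF.{v, u} D)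
    (law : Y.data.T ≫ F ⟶ F ≫ (vfData.{v, u} h).T) (M : Y.X.base) :
    (Cell.base (compLaw (A := Y) (B := ⟨VF.{v, u} D, vfData h, hE⟩) (D := ⟨P, D, hD⟩) F law
      (U.{v, u} D) (vfLaw h))).app M = (Mor.base (U.{v, u} D)).map ((Cell.base law).app M) :=
  (Category.id_comp _).trans ((congrArg (fun x => _ ≫ x)
    ((Category.id_comp _).trans (Category.id_comp _))).trans (Category.comp_id _))

lemma compLaw_vfLaw_total (F : Y.X ⟶ VF.{v, u} D)
    (law : Y.data.T ≫ F ⟶ F ≫ (vfData.{v, u} h).T) (M : Y.X.total) :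
    (Cell.total (compLaw (A := Y) (B := ⟨VF.{v, u} D, vfData h, hE⟩) (D := ⟨P, D, hD⟩) F law
      (U.{v, u} D) (vfLaw h))).app M = (Mor.total (U.{v, u} D)).map ((Cell.total law).app M) :=
  (Category.id_comp _).trans ((congrArg (fun x => _ ≫ x)
    ((Category.id_comp _).trans (Category.id_comp _))).trans (Category.comp_id _))

lemma Gamma_map_injective {H H' : LaxMor Y ⟨VF.{v, u} D, vfData h, hE⟩} {f g : H ⟶ H'}
    (hfg : (Gamma (vfUniversal.{v, u} h hD hE) Y).map f =
      (Gamma (vfUniversal.{v, u} h hD hE) Y).map g) : f = g := by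
  have e : LaxMor.Hom.hom f ▷ U.{v, u} D = LaxMor.Hom.hom g ▷ U.{v, u} D :=
    congrArg (fun k => LaxMor.Hom.hom (VecField.Hom.hom k)) hfg
  exact LaxMor.hom_ext (hom_ext_app (fun M => U_hom_ext_base (base_app_congr e M))
    fun M => U_hom_ext_total (total_app_congr e M))

/-- Commutation of `k` with the two fields says exactly that each component of its underlying
`2`-morphism `κ` is a morphism of vector fields, so `κ` lifts to `VF(Π)`. -/
lemma Gamma_map_surjective {H H' : LaxMor Y ⟨VF.{v, u} D, vfData h, hE⟩}
    (k : (Gamma (vfUniversal.{v, u} h hD hE) Y).obj H ⟶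
      (Gamma (vfUniversal.{v, u} h hD hE) Y).obj H') :
    ∃ f, (Gamma (vfUniversal.{v, u} h hD hE) Y).map f = k := by
  let κ : H.F ≫ U.{v, u} D ⟶ H'.F ≫ U.{v, u} D := LaxMor.Hom.hom (VecField.Hom.hom k)
  have e : (H.F ◁ univCell.{v, u} D ≫ (α_ H.F (U.{v, u} D) D.T).inv) ≫ κ ▷ D.T =
      κ ≫ H'.F ◁ univCell.{v, u} D ≫ (α_ H'.F (U.{v, u} D) D.T).inv :=
    congrArg LaxMor.Hom.hom (VecField.Hom.comm k)
  have eb : ∀ M, (Cell.base (univCell.{v, u} D)).app ((Mor.base H.F).obj M) ≫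
      (Mor.base D.T).map ((Cell.base κ).app M) = (Cell.base κ).app M ≫
      (Cell.base (univCell.{v, u} D)).app ((Mor.base H'.F).obj M) := fun M => by
    simpa using base_app_congr e M
  have et : ∀ M, (Cell.total (univCell.{v, u} D)).app ((Mor.total H.F).obj M) ≫
      (Mor.total D.T).map ((Cell.total κ).app M) = (Cell.total κ).app M ≫
      (Cell.total (univCell.{v, u} D)).app ((Mor.total H'.F).obj M) := fun M => by
    simpa using total_app_congr e M
  let f : H.F ⟶ H'.F := vfCellMk.{v, u} (T := D.T) (p := D.p) (F := H.F) (G := H'.F)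
    { app M := ⟨(Cell.base κ).app M, eb M⟩
      naturality M N x := VecField.hom_ext ((Cell.base κ).naturality x) }
    { app M := ⟨(Cell.total κ).app M, et M⟩
      naturality M N x := VecField.hom_ext ((Cell.total κ).naturality x) }
    fun X => Cell.comm κ X
  have fb : ∀ M, (Mor.base (U.{v, u} D)).map ((Cell.base f).app M) = (Cell.base κ).app M :=
    fun _ => rfl
  have ft : ∀ M, (Mor.total (U.{v, u} D)).map ((Cell.total f).app M) = (Cell.total κ).app M :=
    fun _ => rfl
  have hf : f ▷ U.{v, u} D = κ := hom_ext_app fb ft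
  have hκ : compLaw (A := Y) (B := ⟨VF.{v, u} D, vfData h, hE⟩) (D := ⟨P, D, hD⟩) H.F H.law
      (U.{v, u} D) (vfLaw h) ≫ κ ▷ D.T = Y.data.T ◁ κ ≫
      compLaw (A := Y) (B := ⟨VF.{v, u} D, vfData h, hE⟩) (D := ⟨P, D, hD⟩) H'.F H'.law
        (U.{v, u} D) (vfLaw h) := LaxMor.Hom.comm (VecField.Hom.hom k)
  -- From here on only the images of the components of `f` under `U` matter: compatibility with the
  -- laws is tested after the faithful `U`, where it becomes that of `κ`.
  clear_value f
  refine ⟨⟨f, hom_ext_app (fun M => U_hom_ext_base ?_) fun M => U_hom_ext_total ?_⟩,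
    VecField.hom_ext (LaxMor.hom_ext hf)⟩
  · have e := base_app_congr hκ M
    rw [cell_comp_base, cell_comp_base, compLaw_vfLaw_base, cell_whiskerLeft_base, compLaw_vfLaw_base] at e
    simpa [fb] using e
  · have e := total_app_congr hκ M
    rw [cell_comp_total, cell_comp_total, compLaw_vfLaw_total, cell_whiskerLeft_total, compLaw_vfLaw_total] at e
    simpa [ft] using e

variable {Y} in
/-- The `1`-morphism into `VF(Π)` given by a `1`-morphism `F` into `Π` and a section of the
projection `T ∘ F ⟶ F`. -/
noncomputable def vfLift {Q : Fib.{v, max u v}} (F : Q ⟶ P) (w : F ⟶ F ≫ D.T)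
    (hw : w ≫ F ◁ D.p ≫ (ρ_ F).hom = 𝟙 F) : Q ⟶ VF.{v, u} D :=
  vfMor.{v, u} (T := D.T) (p := D.p) F
    { obj M := ⟨(Mor.base F).obj M, (Cell.base w).app M, by
        simpa using base_app_congr hw M⟩
      map f := ⟨(Mor.base F).map f, ((Cell.base w).naturality f).symm⟩
      map_id M := VecField.hom_ext ((Mor.base F).map_id M)
      map_comp f g := VecField.hom_ext ((Mor.base F).map_comp f g) }
    { obj M := ⟨(Mor.total F).obj M, (Cell.total w).app M, by
        simpa using total_app_congr hw M⟩
      map f := ⟨(Mor.total F).map f, ((Cell.total w).naturality f).symm⟩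
      map_id M := VecField.hom_ext ((Mor.total F).map_id M)
      map_comp f g := VecField.hom_ext ((Mor.total F).map_comp f g) }
    rfl rfl fun X => Cell.comm w X

/-- A `1`-morphism into `VF(Π)` is recovered from its underlying `1`-morphism and field. Keeping `w`
a variable lets the associator be removed by substitution, after which the equality is definitional.
-/
lemma vfLift_univCell {Q : Fib.{v, max u v}} (H : Q ⟶ VF.{v, u} D)
    (w : H ≫ U.{v, u} D ⟶ (H ≫ U.{v, u} D) ≫ D.T)
    (hw : w ≫ (H ≫ U.{v, u} D) ◁ D.p ≫ (ρ_ _).hom = 𝟙 (H ≫ U.{v, u} D))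
    (hH : w = H ◁ univCell.{v, u} D ≫ (α_ H (U.{v, u} D) D.T).inv) :
    vfLift (H ≫ U.{v, u} D) w hw = H := by
  obtain rfl : w = H ◁ univCell.{v, u} D := hH.trans (Category.comp_id _)
  rfl

/-- The `1`-morphism into `VF(Π)` given by a vector field in a Hom-tangent category. -/
noncomputable def vfLiftOf (X : VecField (homTangent Y ⟨P, D, hD⟩) (homProj Y ⟨P, D, hD⟩)) :
    Y.X ⟶ VF.{v, u} D :=
  vfLift X.obj.F (LaxMor.Hom.hom X.field) (congrArg LaxMor.Hom.hom X.field_p)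

lemma vfLiftOf_Gamma (H : LaxMor Y ⟨VF.{v, u} D, vfData h, hE⟩) :
    vfLiftOf hD Y ((Gamma (vfUniversal.{v, u} h hD hE) Y).obj H) = H.F :=
  vfLift_univCell H.F _ _ rfl

lemma Gamma_obj_injective {H H' : LaxMor Y ⟨VF.{v, u} D, vfData h, hE⟩}
    (e : (Gamma (vfUniversal.{v, u} h hD hE) Y).obj H =
      (Gamma (vfUniversal.{v, u} h hD hE) Y).obj H') : H = H' := by
  have hF : H.F = H'.F := by rw [← vfLiftOf_Gamma h hD hE, e, vfLiftOf_Gamma]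
  obtain ⟨F, law, hl⟩ := H
  obtain ⟨F', law', hl'⟩ := H'
  obtain rfl : F = F' := hF
  -- The type of a law depends on the underlying `1`-morphism, so the law is compared only after `F`
  -- and `F'` have been identified, when heterogeneous equality becomes equality. The law of `U`
  -- being an identity, the composite laws show the images of `law` and `law'` under `U`.
  have e₂ : compLaw (A := Y) (B := ⟨VF.{v, u} D, vfData h, hE⟩) (D := ⟨P, D, hD⟩) F law
      (U.{v, u} D) (vfLaw h) =
      compLaw (A := Y) (B := ⟨VF.{v, u} D, vfData h, hE⟩) (D := ⟨P, D, hD⟩) F law'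
        (U.{v, u} D) (vfLaw h) :=
    eq_of_heq (LaxMor.mk.inj (congrArg VecField.obj e)).2
  obtain rfl : law = law' := by
    refine hom_ext_app (fun M => U_hom_ext_base ?_) fun M => U_hom_ext_total ?_
    · have e := base_app_congr e₂ M
      rwa [compLaw_vfLaw_base, compLaw_vfLaw_base] at e
    · have e := total_app_congr e₂ M
      rwa [compLaw_vfLaw_total, compLaw_vfLaw_total] at e
  rfl

/-- Since `U` is faithful and strictly preserves the tangent structure, the axioms for `b` follow
from their images under `U`, which are those for `a`. Only compatibility with `s` also asks for an
auxiliary morphism, which must be constructed in `VF(Π)`. -/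
lemma isLax_of_comp_U {H : Y.X ⟶ VF.{v, u} D} {b : Y.data.T ≫ H ⟶ H ≫ (vfData.{v, u} h).T}
    {a : Y.data.T ≫ H ≫ U.{v, u} D ⟶ (H ≫ U.{v, u} D) ≫ D.T}
    (hb : ∀ M, (Mor.base (U.{v, u} D)).map ((Cell.base b).app M) = (Cell.base a).app M)
    (ht : ∀ M, (Mor.total (U.{v, u} D)).map ((Cell.total b).app M) = (Cell.total a).app M)
    (hX : IsLax (A := Y) (B := ⟨P, D, hD⟩) (H ≫ U.{v, u} D) a) :
    IsLax (A := Y) (B := ⟨VF.{v, u} D, vfData h, hE⟩) H b := by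
  have hp : b ≫ H ◁ (vfData.{v, u} h).p ≫ (ρ_ H).hom = Y.data.p ▷ H ≫ (λ_ H).hom := hom_ext_app
    (fun M => U_hom_ext_base (by simpa [hb] using base_app_congr hX.p M))
    fun M => U_hom_ext_total (by simpa [ht] using total_app_congr hX.p M)
  refine { p := hp, z := ?_, s := ?_, l := ?_, c := ?_ }
  · exact hom_ext_app
      (fun M => U_hom_ext_base (by simpa [hb] using base_app_congr hX.z M))
      fun M => U_hom_ext_total (by simpa [ht] using total_app_congr hX.z M)
  · obtain ⟨g, g₁, g₂, g₃⟩ := hX.s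
    have e : Y.data.pr₁ ≫ Y.data.p = Y.data.pr₂ ≫ Y.data.p := by
      have := isTangentad_iff.1 Y.isTangentad
      exact hom_ext_app (fun M => ((this.base.power 2 M).comp_eq 0).trans
        ((this.base.power 2 M).comp_eq 1).symm) fun M => ((this.total.power 2 M).comp_eq 0).trans
        ((this.total.power 2 M).comp_eq 1).symm
    have hq : IsFiberPower (H ◁ (vfData.{v, u} h).p) (H ◁ (vfData.{v, u} h).leg 2)
        fun i => H ◁ (vfData.{v, u} h).proj 2 i := hE.isFiberPower 2 H 0
    -- The induced law on `T₂` comes from the pointwise fibre square in `VF(Π)`; compatibility of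
    -- its components is where `hp` is needed.
    obtain ⟨k, k₁, k₂⟩ := hq.exists_lift_two (Y.data.pr₁ ▷ H ≫ b) (Y.data.pr₂ ▷ H ≫ b) (by
      rw [← cancel_mono (ρ_ H).hom]
      simp only [Category.assoc, hp]
      rw [← comp_whiskerRight_assoc, e, comp_whiskerRight_assoc])
    refine ⟨k, k₁, k₂, hom_ext_app (fun M => U_hom_ext_base ?_) fun M => U_hom_ext_total ?_⟩
    · have e₁ := congrArg (Mor.base (U.{v, u} D)).map (base_app_congr k₁ M)
      have e₂ := congrArg (Mor.base (U.{v, u} D)).map (base_app_congr k₂ M)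
      have f₁ := base_app_congr g₁ M
      have f₂ := base_app_congr g₂ M
      have f₃ := base_app_congr g₃ M
      simp [hb] at e₁ e₂ f₁ f₂ f₃
      -- The image of `k` under `U` has the same projections as the law `g` given downstairs, hence
      -- equals it.
      have hk : (Mor.base (U.{v, u} D)).map ((Cell.base k).app M) = (Cell.base g).app M :=
        (h.base.power 2 _).hom_ext_two (e₁.trans f₁.symm) (e₂.trans f₂.symm)
      simpa [hb, hk] using f₃
    · have e₁ := congrArg (Mor.total (U.{v, u} D)).map (total_app_congr k₁ M)
      have e₂ := congrArg (Mor.total (U.{v, u} D)).map (total_app_congr k₂ M)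
      have f₁ := total_app_congr g₁ M
      have f₂ := total_app_congr g₂ M
      have f₃ := total_app_congr g₃ M
      simp [ht] at e₁ e₂ f₁ f₂ f₃
      have hk : (Mor.total (U.{v, u} D)).map ((Cell.total k).app M) = (Cell.total g).app M :=
        (h.total.power 2 _).hom_ext_two (e₁.trans f₁.symm) (e₂.trans f₂.symm)
      simpa [ht, hk] using f₃
  · exact hom_ext_app
      (fun M => U_hom_ext_base (by simpa [doubleLaw, hb] using base_app_congr hX.l M))
      fun M => U_hom_ext_total (by simpa [doubleLaw, ht] using total_app_congr hX.l M)
  · exact hom_ext_app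
      (fun M => U_hom_ext_base (by simpa [doubleLaw, hb] using base_app_congr hX.c M))
      fun M => U_hom_ext_total (by simpa [doubleLaw, ht] using total_app_congr hX.c M)

lemma homTangent_vecField_ext {A B : Tangentad Fib.{v, max u v}}
    {X X' : VecField (homTangent A B) (homProj A B)} (hF : X.obj.F = X'.obj.F)
    (hl : HEq X.obj.law X'.obj.law)
    (hw : HEq (LaxMor.Hom.hom X.field) (LaxMor.Hom.hom X'.field)) : X = X' := by
  obtain ⟨⟨F, l, _⟩, ⟨w, _⟩, _⟩ := X
  obtain ⟨⟨F', l', _⟩, ⟨w', _⟩, _⟩ := X'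
  obtain rfl : F = F' := hF
  obtain rfl : l = l' := eq_of_heq hl
  obtain rfl : w = w' := eq_of_heq hw
  rfl

lemma Gamma_obj_surjective (X : VecField (homTangent Y ⟨P, D, hD⟩) (homProj Y ⟨P, D, hD⟩)) :
    ∃ H, (Gamma (vfUniversal.{v, u} h hD hE) Y).obj H = X := by
  let H : Y.X ⟶ VF.{v, u} D := vfLiftOf hD Y X
  let w : X.obj.F ⟶ X.obj.F ≫ D.T := LaxMor.Hom.hom X.field
  let a : Y.data.T ≫ X.obj.F ⟶ X.obj.F ≫ D.T := X.obj.law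
  have hw : a ≫ w ▷ D.T = Y.data.T ◁ w ≫ compLaw (A := Y) (B := ⟨P, D, hD⟩) (D := ⟨P, D, hD⟩)
    X.obj.F a D.T D.c := LaxMor.Hom.comm X.field
  have ccb := h.base.c_c
  have cct := h.total.c_c
  dsimp only [baseData, totalData] at ccb cct
  -- This is the condition for the component of `a` to be a morphism of vector fields: the source
  -- carries the field `w` at `TM`, the target the field `Tw` followed by the flip. It is `hw` with
  -- the flip moved to the other side by involutivity.
  have hb : ∀ M, (Cell.base w).app ((Mor.base Y.data.T).obj M) ≫
      (Mor.base D.T).map ((Cell.base a).app M) = (Cell.base a).app M ≫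
      (Mor.base D.T).map ((Cell.base w).app M) ≫ (Cell.base D.c).app _ := fun M => by
    have e := base_app_congr hw M
    have := ccb ((Mor.base X.obj.F).obj M)
    simp [compLaw] at e
    rw [reassoc_of% e, this]
    exact congrArg _ (Category.comp_id _).symm
  have ht : ∀ M, (Cell.total w).app ((Mor.total Y.data.T).obj M) ≫
      (Mor.total D.T).map ((Cell.total a).app M) = (Cell.total a).app M ≫
      (Mor.total D.T).map ((Cell.total w).app M) ≫ (Cell.total D.c).app _ := fun M => by
    have e := total_app_congr hw M
    have := cct ((Mor.total X.obj.F).obj M)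
    simp [compLaw] at e
    rw [reassoc_of% e, this]
    exact congrArg _ (Category.comp_id _).symm
  let b : Y.data.T ≫ H ⟶ H ≫ (vfData.{v, u} h).T := vfCellMk.{v, u} (T := D.T) (p := D.p)
    (F := Y.data.T ≫ H) (G := H ≫ (vfData.{v, u} h).T)
    { app M := ⟨(Cell.base a).app M, hb M⟩
      naturality M N x := VecField.hom_ext ((Cell.base a).naturality x) }
    { app M := ⟨(Cell.total a).app M, ht M⟩
      naturality M N x := VecField.hom_ext ((Cell.total a).naturality x) }
    fun X => Cell.comm a X
  have bb : ∀ M, (Mor.base (U.{v, u} D)).map ((Cell.base b).app M) = (Cell.base a).app M :=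
    fun _ => rfl
  have bt : ∀ M, (Mor.total (U.{v, u} D)).map ((Cell.total b).app M) = (Cell.total a).app M :=
    fun _ => rfl
  have hl : IsLax (A := Y) (B := ⟨VF.{v, u} D, vfData h, hE⟩) H b := by
    exact isLax_of_comp_U h hD hE Y bb bt X.obj.isLax
  have hc : compLaw (A := Y) (B := ⟨VF.{v, u} D, vfData h, hE⟩) (D := ⟨P, D, hD⟩) H b
      (U.{v, u} D) (vfLaw h) = a :=
    hom_ext_app (compLaw_vfLaw_base h hD hE Y H b) (compLaw_vfLaw_total h hD hE Y H b)
  have hw' : H ◁ univCell.{v, u} D ≫ (α_ H (U.{v, u} D) D.T).inv = w := Category.comp_id _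
  exact ⟨⟨H, b, hl⟩, homTangent_vecField_ext rfl (heq_of_eq hc) (heq_of_eq hw')⟩

end Gamma

end Fib

/-! ### Existence of vector fields in `Fib`, and preservation of Cartesian arrows -/

namespace Fib

section VecFieldConstruction

variable {P : Fib.{v, max u v}} {D : TangentData P} (h : IsTangentFibration D)
  (hD : D.IsTangentad) (hE : (vfData.{v, u} h).IsTangentad)

lemma isUniversalVectorField_vfUniversal :
    IsUniversalVectorField (vfUniversal.{v, u} h hD hE) :=
  ⟨⟨rfl, rfl⟩, fun Y => isIsoFunctor_of_bijective _ (Gamma_map_surjective h hD hE Y)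
    (Gamma_map_injective h hD hE Y) (Gamma_obj_injective h hD hE Y)
    (Gamma_obj_surjective h hD hE Y)⟩

lemma isTangentadOfVectorFields_vfData :
    IsTangentadOfVectorFields.{v, u} hD (vfData h) hE :=
  ⟨vfLaw h, vfLaw_isLax h hD hE, vfLaw_univCell h hD hE,
    isUniversalVectorField_vfUniversal h hD hE⟩

/-- `Fib` admits the construction of vector fields. -/
theorem admitsVectorFields : AdmitsVectorFields Fib.{v, max u v} := by
  rintro ⟨P, D, hD⟩
  have h := isTangentad_iff.1 hD
  exact ⟨_, _, isUniversalVectorField_vfUniversal.{v, u} h hD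
    (isTangentFibration_vfData.{v, u} h).isTangentad⟩

end VecFieldConstruction

section Cartesian

variable {E : Type*} {B : Type*} {E' : Type*} {B' : Type*} [Category* E] [Category* B]
  [Category* E'] [Category* B'] {S : E ⥤ B} {S' : E' ⥤ B'}

/-- A functor over another one preserves Cartesian lifts as soon as it preserves some Cartesian
lift of each morphism. -/
lemma preserves_cartesian_of_exists (F : B ⥤ B') (G : E ⥤ E')
    (hFG : ∀ {M N : B} {X Y : E} (f : M ⟶ N) (φ : X ⟶ Y), S.IsHomLift f φ →
      S'.IsHomLift (F.map f) (G.map φ))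
    (hc : ∀ {M : B} {Y : E} (f : M ⟶ S.obj Y), ∃ (X : E) (φ : X ⟶ Y), S.IsStronglyCartesian f φ ∧
      S'.IsStronglyCartesian (F.map f) (G.map φ))
    {M N : B} {X Y : E} (f : M ⟶ N) (φ : X ⟶ Y) (hφ : S.IsStronglyCartesian f φ) :
    S'.IsStronglyCartesian (F.map f) (G.map φ) := by
  obtain rfl := IsHomLift.codomain_eq S f φ
  obtain ⟨Z, ψ, hψ, hψ'⟩ := hc f
  -- Any two Cartesian lifts of `f` differ by an isomorphism over the identity. Its image is again
  -- an isomorphism over an identity, hence Cartesian, and Cartesian arrows compose.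
  let e := Functor.IsStronglyCartesian.domainIsoOfBaseIso S (f := f) (f' := f)
    (g := Iso.refl M) (Category.id_comp f).symm ψ φ
  have he : S.IsHomLift (𝟙 M) e.hom :=
    Functor.IsStronglyCartesian.domainUniqueUpToIso_inv_isHomLift S (g := Iso.refl M)
      (Category.id_comp f).symm ψ φ
  have hc : e.hom ≫ ψ = φ := Functor.IsStronglyCartesian.fac S (g := (Iso.refl M).hom) f ψ
    (Category.id_comp f).symm φ
  have he' : S'.IsHomLift (𝟙 (F.obj M)) (G.map e.hom) := by
    rw [← F.map_id]
    exact hFG _ _ he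
  have h₂ : S'.IsStronglyCartesian (𝟙 (F.obj M)) (G.map e.hom) :=
    Functor.IsStronglyCartesian.of_isIso _ _ _
  have h₃ : S'.IsStronglyCartesian (𝟙 (F.obj M) ≫ F.map f) (G.map e.hom ≫ G.map ψ) :=
    Functor.IsStronglyCartesian.comp S' (f := 𝟙 (F.obj M)) (g := F.map f)
  rwa [Category.id_comp, ← G.map_comp, hc] at h₃

end Cartesian

/-! ### Products in `Fib` -/

section Products

variable {J : Type v} (A : J → Fib.{v, max u v})

/-- The product of the projections. -/
def piProj : (∀ j, (A j).total) ⥤ (∀ j, (A j).base) where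
  obj X j := (A j).proj.obj (X j)
  map f j := (A j).proj.map (f j)

variable {A}

lemma piProj_isHomLift {M N : ∀ j, (A j).base} {X Y : ∀ j, (A j).total} (f : M ⟶ N) (φ : X ⟶ Y)
    (h : ∀ j, (A j).proj.IsHomLift (f j) (φ j)) : (piProj A).IsHomLift f φ := by
  refine isHomLift_of_unique _ _ _ (funext fun j => IsHomLift.domain_eq (A j).proj (f j) (φ j))
    (funext fun j => IsHomLift.codomain_eq (A j).proj (f j) (φ j)) fun f' hf' => ?_
  cases hf'
  exact funext fun j => isHomLift_unique _ _ (h j) (.map _)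

lemma isHomLift_of_piProj {M N : ∀ j, (A j).base} {X Y : ∀ j, (A j).total} (f : M ⟶ N)
    (φ : X ⟶ Y) (h : (piProj A).IsHomLift f φ) (j : J) : (A j).proj.IsHomLift (f j) (φ j) := by
  cases h
  exact .map _

lemma piProj_isStronglyCartesian {M N : ∀ j, (A j).base} {X Y : ∀ j, (A j).total} (f : M ⟶ N)
    (φ : X ⟶ Y) (h : ∀ j, (A j).proj.IsStronglyCartesian (f j) (φ j)) :
    (piProj A).IsStronglyCartesian f φ where
  toIsHomLift := piProj_isHomLift f φ fun j => (h j).toIsHomLift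
  universal_property' {Z} g ψ hψ := by
    have hψ := isHomLift_of_piProj _ _ hψ
    choose χ hχ hu using fun j => Functor.IsStronglyCartesian.universal_property (A j).proj
      (f j) (φ j) (g j) _ rfl (ψ j)
    exact ⟨χ, ⟨piProj_isHomLift _ _ fun j => (hχ j).1, funext fun j => (hχ j).2⟩,
      fun χ' hχ' => funext fun j => hu j _ ⟨isHomLift_of_piProj _ _ hχ'.1 j, congrFun hχ'.2 j⟩⟩

variable (A)

/-- The product of a family of fibrations. -/
def pi : Fib.{v, max u v} where
  total := ∀ j, (A j).total
  base := ∀ j, (A j).base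
  proj := piProj A
  cleavage :=
    { obj f j := (A j).cleavage.obj (f j)
      lift f j := (A j).cleavage.lift (f j)
      cartesian f := piProj_isStronglyCartesian _ _ fun j => (A j).cleavage.cartesian (f j) }

/-- The projections of the product. -/
def piFst (j : J) : pi.{v, u} A ⟶ A j :=
  Mor.mk (P := pi.{v, u} A) (Q := A j) (Pi.eval _ j) (Pi.eval _ j) rfl
    (preserves_cartesian_of_exists _ _ (fun f φ h => isHomLift_of_piProj f φ h j)
      fun f => ⟨_, _, (pi.{v, u} A).cleavage.cartesian f, (A j).cleavage.cartesian _⟩)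

variable {A}

/-- The `1`-morphism into a product with given components. -/
def piLift {Y : Fib.{v, max u v}} (F : ∀ j, Y ⟶ A j) : Y ⟶ pi.{v, u} A :=
  Mor.mk (P := Y) (Q := pi.{v, u} A) (Functor.pi' fun j => Mor.base (F j))
    (Functor.pi' fun j => Mor.total (F j))
    (Functor.pi_ext _ _ fun j => Mor.comm (F j))
    fun f φ h => piProj_isStronglyCartesian _ _ fun j => Mor.cartesian (F j) f φ h

/-- The `2`-morphism into a product with given components. -/
def piLiftHom {Y : Fib.{v, max u v}} {F G : ∀ j, Y ⟶ A j} (f : ∀ j, F j ⟶ G j) :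
    piLift F ⟶ piLift G :=
  Cell.mk (F := piLift F) (G := piLift G)
    { app M j := (Cell.base (f j)).app M
      naturality _ _ x := funext fun j => (Cell.base (f j)).naturality x }
    { app M j := (Cell.total (f j)).app M
      naturality _ _ x := funext fun j => (Cell.total (f j)).naturality x }
    fun X => piProj_isHomLift _ _ fun j => Cell.comm (f j) X

variable (A)

lemma isIsoFunctor_prodComparison (Y : Fib.{v, max u v}) :
    IsIsoFunctor (prodComparison (piFst.{v, u} A) Y) :=
  ⟨{ obj := piLift
     map := piLiftHom
     map_id _ := rfl
     map_comp _ _ := rfl }, rfl, rfl⟩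

end Products

end Fib

/-! ### Equifiers in `Fib` -/

section FullSubcategory

variable {A : Type*} {C : Type*} [Category* A] [Category* C] {P : ObjectProperty C}

/-- A functor into a full subcategory is definitionally the lift of its composite with the
inclusion, so equal composites can be substituted. -/
lemma functor_fullSubcategory_ext {K K' : A ⥤ P.FullSubcategory} (h : K ⋙ P.ι = K' ⋙ P.ι) :
    K = K' := by
  have key : ∀ (F F' : A ⥤ C) (hF : ∀ X, P (F.obj X)) (hF' : ∀ X, P (F'.obj X)), F = F' →
      P.lift F hF = P.lift F' hF' := by
    rintro F _ _ _ rfl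
    rfl
  exact key (K ⋙ P.ι) (K' ⋙ P.ι) (fun X => (K.obj X).property) (fun X => (K'.obj X).property) h

end FullSubcategory

namespace Fib

lemma cell_comm_of_eq {P Q : Fib.{v, u}} {F G : P ⟶ Q} (φ : F ⟶ G) {M : P.base} {X : P.total}
    (h : P.proj.obj X = M) : Q.proj.IsHomLift ((Cell.base φ).app M) ((Cell.total φ).app X) := by
  subst h
  exact Cell.comm φ X

section Equifiers

variable {X X' : Fib.{v, u}} {F G : X ⟶ X'} (φ ψ : F ⟶ G)

/-- The objects of the base category at which two `2`-morphisms agree. -/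
def eqBase : ObjectProperty X.base := fun M => (Cell.base φ).app M = (Cell.base ψ).app M

/-- The objects of the total category at which two `2`-morphisms agree. -/
def eqTotal : ObjectProperty X.total := fun E => (Cell.total φ).app E = (Cell.total ψ).app E

variable {φ ψ} in
-- One total component lies over both base components, so these coincide.
lemma eqBase_of_eqTotal {E : X.total} (h : eqTotal φ ψ E) : eqBase φ ψ (X.proj.obj E) :=
  isHomLift_unique X'.proj _ (Cell.comm φ E) (by
    have := Cell.comm ψ E
    rwa [← show (Cell.total φ).app E = (Cell.total ψ).app E from h] at this)

/-- The projection of the equifier. -/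
def eqProj : (eqTotal φ ψ).FullSubcategory ⥤ (eqBase φ ψ).FullSubcategory :=
  (eqBase φ ψ).lift ((eqTotal φ ψ).ι ⋙ X.proj) fun E => eqBase_of_eqTotal E.property

variable {φ ψ}

lemma isHomLift_of_eqProj {M N : (eqBase φ ψ).FullSubcategory}
    {E E' : (eqTotal φ ψ).FullSubcategory} {f : M ⟶ N} {χ : E ⟶ E'}
    (h : (eqProj φ ψ).IsHomLift f χ) : X.proj.IsHomLift f.hom χ.hom := by
  cases h
  exact .map _

lemma eqProj_isHomLift {M N : (eqBase φ ψ).FullSubcategory}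
    {E E' : (eqTotal φ ψ).FullSubcategory} {f : M ⟶ N} {χ : E ⟶ E'}
    (h : X.proj.IsHomLift f.hom χ.hom) : (eqProj φ ψ).IsHomLift f χ := by
  refine isHomLift_of_unique _ _ _
    (ObjectProperty.FullSubcategory.ext (IsHomLift.domain_eq X.proj f.hom χ.hom))
    (ObjectProperty.FullSubcategory.ext (IsHomLift.codomain_eq X.proj f.hom χ.hom)) fun f' hf' =>
    ObjectProperty.hom_ext _ (isHomLift_unique X.proj _ h (isHomLift_of_eqProj hf'))

lemma eqProj_isStronglyCartesian {M N : (eqBase φ ψ).FullSubcategory}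
    {E E' : (eqTotal φ ψ).FullSubcategory} {f : M ⟶ N} {χ : E ⟶ E'}
    (h : X.proj.IsStronglyCartesian f.hom χ.hom) : (eqProj φ ψ).IsStronglyCartesian f χ where
  toIsHomLift := eqProj_isHomLift h.toIsHomLift
  universal_property' {Z} g η hη := by
    have hη : X.proj.IsHomLift (g.hom ≫ f.hom) η.hom := isHomLift_of_eqProj hη
    obtain ⟨κ, ⟨hκ, hκ'⟩, hu⟩ := Functor.IsStronglyCartesian.universal_property X.proj
      f.hom χ.hom g.hom _ rfl η.hom
    exact ⟨ObjectProperty.homMk κ, ⟨eqProj_isHomLift hκ, ObjectProperty.hom_ext _ hκ'⟩,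
      fun κ' h' => ObjectProperty.hom_ext _
        (hu _ ⟨isHomLift_of_eqProj h'.1, congrArg InducedCategory.Hom.hom h'.2⟩)⟩

/-- At `E` the two components lie over the same base morphism. By naturality they also agree after
composition with the image of `χ` under `G`, which is Cartesian. -/
lemma eqTotal_of_isStronglyCartesian {M : X.base} (hM : eqBase φ ψ M) {E E' : X.total}
    (hE' : eqTotal φ ψ E') (f : M ⟶ X.proj.obj E') (χ : E ⟶ E')
    (hχ : X.proj.IsStronglyCartesian f χ) : eqTotal φ ψ E := by
  have hE := IsHomLift.domain_eq X.proj f χ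
  have hG := Mor.cartesian G f χ hχ
  have h₁ := cell_comm_of_eq φ hE
  have h₂ := cell_comm_of_eq ψ hE
  rw [← show (Cell.base φ).app M = (Cell.base ψ).app M from hM] at h₂
  refine Functor.IsStronglyCartesian.ext X'.proj ((Mor.base G).map f) ((Mor.total G).map χ)
    ((Cell.base φ).app M) ?_
  rw [← (Cell.total φ).naturality, ← (Cell.total ψ).naturality,
    show (Cell.total φ).app E' = (Cell.total ψ).app E' from hE']

/-- The Cartesian property is recorded both in the equifier and in `X`: the first gives the
cleavage, the second that the inclusion preserves Cartesian arrows. -/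
lemma exists_eqProj_isStronglyCartesian {M : (eqBase φ ψ).FullSubcategory}
    {E : (eqTotal φ ψ).FullSubcategory} (f : M ⟶ (eqProj φ ψ).obj E) :
    ∃ (E₀ : (eqTotal φ ψ).FullSubcategory) (χ : E₀ ⟶ E), (eqProj φ ψ).IsStronglyCartesian f χ ∧
      X.proj.IsStronglyCartesian f.hom χ.hom :=
  have h := X.cleavage.cartesian (X := E.obj) f.hom
  ⟨⟨_, eqTotal_of_isStronglyCartesian M.property E.property f.hom _ h⟩, ObjectProperty.homMk _,
    eqProj_isStronglyCartesian h, h⟩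

variable (φ ψ)

/-- The equifier of two `2`-morphisms. -/
noncomputable def equifier : Fib.{v, u} where
  total := (eqTotal φ ψ).FullSubcategory
  base := (eqBase φ ψ).FullSubcategory
  proj := eqProj φ ψ
  cleavage :=
    { obj f := (exists_eqProj_isStronglyCartesian f).choose
      lift f := (exists_eqProj_isStronglyCartesian f).choose_spec.choose
      cartesian f := (exists_eqProj_isStronglyCartesian f).choose_spec.choose_spec.1 }

/-- The inclusion of the equifier. -/
noncomputable def equifierInclusion : equifier φ ψ ⟶ X :=
  Mor.mk (P := equifier φ ψ) (Q := X) (eqBase φ ψ).ι (eqTotal φ ψ).ι rfl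
    (preserves_cartesian_of_exists _ _ (fun _ _ h => isHomLift_of_eqProj h)
      exists_eqProj_isStronglyCartesian)

lemma equifies_equifierInclusion : equifies φ ψ _ (equifierInclusion φ ψ) :=
  hom_ext_app
    (fun (M : (eqBase φ ψ).FullSubcategory) =>
      show (Cell.base φ).app M.obj = (Cell.base ψ).app M.obj from M.property)
    fun (E : (eqTotal φ ψ).FullSubcategory) =>
      show (Cell.total φ).app E.obj = (Cell.total ψ).app E.obj from E.property

variable {φ ψ} {Y : Fib.{v, u}}

/-- The `1`-morphism into the equifier given by an equifying `1`-morphism. -/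
noncomputable def equifierLift (H : Y ⟶ X) (hH : H ◁ φ = H ◁ ψ) : Y ⟶ equifier φ ψ :=
  Mor.mk (P := Y) (Q := equifier φ ψ)
    ((eqBase φ ψ).lift (Mor.base H) (base_app_congr hH))
    ((eqTotal φ ψ).lift (Mor.total H) (total_app_congr hH))
    (functor_fullSubcategory_ext (Mor.comm H))
    fun f χ h => eqProj_isStronglyCartesian (Mor.cartesian H f χ h)

/-- The `2`-morphism into the equifier given by a `2`-morphism of equifying `1`-morphisms. -/
noncomputable def equifierLiftHom {H H' : Y ⟶ X} (hH : H ◁ φ = H ◁ ψ) (hH' : H' ◁ φ = H' ◁ ψ) (κ : H ⟶ H') :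
    equifierLift H hH ⟶ equifierLift H' hH' :=
  Cell.mk (F := equifierLift H hH) (G := equifierLift H' hH')
    { app M := ObjectProperty.homMk ((Cell.base κ).app M)
      naturality _ _ f := ObjectProperty.hom_ext _ ((Cell.base κ).naturality f) }
    { app M := ObjectProperty.homMk ((Cell.total κ).app M)
      naturality _ _ f := ObjectProperty.hom_ext _ ((Cell.total κ).naturality f) }
    fun E => eqProj_isHomLift (Cell.comm κ E)

variable (φ ψ Y)

lemma isIsoFunctor_equifyComparison : IsIsoFunctor
    (equifyComparison (equifierInclusion φ ψ) (equifies_equifierInclusion φ ψ) Y) :=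
  ⟨{ obj H := equifierLift H.obj H.property
     map κ := equifierLiftHom _ _ κ.hom
     map_id _ := rfl
     map_comp _ _ := rfl }, rfl, functor_fullSubcategory_ext rfl⟩

end Equifiers

end Fib

/-! ### Inserters in `Fib` -/

section Inserter

variable {A : Type*} {C : Type*} [Category* A] [Category* C]

/-- The objects `(a, F a ⟶ G a)` of the inserter of two functors. -/
structure Inserter (F G : A ⥤ C) where
  obj : A
  cell : F.obj obj ⟶ G.obj obj

namespace Inserter

variable {F G : A ⥤ C}

/-- The morphisms of the inserter of two functors. -/
@[ext]
structure Hom (X Y : Inserter F G) where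
  hom : X.obj ⟶ Y.obj
  comm : X.cell ≫ G.map hom = F.map hom ≫ Y.cell

instance : Category (Inserter F G) where
  Hom X Y := Hom X Y
  id X := ⟨𝟙 X.obj, by simp⟩
  comp f g := ⟨f.hom ≫ g.hom, by
    rw [G.map_comp, ← Category.assoc, f.comm, Category.assoc, g.comm, F.map_comp,
      Category.assoc]⟩
  id_comp _ := Hom.ext (Category.id_comp _)
  comp_id _ := Hom.ext (Category.comp_id _)
  assoc _ _ _ := Hom.ext (Category.assoc _ _ _)

@[simp] lemma comp_hom {X Y Z : Inserter F G} (f : X ⟶ Y) (g : Y ⟶ Z) :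
    Hom.hom (f ≫ g) = f.hom ≫ g.hom := rfl

lemma hom_ext {X Y : Inserter F G} {f g : X ⟶ Y} (h : Hom.hom f = Hom.hom g) : f = g :=
  Hom.ext h

lemma hom_comm {X Y : Inserter F G} (f : X ⟶ Y) :
    X.cell ≫ G.map (Hom.hom f) = F.map (Hom.hom f) ≫ Y.cell := Hom.comm f

variable (F G) in
/-- The forgetful functor of the inserter. -/
def forget : Inserter F G ⥤ A where
  obj X := X.obj
  map f := f.hom

lemma ext_of_eqToHom {X Y : Inserter F G} (h : X.obj = Y.obj)
    (h' : X.cell ≫ G.map (eqToHom h) = F.map (eqToHom h) ≫ Y.cell) : X = Y := by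
  obtain ⟨X, x⟩ := X
  obtain ⟨Y, y⟩ := Y
  obtain rfl : X = Y := h
  obtain rfl : x = y := by simpa using h'
  rfl

lemma eqToHom_hom {X Y : Inserter F G} (h : X = Y) (h' : X.obj = Y.obj) :
    Hom.hom (eqToHom h) = eqToHom h' := by
  subst h
  rfl

end Inserter

end Inserter

namespace Fib

section Inserters

variable {X X' : Fib.{v, u}} (F G : Mor X X')

/-- The projection of the inserter. -/
def insProj : Inserter F.total G.total ⥤ Inserter F.base G.base where
  obj E := ⟨X.proj.obj E.obj,
    eqToHom (F.comm_obj E.obj).symm ≫ X'.proj.map E.cell ≫ eqToHom (G.comm_obj E.obj)⟩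
  map {E E'} f := ⟨X.proj.map f.hom, by
    have h := congrArg X'.proj.map f.comm
    rw [X'.proj.map_comp, X'.proj.map_comp] at h
    rw [Category.assoc, Category.assoc, ← G.proj_map, reassoc_of% h,
      ← cancel_epi (eqToHom (F.comm_obj E.obj)), ← reassoc_of% F.proj_map]
    simp⟩
  map_id E := Inserter.hom_ext (X.proj.map_id _)
  map_comp f g := Inserter.hom_ext (X.proj.map_comp _ _)

variable {F G}

lemma isHomLift_insProj_cell (E : Inserter F.total G.total) :
    X'.proj.IsHomLift ((insProj F G).obj E).cell E.cell :=
  inferInstanceAs (X'.proj.IsHomLift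
    (eqToHom (F.comm_obj E.obj).symm ≫ X'.proj.map E.cell ≫ eqToHom (G.comm_obj E.obj)) E.cell)

lemma insProj_obj_eq {M : Inserter F.base G.base} {E : Inserter F.total G.total}
    (hE : X.proj.obj E.obj = M.obj) (h : X'.proj.IsHomLift M.cell E.cell) :
    (insProj F G).obj E = M := by
  apply Inserter.ext_of_eqToHom hE
  change (eqToHom (F.comm_obj E.obj).symm ≫ X'.proj.map E.cell ≫ eqToHom (G.comm_obj E.obj)) ≫
    G.base.map (eqToHom hE) = F.base.map (eqToHom hE) ≫ M.cell
  rw [IsHomLift.fac' X'.proj M.cell E.cell]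
  simp [eqToHom_map]

lemma isHomLift_of_insProj {M N : Inserter F.base G.base} {E E' : Inserter F.total G.total}
    {f : M ⟶ N} {χ : E ⟶ E'} (h : (insProj F G).IsHomLift f χ) :
    X.proj.IsHomLift (Inserter.Hom.hom f) (Inserter.Hom.hom χ) := by
  cases h
  exact .map _

lemma insProj_isHomLift {M N : Inserter F.base G.base} {E E' : Inserter F.total G.total}
    {f : M ⟶ N} {χ : E ⟶ E'} (hE : (insProj F G).obj E = M) (hE' : (insProj F G).obj E' = N)
    (h : X.proj.IsHomLift (Inserter.Hom.hom f) (Inserter.Hom.hom χ)) :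
    (insProj F G).IsHomLift f χ :=
  isHomLift_of_unique _ _ _ hE hE' fun _ hf' =>
    Inserter.hom_ext (isHomLift_unique X.proj _ h (isHomLift_of_insProj hf'))

lemma insProj_isStronglyCartesian {M N : Inserter F.base G.base}
    {E E' : Inserter F.total G.total} {f : M ⟶ N} {χ : E ⟶ E'}
    (hE : (insProj F G).obj E = M) (hE' : (insProj F G).obj E' = N)
    (h : X.proj.IsStronglyCartesian (Inserter.Hom.hom f) (Inserter.Hom.hom χ)) :
    (insProj F G).IsStronglyCartesian f χ where
  toIsHomLift := insProj_isHomLift hE hE' h.toIsHomLift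
  universal_property' {Z} g η hη := by
    subst hE
    have hη : X.proj.IsHomLift (Inserter.Hom.hom g ≫ Inserter.Hom.hom f) (Inserter.Hom.hom η) :=
      isHomLift_of_insProj hη
    obtain ⟨κ, ⟨hκ, hκ'⟩, hu⟩ := Functor.IsStronglyCartesian.universal_property X.proj
      (Inserter.Hom.hom f) (Inserter.Hom.hom χ) (Inserter.Hom.hom g) _ rfl (Inserter.Hom.hom η)
    have hG := G.cartesian _ _ h
    have b₁ : X'.proj.IsHomLift (F.base.map (Inserter.Hom.hom g) ≫ ((insProj F G).obj E).cell)
        (F.total.map κ ≫ E.cell) :=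
      isHomLift_comp _ (F.isHomLift hκ) (isHomLift_insProj_cell E)
    have b₂ : X'.proj.IsHomLift (F.base.map (Inserter.Hom.hom g) ≫ ((insProj F G).obj E).cell)
        (Z.cell ≫ G.total.map κ) := by
      rw [← Inserter.hom_comm]
      exact isHomLift_comp _ (isHomLift_insProj_cell Z) (G.isHomLift hκ)
    -- Both composites lie over the same base morphism, by `b₁` and `b₂`, and agree after the
    -- Cartesian image of `χ` under `G`. So the factorisation `κ` respects the cells.
    have hc : Z.cell ≫ G.total.map κ = F.total.map κ ≫ E.cell := by
      refine Functor.IsStronglyCartesian.ext X'.proj (G.base.map (Inserter.Hom.hom f))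
        (G.total.map (Inserter.Hom.hom χ)) (F.base.map (Inserter.Hom.hom g) ≫
          ((insProj F G).obj E).cell) ?_
      rw [Category.assoc, Category.assoc, ← G.total.map_comp, hκ', Inserter.hom_comm,
        Inserter.hom_comm, ← hκ', F.total.map_comp, Category.assoc]
    exact ⟨⟨κ, hc⟩, ⟨insProj_isHomLift rfl rfl hκ, Inserter.hom_ext hκ'⟩,
      fun κ' h' => Inserter.hom_ext
        (hu _ ⟨isHomLift_of_insProj h'.1, congrArg Inserter.Hom.hom h'.2⟩)⟩

/-- The new cell is the factorisation over `M.cell` through the image of `χ` under `G`, which is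
Cartesian. Of `F` only the commuting square is used. -/
lemma exists_inserter_lift {M : Inserter F.base G.base} {E : Inserter F.total G.total}
    (f : M ⟶ (insProj F G).obj E) {E₀ : X.total} (χ : E₀ ⟶ E.obj)
    (hχ : X.proj.IsStronglyCartesian (Inserter.Hom.hom f) χ) :
    ∃ m : F.total.obj E₀ ⟶ G.total.obj E₀, X'.proj.IsHomLift M.cell m ∧
      m ≫ G.total.map χ = F.total.map χ ≫ E.cell := by
  have hG := G.cartesian _ _ hχ
  have hF : X'.proj.IsHomLift (F.base.map (Inserter.Hom.hom f) ≫ ((insProj F G).obj E).cell)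
      (F.total.map χ ≫ E.cell) :=
    isHomLift_comp _ (F.isHomLift hχ.toIsHomLift) (isHomLift_insProj_cell E)
  obtain ⟨m, hm, -⟩ := Functor.IsStronglyCartesian.universal_property X'.proj
    (G.base.map (Inserter.Hom.hom f)) (G.total.map χ) M.cell _ (Inserter.hom_comm f).symm
    (F.total.map χ ≫ E.cell)
  exact ⟨m, hm⟩

lemma exists_insProj_isStronglyCartesian {M : Inserter F.base G.base}
    {E : Inserter F.total G.total} (f : M ⟶ (insProj F G).obj E) :
    ∃ (E₀ : Inserter F.total G.total) (χ : E₀ ⟶ E), (insProj F G).IsStronglyCartesian f χ ∧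
      X.proj.IsStronglyCartesian (Inserter.Hom.hom f) (Inserter.Hom.hom χ) := by
  have h := X.cleavage.cartesian (X := E.obj) (Inserter.Hom.hom f)
  obtain ⟨m, hm, hm'⟩ := exists_inserter_lift f _ h
  exact ⟨⟨_, m⟩, ⟨_, hm'⟩,
    insProj_isStronglyCartesian (insProj_obj_eq (isHomLift_domain h.toIsHomLift) hm) rfl h, h⟩

lemma comp_insProj_eq {A B : Type*} [Category* A] [Category* B] {K : A ⥤ B}
    {H : B ⥤ Inserter F.base G.base} {H' : A ⥤ Inserter F.total G.total}
    (h : (H' ⋙ Inserter.forget _ _) ⋙ X.proj = K ⋙ H ⋙ Inserter.forget _ _)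
    (hf : ∀ E, X'.proj.IsHomLift (H.obj (K.obj E)).cell (H'.obj E).cell) :
    H' ⋙ insProj F G = K ⋙ H := by
  refine CategoryTheory.Functor.ext
    (fun E => insProj_obj_eq (Functor.congr_obj h E) (hf E)) fun E E' f => Inserter.hom_ext ?_
  rw [Inserter.comp_hom, Inserter.comp_hom, Inserter.eqToHom_hom _ (Functor.congr_obj h E),
    Inserter.eqToHom_hom _ (Functor.congr_obj h E').symm]
  exact Functor.congr_hom h f

end Inserters

section InserterFib

variable {X X' : Fib.{v, max u v}} (F G : X ⟶ X')

/-- The inserter of two `1`-morphisms. -/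
noncomputable def inserter : Fib.{v, max u v} where
  total := Inserter (Mor.total F) (Mor.total G)
  base := Inserter (Mor.base F) (Mor.base G)
  proj := insProj F G
  cleavage :=
    { obj f := (exists_insProj_isStronglyCartesian f).choose
      lift f := (exists_insProj_isStronglyCartesian f).choose_spec.choose
      cartesian f := (exists_insProj_isStronglyCartesian f).choose_spec.choose_spec.1 }

/-- The forgetful `1`-morphism of the inserter. -/
noncomputable def inserterForget : inserter.{v, u} F G ⟶ X :=
  Mor.mk (P := inserter.{v, u} F G) (Q := X) (Inserter.forget _ _) (Inserter.forget _ _) rfl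
    (preserves_cartesian_of_exists _ _ (fun _ _ h => isHomLift_of_insProj h)
      exists_insProj_isStronglyCartesian)

/-- The universal `2`-morphism of the inserter. -/
noncomputable def inserterCell : inserterForget.{v, u} F G ≫ F ⟶ inserterForget.{v, u} F G ≫ G :=
  Cell.mk (F := inserterForget.{v, u} F G ≫ F) (G := inserterForget.{v, u} F G ≫ G)
    { app (M : Inserter (Mor.base F) (Mor.base G)) := M.cell
      naturality _ _ f := (Inserter.hom_comm (F := Mor.base F) (G := Mor.base G) f).symm }
    { app (E : Inserter (Mor.total F) (Mor.total G)) := E.cell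
      naturality _ _ f := (Inserter.hom_comm (F := Mor.total F) (G := Mor.total G) f).symm }
    fun E => isHomLift_insProj_cell (F := F) (G := G) E

variable {F G} {Y : Fib.{v, max u v}}

/-- The `1`-morphism into the inserter given by an inserter cone. -/
noncomputable def inserterLift (H : Y ⟶ X) (w : H ≫ F ⟶ H ≫ G) : Y ⟶ inserter.{v, u} F G :=
  have hw : ∀ E, X'.proj.IsHomLift ((Cell.base w).app (Y.proj.obj E)) ((Cell.total w).app E) :=
    Cell.comm w
  Mor.mk (P := Y) (Q := inserter.{v, u} F G)
    { obj M := ⟨(Mor.base H).obj M, (Cell.base w).app M⟩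
      map f := ⟨(Mor.base H).map f, ((Cell.base w).naturality f).symm⟩
      map_id M := Inserter.hom_ext ((Mor.base H).map_id M)
      map_comp f g := Inserter.hom_ext ((Mor.base H).map_comp f g) }
    { obj M := ⟨(Mor.total H).obj M, (Cell.total w).app M⟩
      map f := ⟨(Mor.total H).map f, ((Cell.total w).naturality f).symm⟩
      map_id M := Inserter.hom_ext ((Mor.total H).map_id M)
      map_comp f g := Inserter.hom_ext ((Mor.total H).map_comp f g) }
    (comp_insProj_eq (F := F) (G := G) (Mor.comm H) hw)
    fun {_ _ E E'} f χ h => by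
      refine insProj_isStronglyCartesian (F := F) (G := G) ?_ ?_ (Mor.cartesian H f χ h)
      · obtain rfl := IsHomLift.domain_eq Y.proj f χ
        exact insProj_obj_eq (Mor.comm_obj H E) (hw E)
      · obtain rfl := IsHomLift.codomain_eq Y.proj f χ
        exact insProj_obj_eq (Mor.comm_obj H E') (hw E')

/-- With `w` a variable, the associators disappear by substitution and the cone of `H` gives back
`H` definitionally; this yields injectivity on objects. -/
lemma inserterLift_cell (H : Y ⟶ inserter.{v, u} F G)
    (w : (H ≫ inserterForget.{v, u} F G) ≫ F ⟶ (H ≫ inserterForget.{v, u} F G) ≫ G)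
    (hw : w = (α_ _ _ _).hom ≫ H ◁ inserterCell.{v, u} F G ≫ (α_ _ _ _).inv) :
    inserterLift (H ≫ inserterForget.{v, u} F G) w = H := by
  obtain rfl : w = H ◁ inserterCell.{v, u} F G :=
    hw.trans ((Category.id_comp _).trans (Category.comp_id _))
  rfl

variable (F G Y)

lemma isIsoFunctor_insertComparison : IsIsoFunctor
    (insertComparison (inserterForget.{v, u} F G) (inserterCell.{v, u} F G) Y) := by
  refine isIsoFunctor_of_bijective _ (fun {H H'} k => ?_) (fun {H H' f g} e => ?_)
    (fun {H H'} e => ?_) fun Z => ?_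
  -- Compatibility with the cells makes every component of `κ` a morphism of the inserter
  -- categories, hence `κ` lifts.
  · let κ : H ≫ inserterForget.{v, u} F G ⟶ H' ≫ inserterForget.{v, u} F G := InsertObj.Hom.hom k
    have e : ((α_ _ _ _).hom ≫ H ◁ inserterCell.{v, u} F G ≫ (α_ _ _ _).inv) ≫ κ ▷ G =
        κ ▷ F ≫ (α_ _ _ _).hom ≫ H' ◁ inserterCell.{v, u} F G ≫ (α_ _ _ _).inv :=
      InsertObj.Hom.comm k
    have eb : ∀ M, (Cell.base (inserterCell.{v, u} F G)).app ((Mor.base H).obj M) ≫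
        (Mor.base G).map ((Cell.base κ).app M) = (Mor.base F).map ((Cell.base κ).app M) ≫
        (Cell.base (inserterCell.{v, u} F G)).app ((Mor.base H').obj M) := fun M => by
      simpa using base_app_congr e M
    have et : ∀ M, (Cell.total (inserterCell.{v, u} F G)).app ((Mor.total H).obj M) ≫
        (Mor.total G).map ((Cell.total κ).app M) = (Mor.total F).map ((Cell.total κ).app M) ≫
        (Cell.total (inserterCell.{v, u} F G)).app ((Mor.total H').obj M) := fun M => by
      simpa using total_app_congr e M
    exact ⟨Cell.mk (F := H) (G := H')
      { app M := ⟨(Cell.base κ).app M, eb M⟩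
        naturality M N x := Inserter.hom_ext ((Cell.base κ).naturality x) }
      { app M := ⟨(Cell.total κ).app M, et M⟩
        naturality M N x := Inserter.hom_ext ((Cell.total κ).naturality x) }
      fun E => insProj_isHomLift (F := F) (G := G) (Mor.comm_obj H E) (Mor.comm_obj H' E)
        (Cell.comm κ E), rfl⟩
  · have e : f ▷ inserterForget.{v, u} F G = g ▷ inserterForget.{v, u} F G :=
      congrArg InsertObj.Hom.hom e
    exact hom_ext_app (fun M => Inserter.hom_ext (base_app_congr e M))
      fun M => Inserter.hom_ext (total_app_congr e M)
  · have key : ∀ H : Y ⟶ inserter.{v, u} F G, inserterLift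
        ((insertComparison (inserterForget.{v, u} F G) (inserterCell.{v, u} F G) Y).obj H).obj
        ((insertComparison (inserterForget.{v, u} F G) (inserterCell.{v, u} F G) Y).obj H).cell =
        H := fun H => inserterLift_cell H _ rfl
    rw [← key H, e, key]
  · refine ⟨inserterLift Z.obj Z.cell, ?_⟩
    obtain ⟨H, w⟩ := Z
    refine congrArg (InsertObj.mk H) ?_
    exact (Category.id_comp _).trans (Category.comp_id _)

end InserterFib

/-- `Fib` admits PIE limits. -/
theorem admitsPIELimits : AdmitsPIELimits.{v} Fib.{v, max u v} where
  products _ A := ⟨_, _, isIsoFunctor_prodComparison.{v, u} A⟩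
  inserters F G := ⟨_, _, _, isIsoFunctor_insertComparison.{v, u} F G⟩
  equifiers φ ψ := ⟨_, _, _, isIsoFunctor_equifyComparison φ ψ⟩

end Fib

end TangentFib

theorem mainTheorem9 :
    TangentFib.AdmitsPIELimits.{v} TangentFib.Fib.{v, max u v} ∧
    TangentFib.AdmitsVectorFields TangentFib.Fib.{v, max u v} ∧
    ∀ (P : TangentFib.Fib.{v, max u v}) (D : TangentFib.TangentData P)
      (h : TangentFib.Fib.IsTangentFibration D),
      ∃ E : TangentFib.TangentData (TangentFib.Fib.VF.{v, u} D),
        TangentFib.Fib.totalData E = h.total.vf ∧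
        TangentFib.Fib.baseData E = h.base.vf ∧
        TangentFib.Fib.IsTangentFibration E ∧
        ∃ (hD : D.IsTangentad) (hE : E.IsTangentad),
          TangentFib.Fib.IsTangentadOfVectorFields.{v, u} hD E hE := by
  refine ⟨TangentFib.Fib.admitsPIELimits.{v, u}, TangentFib.Fib.admitsVectorFields.{v, u},
    fun P D h => ⟨TangentFib.Fib.vfData.{v, u} h, TangentFib.Fib.totalData_vfData h,
      TangentFib.Fib.baseData_vfData h,
      TangentFib.Fib.isTangentFibration_vfData h, h.isTangentad,
      (TangentFib.Fib.isTangentFibration_vfData h).isTangentad, ?_⟩⟩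
  exact TangentFib.Fib.isTangentadOfVectorFields_vfData h _ _
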